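/- **Conventions.** Let $\epsilon_{ijk}$ be the Levi-Civita symbol and $X_1,X_2,X_3$ the basis of $\mathfrak{so}(3)$ with $(X_i)_{jk}=-\epsilon_{ijk}$. Let $(V_k,\rho_k)$ be the irreducible $k$-dimensional complex representation of $\mathfrak{so}(3)$, realized on $\mathbb{C}^k$ by the standard (skew-Hermitian) spin matrices. Let $n\geq 2$, $N=2n+2$, $Y_i^+=\rho_{n+2}(X_i)$, $Y_i^-=\rho_n(X_i)$. There are linear maps $B_1,B_2,B_3:\mathbb{C}^n\to\mathbb{C}^{n+2}$ with $$Y_j^+B_k-B_kY_j^-=\sum_{i=1}^3\epsilon_{ijk}B_i\quad (j,k\in\{1,2,3\}),\qquad \sum_{i=1}^3B_iB_i^*=\mathbb{1}_{n+2};$$ fix any such triple. A solution of Nahm's equations on an open interval $I$ is a triple $\mathcal{T}=(T_1,T_2,T_3)$ of functions $I\to\mathfrak{su}(N)$ with $\dot T_i=\tfrac12\sum_{j,k}\epsilon_{ijk}[T_j,T_k]$. It is spherically symmetric if for every $A\in\mathrm{SO}(3)$ there is $U\in\mathrm{SU}(N)$ with $\sum_jA_{ij}T_j=U^{-1}T_iU$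 on $I$ for all $i$. A representation $\rho:\mathfrak{so}(3)\to\mathfrak{su}(N)$ generates the spherical symmetry of $\mathcal{T}$ if $[\rho(X_i),T_j]=\sum_k\epsilon_{ijk}T_k$ on $I$ for all $i,j$ (this implies that $\mathcal{T}$ is spherically symmetric). $\mathcal{T}$ is irreducible if no proper nonzero subspace of $\mathbb{C}^N$ is invariant under all $T_i(t)$, $t\in I$. If $\mathcal{T}$ has simple poles at $t_0$, the representation that it induces at $t_0$ is $X_i\mapsto-\mathrm{Res}(T_i,t_0)$. **Theorem.** Let $n\geq2$. (1) Let $\mathcal{T}$ be a solution of Nahm's equations on a nonempty open interval $I$, whose spherical symmetry is generated by a representation $\rho\simeq V_{n+2}\oplus V_n$. Then in some gauge, that is, after conjugation by a constant $U\in\mathrm{SU}(N)$, which can be chosen so that also $U\rho(X_i)U^{-1}=\mathrm{diag}(Y_i^+,Y_i^-)$, there are real analytic functions $f^+,f^-,g:I\to\mathbb{R}$ with $$T_i=\begin{pmatrix}f^+Y_i^+&gB_i\\-gB_i^*&f^-Y_i^-\end{pmatrix}\quad(i=1,2,3),\tag{a}$$ and they satisfy $$\dot f^+=(f^+)^2+\tfrac{2}{n+1}g^2,\qquad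 \dot g=\left(\tfrac{n+3}{2}f^+-\tfrac{n-1}{2}f^-\right)g,\qquad \dot f^-=(f^-)^2-\tfrac{2(n+2)}{n(n+1)}g^2.\tag{b}$$ (2) The functions $$f^+(t)=-\frac{(n+1)t+(n-1)}{(n+1)(t^2-1)},\qquad f^-(t)=-\frac{(n+1)t+(n+3)}{(n+1)(t^2-1)},\qquad g(t)=\sqrt{\frac{2n}{n+1}}\,\frac{1}{t^2-1}$$ solve (b) on $(-1,1)$, and this solution has no extension to a larger open interval. The triple $\mathcal{T}$ that they define by (a) is an irreducible, spherically symmetric solution of Nahm's equations on $(-1,1)$, whose symmetry is generated by $X_i\mapsto\mathrm{diag}(Y_i^+,Y_i^-)$. The functions have simple poles at $\pm1$ with residues $$\mathrm{Res}(f^+,1)=-\tfrac{n}{n+1},\quad \mathrm{Res}(f^+,-1)=-\tfrac{1}{n+1},\quad \mathrm{Res}(f^-,1)=-\tfrac{n+2}{n+1},\quad \mathrm{Res}(f^-,-1)=\tfrac{1}{n+1},\quad \mathrm{Res}(g,\pm1)=\pm\sqrt{\tfrac{n}{2(n+1)}}.$$ (3) The representation of $\mathfrak{so}(3)$ that this $\mathcal{T}$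 induces is isomorphic to $V_{n+1}^{\oplus2}$ at $t=1$ and to $V_2^{\oplus(n+1)}$ at $t=-1$. -/

import Mathlib

open Matrix Filter Topology

attribute [local instance] LieRing.ofAssociativeRing

noncomputable section

namespace Nahm

/-- The Levi-Civita symbol on three indices. -/
def eps (i j k : Fin 3) : ℝ :=
  (((j : ℕ) : ℝ) - ((i : ℕ) : ℝ)) * (((k : ℕ) : ℝ) - ((i : ℕ) : ℝ)) *
    (((k : ℕ) : ℝ) - ((j : ℕ) : ℝ)) / 2

/-! ### The Lie algebra `so(3)`, its complex matrix representations, the irreducible ones -/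

/-- The real Lie algebra of skew-symmetric 3 by 3 matrices. -/
abbrev so3 : LieSubalgebra ℝ (Matrix (Fin 3) (Fin 3) ℝ) := LieAlgebra.Orthogonal.so (Fin 3) ℝ

/-- The standard basis of `so(3)`: `(X i) j k = - eps i j k`. -/
def X (i : Fin 3) : so3 :=
  ⟨Matrix.of fun j k => - eps i j k, by
    rw [LieAlgebra.Orthogonal.mem_so]
    ext j k
    simp only [Matrix.transpose_apply, Matrix.of_apply, Matrix.neg_apply, eps]
    ring⟩

/-- A representation of `so(3)` on the complex vector space `ι → ℂ`, given by matrices. -/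
abbrev Rep (ι : Type*) [Fintype ι] [DecidableEq ι] := so3 →ₗ⁅ℝ⁆ Matrix ι ι ℂ

/-- The representation that sends `X i` to `Y i`, for a triple of matrices that satisfies the
commutator relations of `so(3)`. -/
def Rep.ofTriple {ι : Type*} [Fintype ι] [DecidableEq ι] (Y : Fin 3 → Matrix ι ι ℂ)
    (h01 : ⁅Y 0, Y 1⁆ = Y 2) (h12 : ⁅Y 1, Y 2⁆ = Y 0) (h20 : ⁅Y 2, Y 0⁆ = Y 1) : Rep ι where
  toFun A := A.1 2 1 • Y 0 + A.1 0 2 • Y 1 + A.1 1 0 • Y 2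
  map_add' A B := by
    have h : ∀ i j, (A + B).1 i j = A.1 i j + B.1 i j := fun _ _ => rfl
    simp only [h, add_smul]
    abel
  map_smul' c A := by
    have h : ∀ i j, (c • A).1 i j = c * A.1 i j := fun _ _ => rfl
    simp only [h, mul_smul, smul_add, RingHom.id_apply]
  map_lie' := by
    intro A B
    have hs : ∀ (C : so3) (i j : Fin 3), C.1 i j = - C.1 j i := by
      intro C i j
      have h := (LieAlgebra.Orthogonal.mem_so (Fin 3) ℝ C.1).1 C.2
      have h2 := congrFun (congrFun h j) i
      simpa using h2
    have h10 : ⁅Y 1, Y 0⁆ = - Y 2 := by rw [← lie_skew, h01]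
    have h21 : ⁅Y 2, Y 1⁆ = - Y 0 := by rw [← lie_skew, h12]
    have h02 : ⁅Y 0, Y 2⁆ = - Y 1 := by rw [← lie_skew, h20]
    have hd : ∀ (C : so3) (i : Fin 3), C.1 i i = 0 := by
      intro C i
      have := hs C i i
      linarith
    simp only [LieSubalgebra.coe_bracket, Ring.lie_def, Matrix.sub_apply, Matrix.mul_apply,
      Fin.sum_univ_three, hd]
    rw [hs A 1 2, hs A 2 0, hs A 0 1, hs B 1 2, hs B 2 0, hs B 0 1]
    simp only [← Ring.lie_def, lie_add, add_lie, lie_smul, smul_lie, h01, h12, h20, h10, h21,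
      h02, lie_self, smul_zero]
    module

/-- The raising matrix of size `k`: its only nonzero entries are
`√((a + 1) (k - 1 - a))` at the places `(a, a + 1)`, with indices that start at `0`. -/
def raising (k : ℕ) : Matrix (Fin k) (Fin k) ℂ :=
  Matrix.of fun a b => if (a : ℕ) + 1 = (b : ℕ) then
    ((Real.sqrt ((((a : ℕ) : ℝ) + 1) * ((k : ℝ) - 1 - ((a : ℕ) : ℝ))) : ℝ) : ℂ) else 0

/-- The spin matrices of size `k` (in a basis of weight vectors for `X 0`): the standard
skew-Hermitian generators of the irreducible representation of dimension `k`. -/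
def spinMatrix (k : ℕ) : Fin 3 → Matrix (Fin k) (Fin k) ℂ :=
  ![Matrix.diagonal fun a => Complex.I / 2 * ((k : ℂ) - 1 - 2 * ((a : ℕ) : ℂ)),
    (1 / 2 : ℂ) • (raising k - (raising k)ᵀ),
    (Complex.I / 2) • (raising k + (raising k)ᵀ)]

theorem raising_mul_transpose (k : ℕ) : raising k * (raising k)ᵀ =
    Matrix.diagonal fun a : Fin k => (((a : ℕ) : ℂ) + 1) * ((k : ℂ) - 1 - ((a : ℕ) : ℂ)) := by
  ext a b
  rw [Matrix.mul_apply, Matrix.diagonal_apply]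
  simp only [raising, Matrix.of_apply, Matrix.transpose_apply]
  by_cases hab : a = b
  · subst hab
    rw [if_pos rfl]
    have ha : (0 : ℝ) ≤ (((a : ℕ) : ℝ) + 1) * ((k : ℝ) - 1 - ((a : ℕ) : ℝ)) := by
      have h1 : (((a : ℕ) + 1 : ℕ) : ℝ) ≤ (k : ℝ) := by exact_mod_cast a.2
      push_cast at h1
      exact mul_nonneg (by positivity) (by linarith)
    by_cases hk : (a : ℕ) + 1 < k
    · rw [Finset.sum_eq_single (⟨(a : ℕ) + 1, hk⟩ : Fin k)]
      · simp only [if_true]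
        rw [← Complex.ofReal_mul, Real.mul_self_sqrt ha]
        push_cast
        ring
      · intro c _ hc
        rw [if_neg (fun h => hc (Fin.ext h.symm)), zero_mul]
      · intro h
        exact absurd (Finset.mem_univ _) h
    · rw [Finset.sum_eq_zero]
      · have h1 : (a : ℕ) + 1 = k := by have := a.2; omega
        have h2 : (k : ℂ) = ((a : ℕ) : ℂ) + 1 := by exact_mod_cast h1.symm
        rw [h2]
        ring
      · intro c _
        rw [if_neg (by have := c.2; omega), zero_mul]
  · rw [if_neg hab]
    refine Finset.sum_eq_zero fun c _ => ?_
    by_cases h1 : (a : ℕ) + 1 = c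
    · rw [if_neg (c := (b : ℕ) + 1 = c) (fun h => hab (Fin.ext (by omega))), mul_zero]
    · rw [if_neg h1, zero_mul]

theorem transpose_mul_raising (k : ℕ) : (raising k)ᵀ * raising k =
    Matrix.diagonal fun a : Fin k => ((a : ℕ) : ℂ) * ((k : ℂ) - ((a : ℕ) : ℂ)) := by
  ext a b
  rw [Matrix.mul_apply, Matrix.diagonal_apply]
  simp only [raising, Matrix.of_apply, Matrix.transpose_apply]
  by_cases hab : a = b
  · subst hab
    rw [if_pos rfl]
    by_cases hk : (a : ℕ) = 0
    · rw [Finset.sum_eq_zero]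
      · simp [hk]
      · intro c _
        rw [if_neg (by omega), zero_mul]
    · have hlt : (a : ℕ) - 1 < k := by have := a.2; omega
      have hs : (a : ℕ) - 1 + 1 = a := by omega
      rw [Finset.sum_eq_single (⟨(a : ℕ) - 1, hlt⟩ : Fin k)]
      · simp only [hs, if_true]
        have hc : (((a : ℕ) - 1 : ℕ) : ℝ) = ((a : ℕ) : ℝ) - 1 := by
          rw [Nat.cast_sub (by omega), Nat.cast_one]
        rw [← Complex.ofReal_mul, Real.mul_self_sqrt, hc]
        · push_cast
          ring
        · have h1 : ((a : ℕ) : ℝ) ≤ (k : ℝ) := by exact_mod_cast a.2.le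
          rw [hc]
          exact mul_nonneg (by rw [sub_add_cancel]; positivity) (by linarith)
      · intro c _ hc
        rw [if_neg (fun h => hc (Fin.ext (by simp only; omega))), zero_mul]
      · intro h
        exact absurd (Finset.mem_univ _) h
  · rw [if_neg hab]
    refine Finset.sum_eq_zero fun c _ => ?_
    by_cases h1 : (c : ℕ) + 1 = a
    · rw [if_neg (c := (c : ℕ) + 1 = b) (fun h => hab (Fin.ext (by omega))), mul_zero]
    · rw [if_neg h1, zero_mul]

theorem spinMatrix_lie01 (k : ℕ) : ⁅spinMatrix k 0, spinMatrix k 1⁆ = spinMatrix k 2 := by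
  ext a b
  simp only [spinMatrix, Ring.lie_def, Matrix.cons_val_zero, Matrix.cons_val_one,
    Matrix.cons_val, Matrix.sub_apply, Matrix.diagonal_mul, Matrix.mul_diagonal,
    Matrix.smul_apply, Matrix.add_apply, Matrix.transpose_apply, raising, Matrix.of_apply,
    smul_eq_mul]
  by_cases h1 : (a : ℕ) + 1 = b
  · have h2 : ¬ ((b : ℕ) + 1 = a) := by omega
    have h3 : ((b : ℕ) : ℂ) = ((a : ℕ) : ℂ) + 1 := by exact_mod_cast h1.symm
    rw [if_pos h1, if_neg h2, h3]
    ring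
  · by_cases h2 : (b : ℕ) + 1 = a
    · have h3 : ((a : ℕ) : ℂ) = ((b : ℕ) : ℂ) + 1 := by exact_mod_cast h2.symm
      rw [if_neg h1, if_pos h2, h3]
      ring
    · rw [if_neg h1, if_neg h2]
      ring

theorem spinMatrix_lie12 (k : ℕ) : ⁅spinMatrix k 1, spinMatrix k 2⁆ = spinMatrix k 0 := by
  have h : ⁅spinMatrix k 1, spinMatrix k 2⁆ =
      (Complex.I / 2) • (raising k * (raising k)ᵀ - (raising k)ᵀ * raising k) := by
    simp only [spinMatrix, Ring.lie_def, Matrix.cons_val_one, Matrix.cons_val,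
      smul_mul_assoc, mul_smul_comm, mul_add, add_mul, mul_sub, sub_mul]
    module
  rw [h, raising_mul_transpose, transpose_mul_raising, Matrix.diagonal_sub,
    ← Matrix.diagonal_smul]
  simp only [spinMatrix, Matrix.cons_val_zero]
  congr 1
  funext a
  simp only [Pi.smul_apply, smul_eq_mul]
  ring

theorem spinMatrix_lie20 (k : ℕ) : ⁅spinMatrix k 2, spinMatrix k 0⁆ = spinMatrix k 1 := by
  ext a b
  simp only [spinMatrix, Ring.lie_def, Matrix.cons_val_zero, Matrix.cons_val_one,
    Matrix.cons_val, Matrix.sub_apply, Matrix.diagonal_mul, Matrix.mul_diagonal,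
    Matrix.smul_apply, Matrix.add_apply, Matrix.transpose_apply, raising, Matrix.of_apply,
    smul_eq_mul]
  have hI := Complex.I_mul_I
  by_cases h1 : (a : ℕ) + 1 = b
  · have h2 : ¬ ((b : ℕ) + 1 = a) := by omega
    have h3 : ((b : ℕ) : ℂ) = ((a : ℕ) : ℂ) + 1 := by exact_mod_cast h1.symm
    rw [if_pos h1, if_neg h2, h3]
    ring_nf
    rw [Complex.I_sq]
    ring
  · by_cases h2 : (b : ℕ) + 1 = a
    · have h3 : ((a : ℕ) : ℂ) = ((b : ℕ) : ℂ) + 1 := by exact_mod_cast h2.symm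
      rw [if_neg h1, if_pos h2, h3]
      ring_nf
      rw [Complex.I_sq]
      ring
    · rw [if_neg h1, if_neg h2]
      ring

/-- The irreducible complex representation `V k` of `so(3)` of dimension `k`. -/
def V (k : ℕ) : Rep (Fin k) :=
  Rep.ofTriple (spinMatrix k) (spinMatrix_lie01 k) (spinMatrix_lie12 k) (spinMatrix_lie20 k)

theorem V_X (k : ℕ) (i : Fin 3) : V k (X i) = spinMatrix k i := by
  fin_cases i <;> simp [V, Rep.ofTriple, X, eps] <;> norm_num

/-- The direct sum of two representations. -/
def Rep.sum {ι κ : Type*} [Fintype ι] [DecidableEq ι] [Fintype κ] [DecidableEq κ]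
    (ρ : Rep ι) (σ : Rep κ) : Rep (ι ⊕ κ) where
  toFun A := Matrix.fromBlocks (ρ A) 0 0 (σ A)
  map_add' A B := by simp [Matrix.fromBlocks_add]
  map_smul' c A := by simp [Matrix.fromBlocks_smul]
  map_lie' := by
    intro A B
    simp [Ring.lie_def, Matrix.fromBlocks_multiply, sub_eq_add_neg, Matrix.fromBlocks_neg,
      Matrix.fromBlocks_add]

/-- The direct sum of `m` copies of a representation. -/
def Rep.copies {ι : Type*} [Fintype ι] [DecidableEq ι] (m : ℕ) (ρ : Rep ι) :
    Rep (ι × Fin m) where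
  toFun A := Matrix.blockDiagonal fun _ => ρ A
  map_add' A B := by
    rw [← Matrix.blockDiagonal_add]
    congr 1
    funext _
    simp
  map_smul' c A := by
    rw [RingHom.id_apply, ← Matrix.blockDiagonal_smul]
    congr 1
    funext _
    simp
  map_lie' := by
    intro A B
    rw [Ring.lie_def, ← Matrix.blockDiagonal_mul, ← Matrix.blockDiagonal_mul,
      ← Matrix.blockDiagonal_sub]
    congr 1
    funext _
    simp [Ring.lie_def]

/-- Isomorphism of complex representations of `so(3)`. -/
def Rep.Iso {ι κ : Type*} [Fintype ι] [DecidableEq ι] [Fintype κ] [DecidableEq κ]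
    (ρ : Rep ι) (σ : Rep κ) : Prop :=
  ∃ P : (ι → ℂ) ≃ₗ[ℂ] (κ → ℂ), ∀ (A : so3) (v : ι → ℂ), P (ρ A *ᵥ v) = σ A *ᵥ P v

/-! ### Nahm's equations and spherical symmetry -/

section General

variable {ι : Type*} [Fintype ι] [DecidableEq ι]

/-- Membership in `su(N)`: skew-Hermitian and traceless. -/
def IsSu (A : Matrix ι ι ℂ) : Prop := Aᴴ = - A ∧ A.trace = 0

/-- `T` is a solution on `I`, with values in `su(N)`, of Nahm's equations
`dT i / dt = 1/2 * ∑ j k, eps i j k * [T j, T k]`. -/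
def IsNahmSolution (T : ℝ → Fin 3 → Matrix ι ι ℂ) (I : Set ℝ) : Prop :=
  (∀ t ∈ I, ∀ i, IsSu (T t i)) ∧
  ∀ t ∈ I, ∀ i a b, HasDerivAt (fun s => T s i a b)
    (((1 / 2 : ℝ) • ∑ j, ∑ k, eps i j k • ⁅T t j, T t k⁆) a b) t

/-- Equivariance under all rotations: for every `A` in `SO(3)` there is a (constant) `U` in
`SU(N)` with `∑ j, A i j * T j = U⁻¹ * T i * U` on `I`. -/
def IsSphericallySymmetric (T : ℝ → Fin 3 → Matrix ι ι ℂ) (I : Set ℝ) : Prop :=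
  ∀ A ∈ Matrix.specialOrthogonalGroup (Fin 3) ℝ, ∃ U ∈ Matrix.specialUnitaryGroup ι ℂ,
    ∀ t ∈ I, ∀ i, ∑ j, A i j • T t j = Uᴴ * T t i * U

/-- The matrices `ρ (X i)` lie in `su(N)` and are generators of the spherical symmetry of `T`
on `I`: `[ρ (X i), T j] = ∑ k, eps i j k * T k`. -/
def GeneratesSymmetry (ρ : Rep ι) (T : ℝ → Fin 3 → Matrix ι ι ℂ) (I : Set ℝ) : Prop :=
  (∀ i, IsSu (ρ (X i))) ∧ ∀ t ∈ I, ∀ i j, ⁅ρ (X i), T t j⁆ = ∑ k, eps i j k • T t k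

/-- No proper nonzero subspace is invariant under all `T i t`, `t ∈ I`. -/
def IsIrreducible (T : ℝ → Fin 3 → Matrix ι ι ℂ) (I : Set ℝ) : Prop :=
  ∀ W : Submodule ℂ (ι → ℂ), (∀ t ∈ I, ∀ i, ∀ v ∈ W, T t i *ᵥ v ∈ W) → W = ⊥ ∨ W = ⊤

/-- Near `t₀` the function `f` is the sum of `r / (t - t₀)` and an analytic function: it has a
simple pole with residue `r` (no pole if `r = 0`). -/
def HasResidue {E : Type*} [NormedAddCommGroup E] [NormedSpace ℝ E]
    (f : ℝ → E) (t₀ : ℝ) (r : E) : Prop :=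
  ∃ h : ℝ → E, AnalyticAt ℝ h t₀ ∧ ∀ᶠ t in 𝓝[≠] t₀, f t = (t - t₀)⁻¹ • r + h t

/-- `T` has at most simple poles at `t₀`, and the representation `X i ↦ - Res (T i, t₀)` of
`so(3)` is isomorphic to `τ`. The sign: Nahm's equations give `R 0 = - [R 1, R 2]` and so on
for the residues `R i`, hence it is the matrices `- R i` that obey the relations of the `X i`. -/
def ResiduesInduce {κ : Type*} [Fintype κ] [DecidableEq κ]
    (T : ℝ → Fin 3 → Matrix ι ι ℂ) (t₀ : ℝ) (τ : Rep κ) : Prop :=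
  ∃ (R : Fin 3 → Matrix ι ι ℂ) (σ : Rep ι),
    (∀ i a b, HasResidue (fun t => T t i a b) t₀ (R i a b)) ∧
    (∀ i, σ (X i) = - R i) ∧ σ.Iso τ

end General

/-! ### The Ansatz for `V (n + 2) ⊕ V n` -/

/-- `B` is the invariant triple of maps from `V n` to `V (n + 2)`, normalized by
`∑ i, B i * (B i)ᴴ = 1` (which leaves a phase factor free). -/
def IsInvariantTriple (n : ℕ) (B : Fin 3 → Matrix (Fin (n + 2)) (Fin n) ℂ) : Prop :=
  (∀ j k, V (n + 2) (X j) * B k - B k * V n (X j) = ∑ i, eps i j k • B i) ∧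
  ∑ i, B i * (B i)ᴴ = 1

/-- The triple of block matrices `[[fp * Y⁺, g * B], [- g * Bᴴ, fm * Y⁻]]`. -/
def ansatz (n : ℕ) (B : Fin 3 → Matrix (Fin (n + 2)) (Fin n) ℂ) (fp g fm : ℝ → ℝ)
    (t : ℝ) (i : Fin 3) : Matrix (Fin (n + 2) ⊕ Fin n) (Fin (n + 2) ⊕ Fin n) ℂ :=
  Matrix.fromBlocks (fp t • V (n + 2) (X i)) (g t • B i) (- (g t • (B i)ᴴ)) (fm t • V n (X i))

/-- The reduced system of ordinary differential equations on `I`. -/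
def SolvesReduced (n : ℕ) (fp g fm : ℝ → ℝ) (I : Set ℝ) : Prop :=
  ∀ t ∈ I,
    HasDerivAt fp (fp t ^ 2 + 2 / ((n : ℝ) + 1) * g t ^ 2) t ∧
    HasDerivAt g ((((n : ℝ) + 3) / 2 * fp t - ((n : ℝ) - 1) / 2 * fm t) * g t) t ∧
    HasDerivAt fm (fm t ^ 2 - 2 * ((n : ℝ) + 2) / ((n : ℝ) * ((n : ℝ) + 1)) * g t ^ 2) t

/-- A solution of the reduced system on `I` that has no extension to a larger open interval. -/
def IsMaximalReduced (n : ℕ) (fp g fm : ℝ → ℝ) (I : Set ℝ) : Prop :=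
  SolvesReduced n fp g fm I ∧
  ∀ (J : Set ℝ) (fp' g' fm' : ℝ → ℝ), IsOpen J → IsConnected J → I ⊆ J →
    SolvesReduced n fp' g' fm' J →
    (∀ t ∈ I, fp' t = fp t ∧ g' t = g t ∧ fm' t = fm t) → J = I

/-- The function `f⁺` of the explicit solution. -/
def fPlus (n : ℕ) (t : ℝ) : ℝ :=
  - ((((n : ℝ) + 1) * t + ((n : ℝ) - 1)) / (((n : ℝ) + 1) * (t ^ 2 - 1)))

/-- The function `f⁻` of the explicit solution. -/
def fMinus (n : ℕ) (t : ℝ) : ℝ :=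
  - ((((n : ℝ) + 1) * t + ((n : ℝ) + 3)) / (((n : ℝ) + 1) * (t ^ 2 - 1)))

/-- The function `g` of the explicit solution. -/
def gExplicit (n : ℕ) (t : ℝ) : ℝ :=
  Real.sqrt (2 * (n : ℝ) / ((n : ℝ) + 1)) * (1 / (t ^ 2 - 1))

end Nahm

end

/-!
Nahm's equations are quadratic, and on triples of matrices their right-hand side is the cross
product `cross T T` of a triple with itself. The proof is linear algebra for vector operators
(`IsVec`), that is, triples which transform under `so(3)` like the basis `X`.

*Normal form.* An isomorphism of the generating representation with `V (n + 2) ⊕ V n` can be made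
unitary by Schur's lemma (`exists_unitary_intertwiner`). In such a basis each `T t` is a vector
operator for the generators of `V (n + 2) ⊕ V n`. A vector operator between two irreducible
representations is unique up to a scalar (`IsVec.eq_smul`): its raising component lives on one
diagonal, along which one entry determines the others. So the diagonal blocks of `T t` are multiples
of the spin matrices and the off-diagonal ones are multiples of `B` and its adjoint
(`exists_eq_blocks`). The cross products of these building blocks are again such multiples, with
factors that follow from the Casimir eigenvalues and from the normalization of `B`
(`cross_blocks`); hence Nahm's equations are equivalent to the reduced system. The coefficient of
`B` is complex at first, but it satisfies a linear homogeneous equation with real coefficient, so its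
phase is constant and is removed by a diagonal gauge transformation that also normalizes the
determinant (`exists_gauge_ansatz`). The reduced system is quadratic, so its solutions are real
analytic: the recursively defined power series converges and agrees with the solution by uniqueness
(`analyticAt_of_quadField`). The triple `B` exists because the Clebsch-Gordan matrices satisfy its
defining relations (`isVec_cg`, `cg_normalization`).

*The explicit solution.* It cannot be extended, since its coefficient `g` is unbounded at both ends.
Rotations are implemented by the exponentials of the generators, because every rotation is a product
of rotations about the coordinate axes (`exists_euler`). An invariant subspace is invariant under the
generators, which are a combination of two values of the solution; it splits along
`V (n + 2) ⊕ V n`, since the Casimir element separates the summands, and the off-diagonal blocks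
connect these irreducible summands (`eq_bot_or_top_of_blocks_invariant`).

*The induced representations.* The negatives `L` and `S` of the residues at `1` and at `-1` both obey
the relations of `so(3)`, and their sum is the triple of generators. As `L` is a vector operator for
the generators and for itself, it commutes with `S` (`commute_of_add_eq_totalSpin`). The highest
weight vector of `V (n + 2)` is a highest weight vector for both, of the weights of `V (n + 1)` and
`V 2` (`isHighest_topVector`). The ladder vectors over it are joint eigenvectors with distinct
eigenvalues, and there are `2 * (n + 1)` of them, the dimension of the whole space. So the space is
`V (n + 1) ⊗ V 2`, with `L` acting on the first factor and `S` on the second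
(`iso_copies_of_commute`).
-/

noncomputable section

namespace Nahm

/-! ### Vector operators and their cross products -/

/-- A triple `C` of matrices is a vector operator for the triples of generators `Y` (acting on the
left) and `Y'` (acting on the right) if it transforms like the basis `X` of `so(3)`. -/
def IsVec {ι κ : Type*} [Fintype ι] [Fintype κ] (Y : Fin 3 → Matrix ι ι ℂ)
    (Y' : Fin 3 → Matrix κ κ ℂ) (C : Fin 3 → Matrix ι κ ℂ) : Prop :=
  ∀ j k, Y j * C k - C k * Y' j = ∑ i, eps i j k • C i

/-- The cross product of two triples of matrices. -/
def cross {ι κ μ : Type*} [Fintype κ] (C : Fin 3 → Matrix ι κ ℂ) (D : Fin 3 → Matrix κ μ ℂ)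
    (i : Fin 3) : Matrix ι μ ℂ :=
  ∑ j, ∑ k, eps i j k • (C j * D k)

section

variable {ι κ μ ν : Type*}

theorem cross_zero [Fintype κ] (C : Fin 3 → Matrix ι κ ℂ) (D : Fin 3 → Matrix κ μ ℂ) :
    cross C D 0 = C 1 * D 2 - C 2 * D 1 := by
  simp [cross, Fin.sum_univ_three, eps]
  norm_num [sub_eq_add_neg]

theorem cross_one [Fintype κ] (C : Fin 3 → Matrix ι κ ℂ) (D : Fin 3 → Matrix κ μ ℂ) :
    cross C D 1 = C 2 * D 0 - C 0 * D 2 := by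
  simp [cross, Fin.sum_univ_three, eps]
  norm_num [sub_eq_add_neg, add_comm]

theorem cross_two [Fintype κ] (C : Fin 3 → Matrix ι κ ℂ) (D : Fin 3 → Matrix κ μ ℂ) :
    cross C D 2 = C 0 * D 1 - C 1 * D 0 := by
  simp [cross, Fin.sum_univ_three, eps]
  norm_num [sub_eq_add_neg]

/-- The nine relations of a vector operator, with the values of the Levi-Civita symbol inserted. -/
theorem isVec_iff [Fintype ι] [Fintype κ]
    {Y : Fin 3 → Matrix ι ι ℂ} {Y' : Fin 3 → Matrix κ κ ℂ}
    {C : Fin 3 → Matrix ι κ ℂ} : IsVec Y Y' C ↔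
      (Y 0 * C 0 = C 0 * Y' 0 ∧ Y 1 * C 1 = C 1 * Y' 1 ∧ Y 2 * C 2 = C 2 * Y' 2) ∧
      (Y 0 * C 1 = C 1 * Y' 0 + C 2 ∧ Y 1 * C 2 = C 2 * Y' 1 + C 0 ∧
        Y 2 * C 0 = C 0 * Y' 2 + C 1) ∧
      (Y 1 * C 0 = C 0 * Y' 1 - C 2 ∧ Y 2 * C 1 = C 1 * Y' 2 - C 0 ∧
        Y 0 * C 2 = C 2 * Y' 0 - C 1) := by
  simp only [IsVec, Fin.forall_fin_succ, Fin.sum_univ_three, eps]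
  norm_num
  simp only [sub_eq_iff_eq_add, zero_add, neg_add_eq_sub, add_comm (C 0) (_ * _),
    add_comm (C 1) (_ * _), add_comm (C 2) (_ * _)]
  tauto

theorem IsVec.sub_smul [Fintype ι] [Fintype κ]
    {Y : Fin 3 → Matrix ι ι ℂ} {Y' : Fin 3 → Matrix κ κ ℂ}
    {C D : Fin 3 → Matrix ι κ ℂ} (hC : IsVec Y Y' C) (hD : IsVec Y Y' D) (c : ℂ) :
    IsVec Y Y' (fun i => C i - c • D i) := by
  intro j k
  have h1 := hC j k
  have h2 := hD j k
  calc _ = (Y j * C k - C k * Y' j) - c • (Y j * D k - D k * Y' j) := by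
        simp only [Matrix.mul_sub, Matrix.sub_mul, Matrix.mul_smul, Matrix.smul_mul]
        module
    _ = _ := by
        rw [h1, h2, Finset.smul_sum, ← Finset.sum_sub_distrib]
        exact Finset.sum_congr rfl fun i _ => by module

/-- The cross product of two composable vector operators is a vector operator. -/
theorem IsVec.crossProduct [Fintype ι] [Fintype κ] [Fintype μ]
    {Y : Fin 3 → Matrix ι ι ℂ} {Y' : Fin 3 → Matrix κ κ ℂ}
    {Y'' : Fin 3 → Matrix μ μ ℂ} {C : Fin 3 → Matrix ι κ ℂ} {D : Fin 3 → Matrix κ μ ℂ}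
    (hC : IsVec Y Y' C) (hD : IsVec Y' Y'' D) : IsVec Y Y'' (cross C D) := by
  rw [isVec_iff] at *
  obtain ⟨⟨c1, c2, c3⟩, ⟨c4, c5, c6⟩, ⟨c7, c8, c9⟩⟩ := hC
  obtain ⟨⟨d1, d2, d3⟩, ⟨d4, d5, d6⟩, ⟨d7, d8, d9⟩⟩ := hD
  simp only [cross_zero, cross_one, cross_two, Matrix.mul_sub, Matrix.sub_mul, ← Matrix.mul_assoc,
    c1, c2, c3, c4, c5, c6, c7, c8, c9, Matrix.add_mul]
  simp only [Matrix.mul_assoc, Matrix.mul_add, Matrix.mul_sub, d1, d2, d3, d4, d5, d6, d7, d8, d9]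
  refine ⟨⟨?_, ?_, ?_⟩, ⟨?_, ?_, ?_⟩, ⟨?_, ?_, ?_⟩⟩ <;> abel

/-- Adjoints of vector operators for skew-Hermitian generators are vector operators. -/
theorem IsVec.conjTranspose [Fintype ι] [Fintype κ]
    {Y : Fin 3 → Matrix ι ι ℂ} {Y' : Fin 3 → Matrix κ κ ℂ}
    {C : Fin 3 → Matrix ι κ ℂ} (hC : IsVec Y Y' C) (hY : ∀ i, (Y i)ᴴ = - Y i)
    (hY' : ∀ i, (Y' i)ᴴ = - Y' i) : IsVec Y' Y (fun i => (C i)ᴴ) := by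
  intro j k
  have h := congrArg Matrix.conjTranspose (hC j k)
  simp only [Matrix.conjTranspose_sub, Matrix.conjTranspose_mul, hY, hY',
    Matrix.conjTranspose_sum, Matrix.conjTranspose_smul, star_trivial, Matrix.mul_neg,
    Matrix.neg_mul] at h
  rw [← h]
  abel

theorem cross_smul_left [Fintype κ] (c : ℂ) (C : Fin 3 → Matrix ι κ ℂ) (D : Fin 3 → Matrix κ μ ℂ)
    (i : Fin 3) : cross (fun j => c • C j) D i = c • cross C D i := by
  fin_cases i <;> simp [cross_zero, cross_one, cross_two, smul_sub]

theorem cross_smul_right [Fintype κ] (c : ℂ) (C : Fin 3 → Matrix ι κ ℂ) (D : Fin 3 → Matrix κ μ ℂ)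
    (i : Fin 3) : cross C (fun j => c • D j) i = c • cross C D i := by
  fin_cases i <;> simp [cross_zero, cross_one, cross_two, smul_sub]

/-- The two cross products of a vector operator with the generators differ by twice the
operator. -/
theorem IsVec.cross_add_cross [Fintype ι] [Fintype κ]
    {Y : Fin 3 → Matrix ι ι ℂ} {Y' : Fin 3 → Matrix κ κ ℂ}
    {C : Fin 3 → Matrix ι κ ℂ} (hC : IsVec Y Y' C) (i : Fin 3) :
    cross Y C i + cross C Y' i = (2 : ℂ) • C i := by
  rw [isVec_iff] at hC
  obtain ⟨-, ⟨c4, c5, c6⟩, ⟨c7, c8, c9⟩⟩ := hC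
  fin_cases i
  · simp only [Fin.zero_eta, cross_zero, c5, c8]; module
  · simp only [Fin.mk_one, cross_one, c6, c9]; module
  · simp only [Fin.reduceFinMk, cross_two, c4, c7]; module

/-- The cross product with the generators acts on a vector operator as a scalar, which the
Casimir eigenvalues on both sides determine. -/
theorem IsVec.cross_left [Fintype ι] [Fintype κ]
    {Y : Fin 3 → Matrix ι ι ℂ} {Y' : Fin 3 → Matrix κ κ ℂ}
    {C : Fin 3 → Matrix ι κ ℂ} (hC : IsVec Y Y' C) [DecidableEq ι] [DecidableEq κ] {c c' : ℂ}
    (hY : ∑ i, Y i * Y i = c • (1 : Matrix ι ι ℂ))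
    (hY' : ∑ i, Y' i * Y' i = c' • (1 : Matrix κ κ ℂ)) (i : Fin 3) :
    cross Y C i = ((c' - c + 2) / 2) • C i := by
  have e1 : (Y 0 * Y 0 + Y 1 * Y 1 + Y 2 * Y 2) * C i = c • C i := by
    rw [← Fin.sum_univ_three (fun i => Y i * Y i), hY, Matrix.smul_mul, Matrix.one_mul]
  have e2 : C i * (Y' 0 * Y' 0 + Y' 1 * Y' 1 + Y' 2 * Y' 2) = c' • C i := by
    rw [← Fin.sum_univ_three (fun i => Y' i * Y' i), hY', Matrix.mul_smul, Matrix.mul_one]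
  have e3 := hC.cross_add_cross i
  rw [isVec_iff] at hC
  obtain ⟨⟨c1, c2, c3⟩, ⟨c4, c5, c6⟩, ⟨c7, c8, c9⟩⟩ := hC
  have key : (2 : ℂ) • cross Y C i = (c' - c + 2) • C i := by
    rw [add_smul, _root_.sub_smul, ← e1, ← e2, ← e3]
    fin_cases i
    · simp only [Fin.zero_eta, cross_zero, Matrix.add_mul, Matrix.mul_add, Matrix.mul_assoc,
        c1, c7, c6, Matrix.mul_sub]
      simp only [← Matrix.mul_assoc, c1, c7, c6, c5, c8, Matrix.add_mul, Matrix.sub_mul]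
      module
    · simp only [Fin.mk_one, cross_one, Matrix.add_mul, Matrix.mul_add, Matrix.mul_assoc,
        c2, c8, c4, Matrix.mul_sub]
      simp only [← Matrix.mul_assoc, c2, c8, c4, c6, c9, Matrix.add_mul, Matrix.sub_mul]
      module
    · simp only [Fin.reduceFinMk, cross_two, Matrix.add_mul, Matrix.mul_add, Matrix.mul_assoc,
        c3, c9, c5, Matrix.mul_sub]
      simp only [← Matrix.mul_assoc, c3, c9, c5, c4, c7, Matrix.add_mul, Matrix.sub_mul]
      module
  calc cross Y C i = (1 / 2 : ℂ) • ((2 : ℂ) • cross Y C i) := by module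
    _ = _ := by rw [key, smul_smul]; congr 1; ring

/-- The contraction of a cross product is invariant under cyclic permutations. -/
theorem sum_mul_cross [Fintype κ] [Fintype μ] (A : Fin 3 → Matrix ι κ ℂ) (C : Fin 3 → Matrix κ μ ℂ)
    (D : Fin 3 → Matrix μ ν ℂ) :
    ∑ i, A i * cross C D i = ∑ i, cross A C i * D i := by
  simp only [Fin.sum_univ_three, cross_zero, cross_one, cross_two, Matrix.mul_sub, Matrix.sub_mul,
    Matrix.mul_assoc]
  abel

end

/-- The right-hand side of Nahm's equations is the cross product of the triple with itself. -/
theorem half_sum_lie_eq_cross {ι : Type*} [Fintype ι] [DecidableEq ι] (T : Fin 3 → Matrix ι ι ℂ)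
    (i : Fin 3) : (1 / 2 : ℝ) • ∑ j, ∑ k, eps i j k • ⁅T j, T k⁆ = cross T T i := by
  simp only [Ring.lie_def, Fin.sum_univ_three]
  fin_cases i
  · simp [eps, cross_zero]; norm_num; module
  · simp [eps, cross_one]; norm_num; module
  · simp [eps, cross_two]; norm_num; module

/-! ### Ladder operators -/

/-- The raising component of a triple of matrices. The basis `X` of `so(3)` acts by skew-Hermitian
matrices, so the imaginary unit enters; for the spin matrices this is the matrix `raising`. -/
def up {ι κ : Type*} (C : Fin 3 → Matrix ι κ ℂ) : Matrix ι κ ℂ := C 1 - Complex.I • C 2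

/-- The lowering component of a triple of matrices. -/
def down {ι κ : Type*} (C : Fin 3 → Matrix ι κ ℂ) : Matrix ι κ ℂ := - C 1 - Complex.I • C 2

/-- The weight component of a triple of matrices; for the generators it has real eigenvalues. -/
def wt {ι κ : Type*} (C : Fin 3 → Matrix ι κ ℂ) : Matrix ι κ ℂ := (-Complex.I) • C 0

section

variable {ι κ : Type*}

theorem eq_zero_of_ladder {C : Fin 3 → Matrix ι κ ℂ} (hu : up C = 0) (hd : down C = 0)
    (hw : wt C = 0) (i : Fin 3) : C i = 0 := by
  have h0 : C 0 = Complex.I • wt C := by simp [wt, smul_smul]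
  have h1 : C 1 = (1 / 2 : ℂ) • (up C - down C) := by simp only [up, down]; module
  have h2 : C 2 = (Complex.I / 2) • (up C + down C) := by
    simp only [up, down, smul_add, smul_sub, smul_smul, smul_neg]
    rw [div_mul_eq_mul_div, Complex.I_mul_I]
    module
  fin_cases i
  · simpa [hw] using h0
  · simpa [hu, hd] using h1
  · simpa [hu, hd] using h2

theorem conjTranspose_up {S : Fin 3 → Matrix ι ι ℂ} (hS : ∀ i, (S i)ᴴ = - S i) :
    (up S)ᴴ = down S := by
  simp [up, down, hS]

/-- The relations of a vector operator in terms of the ladder components: the raising component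
increases the weight by one, the lowering component decreases it by one. -/
theorem IsVec.ladder [Fintype ι] [Fintype κ]
    {Y : Fin 3 → Matrix ι ι ℂ} {Y' : Fin 3 → Matrix κ κ ℂ}
    {C : Fin 3 → Matrix ι κ ℂ} (hC : IsVec Y Y' C) :
    wt Y * up C = up C * wt Y' + up C ∧ wt Y * down C = down C * wt Y' - down C ∧
    up Y * up C = up C * up Y' ∧ down Y * up C = up C * down Y' - (2 : ℂ) • wt C ∧
    down Y * wt C = wt C * down Y' + down C ∧ up Y * down C = down C * up Y' + (2 : ℂ) • wt C := by
  rw [isVec_iff] at hC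
  obtain ⟨⟨c1, c2, c3⟩, ⟨c4, c5, c6⟩, ⟨c7, c8, c9⟩⟩ := hC
  simp only [up, down, wt, Matrix.mul_sub, Matrix.sub_mul, Matrix.smul_mul, Matrix.mul_smul,
    Matrix.neg_mul, Matrix.mul_neg, c2, c3, c4, c5, c6, c7, c8, c9, smul_add, smul_sub,
    smul_neg, smul_smul, neg_mul, mul_neg, Complex.I_mul_I, neg_neg]
  refine ⟨?_, ?_, ?_, ?_, ?_, ?_⟩ <;> module

/-- The triple with given weight, raising and lowering components. -/
def ofLadder (h e f : Matrix ι κ ℂ) : Fin 3 → Matrix ι κ ℂ :=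
  ![Complex.I • h, (1 / 2 : ℂ) • (e - f), (Complex.I / 2) • (e + f)]

/-- Conversely, the ladder relations imply the relations of a vector operator. -/
theorem isVec_ofLadder [Fintype ι] [Fintype κ] {h e f : Matrix ι ι ℂ} {h' e' f' : Matrix κ κ ℂ}
    {d p q : Matrix ι κ ℂ} (hd : h * d = d * h') (hp : h * p = p * h' + p)
    (hq : h * q = q * h' - q) (ed : e * d = d * e' - p) (ep : e * p = p * e')
    (eq : e * q = q * e' + (2 : ℂ) • d) (fd : f * d = d * f' + q)
    (fp : f * p = p * f' - (2 : ℂ) • d) (fq : f * q = q * f') :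
    IsVec (ofLadder h e f) (ofLadder h' e' f') (ofLadder d p q) := by
  rw [isVec_iff]
  refine ⟨⟨?_, ?_, ?_⟩, ⟨?_, ?_, ?_⟩, ⟨?_, ?_, ?_⟩⟩
  · simp only [ofLadder, Matrix.cons_val_zero, Matrix.smul_mul, Matrix.mul_smul, hd]
  all_goals
    simp only [ofLadder, Matrix.cons_val_zero, Matrix.cons_val_one, Matrix.cons_val,
      Matrix.smul_mul, Matrix.mul_smul, Matrix.mul_add, Matrix.add_mul, Matrix.mul_sub,
      Matrix.sub_mul, hp, hq, ed, ep, eq, fd, fp, fq]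
    match_scalars <;>
    first
    | ring1
    | (ring_nf; simp only [Complex.I_sq]; ring1)

end

/-! ### The spin matrices -/

/-- The weight matrix of size `k`. -/
def weight (k : ℕ) : Matrix (Fin k) (Fin k) ℂ :=
  Matrix.diagonal fun a => ((k : ℂ) - 1) / 2 - ((a : ℕ) : ℂ)

theorem spinMatrix_eq_ofLadder (k : ℕ) :
    spinMatrix k = ofLadder (weight k) (raising k) (raising k)ᵀ := by
  have h : Matrix.diagonal (fun a : Fin k => Complex.I / 2 * ((k : ℂ) - 1 - 2 * ((a : ℕ) : ℂ))) =
      Complex.I • weight k := by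
    rw [weight, ← Matrix.diagonal_smul]
    congr 1
    funext a
    simp only [Pi.smul_apply, smul_eq_mul]
    ring
  rw [spinMatrix, ofLadder, h]

theorem up_ofLadder {ι κ : Type*} (h e f : Matrix ι κ ℂ) : up (ofLadder h e f) = e := by
  simp only [up, ofLadder, Matrix.cons_val_one, Matrix.cons_val, smul_smul]
  rw [← mul_div_assoc, Complex.I_mul_I]
  module

theorem down_ofLadder {ι κ : Type*} (h e f : Matrix ι κ ℂ) : down (ofLadder h e f) = f := by
  simp only [down, ofLadder, Matrix.cons_val_one, Matrix.cons_val, smul_smul]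
  rw [← mul_div_assoc, Complex.I_mul_I]
  module

theorem wt_ofLadder {ι κ : Type*} (h e f : Matrix ι κ ℂ) : wt (ofLadder h e f) = h := by
  simp [wt, ofLadder, smul_smul]

theorem up_spinMatrix (k : ℕ) : up (spinMatrix k) = raising k := by
  rw [spinMatrix_eq_ofLadder, up_ofLadder]

theorem down_spinMatrix (k : ℕ) : down (spinMatrix k) = (raising k)ᵀ := by
  rw [spinMatrix_eq_ofLadder, down_ofLadder]

theorem wt_spinMatrix (k : ℕ) : wt (spinMatrix k) = weight k := by
  rw [spinMatrix_eq_ofLadder, wt_ofLadder]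

theorem conjTranspose_raising (k : ℕ) : (raising k)ᴴ = (raising k)ᵀ := by
  ext a b
  simp only [Matrix.conjTranspose_apply, Matrix.transpose_apply, raising, Matrix.of_apply]
  split_ifs <;> simp

theorem conjTranspose_spinMatrix (k : ℕ) (i : Fin 3) : (spinMatrix k i)ᴴ = - spinMatrix k i := by
  have h1 := conjTranspose_raising k
  have h2 : (raising k)ᵀᴴ = raising k := by
    rw [← h1, Matrix.conjTranspose_conjTranspose]
  have h3 : (weight k)ᴴ = weight k := by
    rw [weight, Matrix.diagonal_conjTranspose]
    congr 1
    funext a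
    simp
  rw [spinMatrix_eq_ofLadder]
  fin_cases i
  · simp [ofLadder, h3]
  · simp [ofLadder, h1, h2, ← smul_neg]
  · simp only [ofLadder, Fin.reduceFinMk, Matrix.cons_val, Matrix.conjTranspose_smul,
      Matrix.conjTranspose_add, h1, h2, star_div₀]
    simp
    module

theorem isVec_spinMatrix (k : ℕ) : IsVec (spinMatrix k) (spinMatrix k) (spinMatrix k) := by
  have h1 := spinMatrix_lie01 k
  have h2 := spinMatrix_lie12 k
  have h3 := spinMatrix_lie20 k
  rw [Ring.lie_def, sub_eq_iff_eq_add] at h1 h2 h3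
  rw [isVec_iff, h1, h2, h3]
  refine ⟨⟨rfl, rfl, rfl⟩, ⟨?_, ?_, ?_⟩, ⟨?_, ?_, ?_⟩⟩ <;> abel

/-- The Casimir operator of the spin matrices is scalar. -/
theorem spinMatrix_casimir (k : ℕ) :
    ∑ i, spinMatrix k i * spinMatrix k i = (-((k : ℂ) ^ 2 - 1) / 4) • (1 : Matrix _ _ ℂ) := by
  have h : ∑ i, spinMatrix k i * spinMatrix k i = - (weight k * weight k) -
      (1 / 2 : ℂ) • (raising k * (raising k)ᵀ + (raising k)ᵀ * raising k) := by
    rw [spinMatrix_eq_ofLadder, Fin.sum_univ_three]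
    simp only [ofLadder, Matrix.cons_val_zero, Matrix.cons_val_one, Matrix.cons_val,
      Matrix.smul_mul, Matrix.mul_smul, Matrix.mul_add, Matrix.add_mul, Matrix.mul_sub,
      Matrix.sub_mul, smul_smul, smul_add, smul_sub]
    match_scalars <;> ring_nf <;> simp only [Complex.I_sq] <;> ring1
  rw [h, raising_mul_transpose, transpose_mul_raising, weight, Matrix.diagonal_mul_diagonal,
    Matrix.diagonal_add, ← Matrix.diagonal_smul, Matrix.diagonal_neg, Matrix.diagonal_sub,
    Matrix.smul_one_eq_diagonal]
  congr 1
  funext a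
  simp only [Pi.smul_apply, smul_eq_mul]
  ring

/-- Each component of a vector operator for `Y` is a commutator. -/
theorem trace_eq_zero_of_isVec {ι : Type*} [Fintype ι] {Y C : Fin 3 → Matrix ι ι ℂ}
    (h : IsVec Y Y C) (i : Fin 3) : (C i).trace = 0 := by
  rw [isVec_iff] at h
  obtain ⟨-, ⟨h1, h2, h3⟩, -⟩ := h
  have e1 := congrArg Matrix.trace h1
  have e2 := congrArg Matrix.trace h2
  have e3 := congrArg Matrix.trace h3
  rw [Matrix.trace_add, Matrix.trace_mul_comm] at e1 e2 e3
  fin_cases i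
  · exact left_eq_add.1 e2
  · exact left_eq_add.1 e3
  · exact left_eq_add.1 e1

/-! ### Matrix entries of products with ladder operators -/

/-- The matrix element of the raising matrix of size `k` between the indices `a + 1` and `a`. -/
def ladderCoeff (k a : ℕ) : ℝ := Real.sqrt (((a : ℝ) + 1) * ((k : ℝ) - 1 - (a : ℝ)))

theorem ladderCoeff_ne_zero {k a : ℕ} (h : a + 1 < k) : ladderCoeff k a ≠ 0 := by
  have h1 : (a : ℝ) + 1 < k := by exact_mod_cast h
  exact (Real.sqrt_pos.2 (mul_pos (by positivity) (by linarith))).ne'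

theorem raising_apply (k : ℕ) (a b : Fin k) :
    raising k a b = if (a : ℕ) + 1 = b then ((ladderCoeff k a : ℝ) : ℂ) else 0 := rfl

section
variable {κ : Type*} {k : ℕ}

theorem raising_mulVec_apply (v : Fin k → ℂ) (a : Fin k) (h : (a : ℕ) + 1 < k) :
    (raising k *ᵥ v) a = ladderCoeff k a * v ⟨a + 1, h⟩ := by
  rw [Matrix.mulVec, dotProduct, Finset.sum_eq_single (⟨(a : ℕ) + 1, h⟩ : Fin k)]
  · simp [raising_apply]
  · intro c _ hc
    rw [raising_apply, if_neg (fun h => hc (Fin.ext h.symm)), zero_mul]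
  · simp

theorem raising_mulVec_apply_last (v : Fin k → ℂ) (a : Fin k) (h : ¬ (a : ℕ) + 1 < k) :
    (raising k *ᵥ v) a = 0 := by
  rw [Matrix.mulVec, dotProduct]
  refine Finset.sum_eq_zero fun c _ => ?_
  rw [raising_apply, if_neg (by have := c.2; omega), zero_mul]

theorem raising_mul_apply (M : Matrix (Fin k) κ ℂ) (a : Fin k) (b : κ) (h : (a : ℕ) + 1 < k) :
    (raising k * M) a b = ladderCoeff k a * M ⟨a + 1, h⟩ b :=
  raising_mulVec_apply (fun c => M c b) a h

theorem raising_transpose_mulVec_single (a : Fin k) (h : (a : ℕ) + 1 < k) :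
    (raising k)ᵀ *ᵥ Pi.single a 1 =
      (ladderCoeff k a : ℂ) • (Pi.single ⟨a + 1, h⟩ 1 : Fin k → ℂ) := by
  ext b
  simp only [Matrix.mulVec_single_one, Matrix.col_apply, Matrix.transpose_apply, raising_apply,
    Pi.smul_apply, Pi.single_apply, smul_eq_mul, mul_ite, mul_one, mul_zero, Fin.ext_iff,
    eq_comm]

theorem raising_transpose_mulVec_single_last (a : Fin k) (h : ¬ (a : ℕ) + 1 < k) :
    (raising k)ᵀ *ᵥ Pi.single a 1 = 0 := by
  ext b
  simp only [Matrix.mulVec_single_one, Matrix.col_apply, Matrix.transpose_apply, raising_apply]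
  exact if_neg (by have := b.2; omega)

theorem raising_mulVec_single_succ (a : Fin k) (h : (a : ℕ) + 1 < k) :
    raising k *ᵥ Pi.single ⟨a + 1, h⟩ 1 =
      (ladderCoeff k a : ℂ) • (Pi.single a 1 : Fin k → ℂ) := by
  ext b
  simp only [Matrix.mulVec_single_one, Matrix.col_apply, raising_apply,
    Pi.smul_apply, Pi.single_apply, smul_eq_mul, mul_ite, mul_one, mul_zero, Fin.ext_iff,
    Nat.add_right_cancel_iff]
  split_ifs with h1
  · rw [h1]
  · rfl

theorem raising_mulVec_single_zero (h : 0 < k) :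
    raising k *ᵥ Pi.single ⟨0, h⟩ 1 = 0 := by
  ext b
  simp [Matrix.col_apply, raising_apply]

theorem mul_raising_apply (M : Matrix κ (Fin k) ℂ) (a : κ) (b : Fin k) (h : (b : ℕ) + 1 < k) :
    (M * raising k) a ⟨b + 1, h⟩ = ladderCoeff k b * M a b := by
  rw [Matrix.mul_apply, Finset.sum_eq_single b]
  · simp [raising_apply, mul_comm]
  · intro c _ hc
    rw [raising_apply, if_neg, mul_zero]
    simp only [Nat.add_right_cancel_iff]
    exact fun h => hc (Fin.ext h)
  · simp

end

/-! ### Uniqueness of vector operators, and Schur's lemma -/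

section
variable {p q e : ℕ} {C D : Fin 3 → Matrix (Fin p) (Fin q) ℂ}

/-- The raising component of a vector operator changes the weight by one, so it is supported on
one diagonal; here `p + 2 * e = q + 2` says that this is the `e`-th diagonal above the main one. -/
theorem IsVec.up_apply_eq_zero (hC : IsVec (spinMatrix p) (spinMatrix q) C)
    (h : p + 2 * e = q + 2) (a : Fin p) (b : Fin q) (hab : (b : ℕ) ≠ a + e) : up C a b = 0 := by
  have h1 := congrFun (congrFun hC.ladder.1 a) b
  rw [wt_spinMatrix, wt_spinMatrix, weight, weight, Matrix.diagonal_mul, Matrix.add_apply,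
    Matrix.mul_diagonal] at h1
  have h2 : ((b : ℕ) : ℂ) - (a + e) ≠ 0 := sub_ne_zero.2 (by exact_mod_cast hab)
  have h3 : (p : ℂ) + 2 * e = q + 2 := by exact_mod_cast h
  refine (mul_eq_zero.1 (?_ : up C a b * (((b : ℕ) : ℂ) - (a + e)) = 0)).resolve_right h2
  linear_combination h1 - up C a b / 2 * h3

/-- Commutation with the raising matrix propagates a vanishing entry along the supporting
diagonal, and the lowering matrix then produces the other two components. -/
theorem IsVec.eq_zero (hC : IsVec (spinMatrix p) (spinMatrix q) C) (h : p + 2 * e = q + 2)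
    (hp : 0 < p) (hq : e < q) (h0 : up C ⟨0, hp⟩ ⟨e, hq⟩ = 0) (i : Fin 3) : C i = 0 := by
  have hL := hC.ladder
  simp only [wt_spinMatrix, up_spinMatrix, down_spinMatrix] at hL
  obtain ⟨-, -, l3, l4, l5, -⟩ := hL
  have key : ∀ (a : ℕ) (ha : a < p) (hb : a + e < q), up C ⟨a, ha⟩ ⟨a + e, hb⟩ = 0 := by
    intro a
    induction a with
    | zero => intro ha hb; simpa using h0
    | succ a ih =>
      intro ha hb
      have h1 := congrFun (congrFun l3 ⟨a, by omega⟩) ⟨a + e + 1, by omega⟩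
      rw [raising_mul_apply _ _ _ ha,
        mul_raising_apply _ _ (⟨a + e, by omega⟩ : Fin q) (by simp only; omega),
        ih (by omega) (by omega), mul_zero] at h1
      have h2 : ((ladderCoeff p a : ℝ) : ℂ) ≠ 0 :=
        Complex.ofReal_ne_zero.2 (ladderCoeff_ne_zero ha)
      have h3 := (mul_eq_zero.1 h1).resolve_left h2
      convert h3 using 2
      exact Fin.ext (by simp only; omega)
  have hu : up C = 0 := by
    ext a b
    by_cases hab : (b : ℕ) = a + e
    · have h1 := key a a.2 (hab ▸ b.2)
      have h2 : b = ⟨a + e, hab ▸ b.2⟩ := Fin.ext hab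
      rw [h2]
      exact h1
    · exact hC.up_apply_eq_zero h a b hab
  have hw : wt C = 0 := by
    rw [hu, Matrix.mul_zero, Matrix.zero_mul, zero_sub, eq_comm, neg_eq_zero] at l4
    exact (smul_eq_zero.1 l4).resolve_left two_ne_zero
  have hd : down C = 0 := by
    rw [hw, Matrix.mul_zero, Matrix.zero_mul, zero_add] at l5
    exact l5.symm
  exact eq_zero_of_ladder hu hd hw i

/-- The space of vector operators between two irreducible representations is at most
one-dimensional. -/
theorem IsVec.eq_smul (hC : IsVec (spinMatrix p) (spinMatrix q) C)
    (hD : IsVec (spinMatrix p) (spinMatrix q) D) (h : p + 2 * e = q + 2)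
    (hp : 0 < p) (hq : e < q) (hD0 : ∃ i, D i ≠ 0) : ∃ c : ℂ, ∀ i, C i = c • D i := by
  have h0 : up D ⟨0, hp⟩ ⟨e, hq⟩ ≠ 0 := by
    intro h0
    obtain ⟨i, hi⟩ := hD0
    exact hi (hD.eq_zero h hp hq h0 i)
  refine ⟨up C ⟨0, hp⟩ ⟨e, hq⟩ / up D ⟨0, hp⟩ ⟨e, hq⟩, fun i => ?_⟩
  refine sub_eq_zero.1 ((hC.sub_smul hD _).eq_zero h hp hq ?_ i)
  generalize hc : up C ⟨0, hp⟩ ⟨e, hq⟩ / up D ⟨0, hp⟩ ⟨e, hq⟩ = c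
  rw [div_eq_iff h0] at hc
  have : up (fun i => C i - c • D i) = up C - c • up D := by
    simp only [up]
    module
  rw [this, Matrix.sub_apply, Matrix.smul_apply, smul_eq_mul, hc, sub_self]

end

theorem spinMatrix_ne_zero {k : ℕ} (hk : 2 ≤ k) : ∃ i, spinMatrix k i ≠ 0 := by
  refine ⟨0, fun h => ?_⟩
  have h1 := congrFun (congrFun h ⟨0, by omega⟩) ⟨0, by omega⟩
  simp [spinMatrix] at h1
  have h2 : (k : ℂ) = 1 := by linear_combination h1
  have h3 : k = 1 := by exact_mod_cast h2
  omega

/-- A vector operator on one irreducible representation is a multiple of the generators. -/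
theorem IsVec.eq_smul_spinMatrix {k : ℕ} (hk : 2 ≤ k) {C : Fin 3 → Matrix (Fin k) (Fin k) ℂ}
    (hC : IsVec (spinMatrix k) (spinMatrix k) C) : ∃ c : ℂ, ∀ i, C i = c • spinMatrix k i :=
  hC.eq_smul (isVec_spinMatrix k) (e := 1) rfl (by omega) (by omega) (spinMatrix_ne_zero hk)

/-- Schur's lemma for the spin matrices. -/
theorem eq_smul_one_of_commute {k : ℕ} {M : Matrix (Fin k) (Fin k) ℂ}
    (hM : ∀ i, spinMatrix k i * M = M * spinMatrix k i) : ∃ c : ℂ, M = c • 1 := by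
  rcases Nat.eq_zero_or_pos k with rfl | hk
  · exact ⟨0, Subsingleton.elim _ _⟩
  have h0 : weight k * M = M * weight k := by
    rw [← wt_spinMatrix, wt, Matrix.smul_mul, Matrix.mul_smul, hM]
  have h1 : raising k * M = M * raising k := by
    rw [← up_spinMatrix, up, Matrix.sub_mul, Matrix.mul_sub, Matrix.smul_mul, Matrix.mul_smul, hM,
      hM]
  have hoff : ∀ a b, a ≠ b → M a b = 0 := by
    intro a b hab
    have h2 := congrFun (congrFun h0 a) b
    rw [weight, Matrix.diagonal_mul, Matrix.mul_diagonal] at h2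
    have h3 : ((b : ℕ) : ℂ) - (a : ℕ) ≠ 0 :=
      sub_ne_zero.2 fun h => hab (Fin.ext (Nat.cast_injective h).symm)
    refine (mul_eq_zero.1 (?_ : M a b * (((b : ℕ) : ℂ) - (a : ℕ)) = 0)).resolve_right h3
    linear_combination h2
  have hdiag : ∀ (a : ℕ) (ha : a < k), M ⟨a, ha⟩ ⟨a, ha⟩ = M ⟨0, hk⟩ ⟨0, hk⟩ := by
    intro a
    induction a with
    | zero => intro ha; rfl
    | succ a ih =>
      intro ha
      rw [← ih (by omega)]
      have h2 := congrFun (congrFun h1 ⟨a, by omega⟩) ⟨a + 1, ha⟩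
      rw [raising_mul_apply _ _ _ ha, mul_raising_apply _ _ (⟨a, by omega⟩ : Fin k) ha] at h2
      exact mul_left_cancel₀ (Complex.ofReal_ne_zero.2 (ladderCoeff_ne_zero ha)) h2
  refine ⟨M ⟨0, hk⟩ ⟨0, hk⟩, ?_⟩
  ext a b
  by_cases hab : a = b
  · subst hab
    simpa using hdiag a a.2
  · simpa [hab] using hoff a b hab

/-- Intertwiners between representations with different Casimir eigenvalues vanish. -/
theorem eq_zero_of_casimir_ne {ι κ : Type*} [Fintype ι] [Fintype κ] [DecidableEq ι] [DecidableEq κ]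
    {Y : Fin 3 → Matrix ι ι ℂ} {Y' : Fin 3 → Matrix κ κ ℂ} {c c' : ℂ}
    (hY : ∑ i, Y i * Y i = c • (1 : Matrix ι ι ℂ))
    (hY' : ∑ i, Y' i * Y' i = c' • (1 : Matrix κ κ ℂ)) (hc : c ≠ c') {M : Matrix ι κ ℂ}
    (hM : ∀ i, Y i * M = M * Y' i) : M = 0 := by
  have h1 : c • M = c' • M := by
    calc c • M = (∑ i, Y i * Y i) * M := by rw [hY, Matrix.smul_mul, Matrix.one_mul]
      _ = M * ∑ i, Y' i * Y' i := by
        rw [Matrix.sum_mul, Matrix.mul_sum]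
        refine Finset.sum_congr rfl fun i _ => ?_
        rw [Matrix.mul_assoc, hM, ← Matrix.mul_assoc, hM, Matrix.mul_assoc]
      _ = c' • M := by rw [hY', Matrix.mul_smul, Matrix.mul_one]
  rw [← sub_eq_zero, ← _root_.sub_smul] at h1
  exact (smul_eq_zero.1 h1).resolve_left (sub_ne_zero.2 hc)

theorem casimir_ne {k l : ℕ} (h : k ≠ l) : -((k : ℂ) ^ 2 - 1) / 4 ≠ -((l : ℂ) ^ 2 - 1) / 4 := by
  intro h1
  have h2 : (k : ℂ) ^ 2 = (l : ℂ) ^ 2 := by linear_combination -4 * h1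
  have h3 : k ^ 2 = l ^ 2 := by exact_mod_cast h2
  exact h (Nat.pow_left_injective (n := 2) (by norm_num) h3)

/-- The spin matrices act irreducibly. -/
theorem eq_bot_or_top_of_spinMatrix_invariant {k : ℕ} (W : Submodule ℂ (Fin k → ℂ))
    (hW : ∀ i, ∀ v ∈ W, spinMatrix k i *ᵥ v ∈ W) : W = ⊥ ∨ W = ⊤ := by
  have hup : ∀ v ∈ W, raising k *ᵥ v ∈ W := by
    intro v hv
    rw [← up_spinMatrix, up, Matrix.sub_mulVec, Matrix.smul_mulVec]
    exact W.sub_mem (hW 1 v hv) (W.smul_mem _ (hW 2 v hv))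
  have hdown : ∀ v ∈ W, (raising k)ᵀ *ᵥ v ∈ W := by
    intro v hv
    rw [← down_spinMatrix, down, Matrix.sub_mulVec, Matrix.smul_mulVec, Matrix.neg_mulVec]
    exact W.sub_mem (W.neg_mem (hW 1 v hv)) (W.smul_mem _ (hW 2 v hv))
  rw [or_iff_not_imp_left]
  intro hne
  obtain ⟨v, hv, hv0⟩ := (Submodule.ne_bot_iff W).1 hne
  obtain ⟨a₀, ha₀⟩ := Function.ne_iff.1 hv0
  have hk : 0 < k := a₀.pos
  -- repeated raising turns a nonzero vector of `W` into a multiple of the highest weight vector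
  have h1 : ∀ (a : ℕ) (ha : a < k) (v : Fin k → ℂ), v ∈ W → v ⟨a, ha⟩ ≠ 0 →
      (∀ b : Fin k, a < b → v b = 0) → (Pi.single ⟨0, hk⟩ 1 : Fin k → ℂ) ∈ W := by
    intro a
    induction a with
    | zero =>
      intro ha v hv hva hvb
      have : (Pi.single ⟨0, hk⟩ 1 : Fin k → ℂ) = (v ⟨0, ha⟩)⁻¹ • v := by
        ext b
        by_cases hb : (b : ℕ) = 0
        · have : b = ⟨0, hk⟩ := Fin.ext hb
          simp [this, hva]
        · have h2 : b ≠ ⟨0, hk⟩ := fun h => hb (by rw [h])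
          simp [h2, hvb b (by omega)]
      rw [this]
      exact W.smul_mem _ hv
    | succ a ih =>
      intro ha v hv hva hvb
      refine ih (by omega) _ (hup v hv) ?_ ?_
      · rw [raising_mulVec_apply _ _ ha]
        exact mul_ne_zero (Complex.ofReal_ne_zero.2 (ladderCoeff_ne_zero ha)) hva
      · intro b hb
        by_cases hb' : (b : ℕ) + 1 < k
        · rw [raising_mulVec_apply _ _ hb', hvb _ (by simp only; omega), mul_zero]
        · exact raising_mulVec_apply_last _ _ hb'
  have h2 : (Pi.single ⟨0, hk⟩ 1 : Fin k → ℂ) ∈ W := by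
    obtain ⟨a, ha, hmax⟩ := Finset.exists_max_image (Finset.univ.filter fun a => v a ≠ 0) id
      ⟨a₀, by simpa using ha₀⟩
    refine h1 a a.2 v hv (by simpa using ha) fun b hb => ?_
    by_contra hvb
    exact absurd (hmax b (by simpa using hvb)) (not_le.2 hb)
  have h3 : ∀ (a : ℕ) (ha : a < k), (Pi.single ⟨a, ha⟩ 1 : Fin k → ℂ) ∈ W := by
    intro a
    induction a with
    | zero => intro _; exact h2
    | succ a ih =>
      intro ha
      have h4 := hdown _ (ih (by omega))
      rw [raising_transpose_mulVec_single _ ha] at h4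
      exact (W.smul_mem_iff (Complex.ofReal_ne_zero.2 (ladderCoeff_ne_zero ha))).1 h4
  rw [eq_top_iff]
  intro w _
  rw [pi_eq_sum_univ' w]
  refine W.sum_mem fun a _ => W.smul_mem _ ?_
  convert h3 a a.2 using 1

/-! ### The algebra of the invariant triple -/

section
variable {n : ℕ} {B : Fin 3 → Matrix (Fin (n + 2)) (Fin n) ℂ}

theorem isVec_of_forall_V {k l : ℕ} {C : Fin 3 → Matrix (Fin k) (Fin l) ℂ} :
    (∀ i j, V k (X i) * C j - C j * V l (X i) = ∑ m, eps m i j • C m) ↔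
      IsVec (spinMatrix k) (spinMatrix l) C := by
  simp only [V_X, IsVec]

theorem IsInvariantTriple.isVec (hB : IsInvariantTriple n B) :
    IsVec (spinMatrix (n + 2)) (spinMatrix n) B := isVec_of_forall_V.1 hB.1

theorem IsInvariantTriple.isVec_conjTranspose (hB : IsInvariantTriple n B) :
    IsVec (spinMatrix n) (spinMatrix (n + 2)) (fun i => (B i)ᴴ) :=
  hB.isVec.conjTranspose (conjTranspose_spinMatrix _) (conjTranspose_spinMatrix _)

theorem cross_spinMatrix (k : ℕ) (i : Fin 3) :
    cross (spinMatrix k) (spinMatrix k) i = spinMatrix k i := by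
  rw [(isVec_spinMatrix k).cross_left (spinMatrix_casimir k) (spinMatrix_casimir k)]
  module

/-- The scalar comes from the Casimir eigenvalues of `V n` and `V (n + 2)`. -/
theorem IsInvariantTriple.cross_left (hB : IsInvariantTriple n B) (i : Fin 3) :
    cross (spinMatrix (n + 2)) B i = (((n : ℂ) + 3) / 2) • B i := by
  rw [hB.isVec.cross_left (spinMatrix_casimir _) (spinMatrix_casimir _)]
  congr 1
  push_cast
  ring

theorem IsInvariantTriple.cross_right (hB : IsInvariantTriple n B) (i : Fin 3) :
    cross B (spinMatrix n) i = (-((n : ℂ) - 1) / 2) • B i := by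
  have h := hB.isVec.cross_add_cross i
  rw [hB.cross_left, ← eq_sub_iff_add_eq'] at h
  rw [h]
  module

theorem IsInvariantTriple.cross_conjTranspose_right (hB : IsInvariantTriple n B) (i : Fin 3) :
    cross (fun j => (B j)ᴴ) (spinMatrix (n + 2)) i = (((n : ℂ) + 3) / 2) • (B i)ᴴ := by
  have h := hB.isVec_conjTranspose.cross_add_cross i
  rw [hB.isVec_conjTranspose.cross_left (spinMatrix_casimir _) (spinMatrix_casimir _),
    ← eq_sub_iff_add_eq'] at h
  rw [h]
  push_cast
  module

theorem IsInvariantTriple.cross_conjTranspose_left (hB : IsInvariantTriple n B) (i : Fin 3) :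
    cross (spinMatrix n) (fun j => (B j)ᴴ) i = (-((n : ℂ) - 1) / 2) • (B i)ᴴ := by
  rw [hB.isVec_conjTranspose.cross_left (spinMatrix_casimir _) (spinMatrix_casimir _)]
  congr 1
  push_cast
  ring

/-- The cross product of `B` and its adjoint is a vector operator on `V (n + 2)`, hence a multiple
of the generators; contraction with the generators determines the factor. -/
theorem IsInvariantTriple.cross_self_conjTranspose (hB : IsInvariantTriple n B) (i : Fin 3) :
    cross B (fun j => (B j)ᴴ) i = (-2 / ((n : ℂ) + 1)) • spinMatrix (n + 2) i := by
  obtain ⟨c, hc⟩ :=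
    (hB.isVec.crossProduct hB.isVec_conjTranspose).eq_smul_spinMatrix (by omega)
  have h := sum_mul_cross (spinMatrix (n + 2)) B (fun j => (B j)ᴴ)
  simp only [hc, hB.cross_left, Matrix.mul_smul, Matrix.smul_mul, ← Finset.smul_sum, hB.2,
    spinMatrix_casimir, smul_smul] at h
  have h1 := congrFun (congrFun h 0) 0
  simp only [Matrix.smul_apply, Matrix.one_apply_eq, smul_eq_mul, mul_one] at h1
  push_cast at h1
  have h2 : (n : ℂ) + 1 ≠ 0 := by exact_mod_cast (by omega : n + 1 ≠ 0)
  have h3 : (n : ℂ) + 3 ≠ 0 := by exact_mod_cast (by omega : n + 3 ≠ 0)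
  rw [hc]
  congr 1
  rw [eq_div_iff h2]
  apply mul_left_cancel₀ h3
  linear_combination -4 * h1

/-- The cross product of the adjoint of `B` with `B` is a multiple of the generators on `V n`;
the trace of the contraction with the generators determines the factor. -/
theorem IsInvariantTriple.cross_conjTranspose_self (hB : IsInvariantTriple n B) (hn : 2 ≤ n)
    (i : Fin 3) : cross (fun j => (B j)ᴴ) B i =
      (2 * ((n : ℂ) + 2) / ((n : ℂ) * ((n : ℂ) + 1))) • spinMatrix n i := by
  obtain ⟨c, hc⟩ := (hB.isVec_conjTranspose.crossProduct hB.isVec).eq_smul_spinMatrix hn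
  have h := sum_mul_cross (spinMatrix n) (fun j => (B j)ᴴ) B
  simp only [hc, hB.cross_conjTranspose_left, Matrix.mul_smul, Matrix.smul_mul,
    ← Finset.smul_sum, spinMatrix_casimir, smul_smul] at h
  have ht : (∑ i, (B i)ᴴ * B i).trace = (n : ℂ) + 2 := by
    have h1 := congrArg Matrix.trace hB.2
    rw [Matrix.trace_sum, Matrix.trace_one, Fintype.card_fin] at h1
    rw [Matrix.trace_sum]
    simp only [Matrix.trace_mul_comm (_ᴴ)]
    rw [h1]
    push_cast
    ring
  have h1 := congrArg Matrix.trace h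
  rw [Matrix.trace_smul, Matrix.trace_smul, ht, Matrix.trace_one, Fintype.card_fin, smul_eq_mul,
    smul_eq_mul] at h1
  have h2 : (n : ℂ) + 1 ≠ 0 := by exact_mod_cast (by omega : n + 1 ≠ 0)
  have h3 : (n : ℂ) ≠ 0 := by exact_mod_cast (by omega : n ≠ 0)
  have h4 : (n : ℂ) - 1 ≠ 0 := sub_ne_zero.2 (by exact_mod_cast (by omega : n ≠ 1))
  rw [hc]
  congr 1
  rw [eq_div_iff (mul_ne_zero h3 h2)]
  apply mul_left_cancel₀ h4
  linear_combination -4 * h1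

theorem IsInvariantTriple.exists_ne_zero (hB : IsInvariantTriple n B) : ∃ i, B i ≠ 0 := by
  by_contra! h
  have h1 := congrFun (congrFun hB.2 0) 0
  simp [h] at h1

/-! ### The block matrices of the Ansatz -/

/-- The generators of `V (n + 2) ⊕ V n`. -/
def totalSpin (n : ℕ) (i : Fin 3) : Matrix (Fin (n + 2) ⊕ Fin n) (Fin (n + 2) ⊕ Fin n) ℂ :=
  Matrix.fromBlocks (spinMatrix (n + 2) i) 0 0 (spinMatrix n i)

/-- The triple of block matrices with complex coefficients `p`, `q`, `q'`, `r` in the blocks. -/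
def blocks (B : Fin 3 → Matrix (Fin (n + 2)) (Fin n) ℂ) (p q q' r : ℂ) (i : Fin 3) :
    Matrix (Fin (n + 2) ⊕ Fin n) (Fin (n + 2) ⊕ Fin n) ℂ :=
  Matrix.fromBlocks (p • spinMatrix (n + 2) i) (q • B i) (-(q' • (B i)ᴴ)) (r • spinMatrix n i)

theorem sum_V_apply_X (n : ℕ) (i : Fin 3) : (V (n + 2)).sum (V n) (X i) = totalSpin n i := by
  rw [totalSpin, ← V_X, ← V_X]
  rfl

theorem ansatz_eq_blocks (fp g fm : ℝ → ℝ) (t : ℝ) (i : Fin 3) :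
    ansatz n B fp g fm t i = blocks B (fp t) (g t) (g t) (fm t) i := by
  simp only [ansatz, blocks, V_X, Complex.coe_smul]

theorem blocks_one_eq_totalSpin (i : Fin 3) : blocks B 1 0 0 1 i = totalSpin n i := by
  simp [blocks, totalSpin]

theorem blocks_add (p q q' r p₁ q₁ q₁' r₁ : ℂ) (i : Fin 3) : blocks B p q q' r i +
    blocks B p₁ q₁ q₁' r₁ i = blocks B (p + p₁) (q + q₁) (q' + q₁') (r + r₁) i := by
  simp only [blocks, Matrix.fromBlocks_add, add_smul, neg_add]

theorem blocks_smul (c p q q' r : ℂ) (i : Fin 3) :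
    c • blocks B p q q' r i = blocks B (c * p) (c * q) (c * q') (c * r) i := by
  simp only [blocks, Matrix.fromBlocks_smul, smul_smul, smul_neg]

theorem blocks_neg (p q q' r : ℂ) (i : Fin 3) :
    - blocks B p q q' r i = blocks B (-p) (-q) (-q') (-r) i := by
  simp only [blocks, Matrix.fromBlocks_neg, neg_smul]

theorem fromBlocks_sub {ι κ μ ν : Type*} (a a' : Matrix ι μ ℂ) (b b' : Matrix ι ν ℂ)
    (c c' : Matrix κ μ ℂ) (d d' : Matrix κ ν ℂ) :
    Matrix.fromBlocks a b c d - Matrix.fromBlocks a' b' c' d' =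
      Matrix.fromBlocks (a - a') (b - b') (c - c') (d - d') := by
  simp only [sub_eq_add_neg, Matrix.fromBlocks_neg, Matrix.fromBlocks_add]

theorem cross_fromBlocks {ι κ : Type*} [Fintype ι] [Fintype κ] (a a' : Fin 3 → Matrix ι ι ℂ)
    (b b' : Fin 3 → Matrix ι κ ℂ) (c c' : Fin 3 → Matrix κ ι ℂ) (d d' : Fin 3 → Matrix κ κ ℂ)
    (i : Fin 3) :
    cross (fun j => Matrix.fromBlocks (a j) (b j) (c j) (d j))
      (fun j => Matrix.fromBlocks (a' j) (b' j) (c' j) (d' j)) i =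
    Matrix.fromBlocks (cross a a' i + cross b c' i) (cross a b' i + cross b d' i)
      (cross c a' i + cross d c' i) (cross c b' i + cross d d' i) := by
  fin_cases i <;>
  · simp only [Fin.zero_eta, Fin.mk_one, Fin.reduceFinMk, cross_zero, cross_one, cross_two,
      Matrix.fromBlocks_multiply, fromBlocks_sub]
    congr 1 <;> abel

/-- The block matrices are closed under the cross product: this reduces Nahm's equations to a
system for the coefficients. -/
theorem cross_blocks (hB : IsInvariantTriple n B) (hn : 2 ≤ n) (p q q' r : ℂ) (i : Fin 3) :
    cross (blocks B p q q' r) (blocks B p q q' r) i =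
      blocks B (p ^ 2 + 2 / ((n : ℂ) + 1) * (q * q'))
        ((((n : ℂ) + 3) / 2 * p - ((n : ℂ) - 1) / 2 * r) * q)
        ((((n : ℂ) + 3) / 2 * p - ((n : ℂ) - 1) / 2 * r) * q')
        (r ^ 2 - 2 * ((n : ℂ) + 2) / ((n : ℂ) * ((n : ℂ) + 1)) * (q * q')) i := by
  have e : blocks B p q q' r = fun j => Matrix.fromBlocks (p • spinMatrix (n + 2) j) (q • B j)
      ((-q') • (B j)ᴴ) (r • spinMatrix n j) := by
    funext j
    rw [blocks, neg_smul]
  rw [e, cross_fromBlocks]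
  simp only [cross_smul_left, cross_smul_right, hB.cross_left, hB.cross_right,
    hB.cross_conjTranspose_left, hB.cross_conjTranspose_right, hB.cross_self_conjTranspose,
    hB.cross_conjTranspose_self hn, cross_spinMatrix, smul_smul, ← add_smul]
  rw [blocks, ← neg_smul]
  congr 2 <;> ring

/-- The block matrices form a vector operator for the generators of `V (n + 2) ⊕ V n`. -/
theorem isVec_blocks (hB : IsInvariantTriple n B) (p q q' r : ℂ) :
    IsVec (totalSpin n) (totalSpin n) (blocks B p q q' r) := by
  intro j k
  have h1 := isVec_spinMatrix (n + 2) j k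
  have h2 := isVec_spinMatrix n j k
  have h3 := hB.isVec j k
  have h4 := hB.isVec_conjTranspose j k
  simp only [blocks, totalSpin, Fin.sum_univ_three, Matrix.fromBlocks_smul,
    Matrix.fromBlocks_add, Matrix.fromBlocks_multiply, fromBlocks_sub, Matrix.zero_mul,
    Matrix.mul_zero, add_zero, zero_add, Matrix.mul_smul, Matrix.smul_mul, Matrix.mul_neg,
    Matrix.neg_mul, smul_zero, neg_zero] at *
  congr 1
  · rw [← smul_sub, h1]; simp only [smul_add, smul_comm p]
  · rw [← smul_sub, h3]; simp only [smul_add, smul_comm q]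
  · rw [← neg_sub', ← smul_sub, h4]; simp only [smul_add, smul_neg, neg_add, smul_comm q']
  · rw [← smul_sub, h2]; simp only [smul_add, smul_comm r]

theorem conjTranspose_blocks (p q r : ℂ) (i : Fin 3) :
    (blocks B p q (star q) r i)ᴴ = - blocks B (star p) q (star q) (star r) i := by
  simp [blocks, Matrix.fromBlocks_conjTranspose, Matrix.fromBlocks_neg, conjTranspose_spinMatrix]

theorem conjTranspose_totalSpin (n : ℕ) (i : Fin 3) : (totalSpin n i)ᴴ = - totalSpin n i := by
  simp [totalSpin, Matrix.fromBlocks_conjTranspose, Matrix.fromBlocks_neg,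
    conjTranspose_spinMatrix]

theorem trace_blocks (hB : IsInvariantTriple n B) (p q q' r : ℂ) (i : Fin 3) :
    (blocks B p q q' r i).trace = 0 :=
  trace_eq_zero_of_isVec (isVec_blocks hB p q q' r) i

end

/-! ### Existence of the invariant triple -/

/-- A matrix supported on the `d`-th diagonal below the main one, with real entries. -/
def lowerDiag (p q d : ℕ) (f : ℕ → ℝ) : Matrix (Fin p) (Fin q) ℂ :=
  Matrix.of fun a b => if (a : ℕ) = b + d then ((f b : ℝ) : ℂ) else 0

section
variable {p q : ℕ}

theorem lowerDiag_apply (d : ℕ) (f : ℕ → ℝ) (a : Fin p) (b : Fin q) :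
    lowerDiag p q d f a b = if (a : ℕ) = b + d then ((f b : ℝ) : ℂ) else 0 := rfl

theorem ladderCoeff_last {k a : ℕ} (h : a + 1 = k) : ladderCoeff k a = 0 := by
  rw [ladderCoeff, ← h]
  simp

theorem raising_mul_lowerDiag_apply (d : ℕ) (f : ℕ → ℝ) (a : Fin p) (b : Fin q) :
    (raising p * lowerDiag p q d f) a b =
      if (a : ℕ) + 1 = b + d then ((ladderCoeff p a * f b : ℝ) : ℂ) else 0 := by
  by_cases h : (a : ℕ) + 1 < p
  · rw [raising_mul_apply _ _ _ h, lowerDiag_apply]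
    simp
  · rw [show (raising p * lowerDiag p q d f) a b = 0 from raising_mulVec_apply_last _ a h,
      ladderCoeff_last (by omega)]
    simp

theorem raising_transpose_mul_lowerDiag_apply (d : ℕ) (f : ℕ → ℝ) (a : Fin p) (b : Fin q) :
    ((raising p)ᵀ * lowerDiag p q d f) a b =
      if (a : ℕ) = b + d + 1 then ((ladderCoeff p (b + d) * f b : ℝ) : ℂ) else 0 := by
  rw [Matrix.mul_apply]
  simp only [Matrix.transpose_apply, raising_apply, lowerDiag_apply]
  split_ifs with h
  · rw [Finset.sum_eq_single (⟨b + d, by omega⟩ : Fin p)]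
    · simp [h]
    · intro c _ hc
      rw [if_neg (c := (c : ℕ) = b + d) (fun h => hc (Fin.ext h)), mul_zero]
    · simp
  · refine Finset.sum_eq_zero fun c _ => ?_
    split_ifs <;> first | omega | simp

theorem lowerDiag_mul_raising_apply (d : ℕ) (f : ℕ → ℝ) (a : Fin p) (b : Fin q) :
    (lowerDiag p q d f * raising q) a b =
      if (a : ℕ) + 1 = b + d ∧ 1 ≤ (b : ℕ) then
        ((f (b - 1) * ladderCoeff q (b - 1) : ℝ) : ℂ) else 0 := by
  rw [Matrix.mul_apply]
  simp only [raising_apply, lowerDiag_apply]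
  split_ifs with h
  · rw [Finset.sum_eq_single (⟨b - 1, by omega⟩ : Fin q)]
    · rw [if_pos (by simp only; omega), if_pos (by simp only; omega)]
      push_cast
      rfl
    · intro c _ hc
      rw [if_neg (c := (c : ℕ) + 1 = b) (fun h => hc (Fin.ext (by simp only; omega))), mul_zero]
    · simp
  · refine Finset.sum_eq_zero fun c _ => ?_
    split_ifs <;> first | omega | simp

theorem lowerDiag_mul_raising_transpose_apply (d : ℕ) (f : ℕ → ℝ) (a : Fin p) (b : Fin q) :
    (lowerDiag p q d f * (raising q)ᵀ) a b =
      if (a : ℕ) = b + 1 + d then ((f (b + 1) * ladderCoeff q b : ℝ) : ℂ) else 0 := by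
  rw [Matrix.mul_apply]
  simp only [Matrix.transpose_apply, raising_apply, lowerDiag_apply]
  by_cases hb : (b : ℕ) + 1 < q
  · rw [Finset.sum_eq_single (⟨b + 1, hb⟩ : Fin q)]
    · simp
    · intro c _ hc
      rw [if_neg (c := (b : ℕ) + 1 = c) (fun h => hc (Fin.ext h.symm)), mul_zero]
    · simp
  · rw [ladderCoeff_last (by omega)]
    refine (Finset.sum_eq_zero fun c _ => ?_).trans (by simp)
    rw [if_neg (c := (b : ℕ) + 1 = c) (by omega), mul_zero]

theorem ladderCoeff_eq (k a : ℕ) :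
    ladderCoeff k a = Real.sqrt ((a : ℝ) + 1) * Real.sqrt ((k : ℝ) - 1 - a) :=
  Real.sqrt_mul (by positivity) _

end

/-- The weight component of the invariant triple, up to normalization: its entries are
Clebsch-Gordan coefficients. -/
def cgWt (n : ℕ) : Matrix (Fin (n + 2)) (Fin n) ℂ :=
  lowerDiag _ _ 1 fun b => Real.sqrt ((b : ℝ) + 1) * Real.sqrt ((n : ℝ) - b)

/-- The negative of the raising component of the invariant triple, up to normalization. -/
def cgUp (n : ℕ) : Matrix (Fin (n + 2)) (Fin n) ℂ :=
  lowerDiag _ _ 0 fun b => Real.sqrt ((n : ℝ) - b) * Real.sqrt ((n : ℝ) + 1 - b)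

/-- The lowering component of the invariant triple, up to normalization. -/
def cgDown (n : ℕ) : Matrix (Fin (n + 2)) (Fin n) ℂ :=
  lowerDiag _ _ 2 fun b => Real.sqrt ((b : ℝ) + 1) * Real.sqrt ((b : ℝ) + 2)

theorem weight_mul_lowerDiag {p q d : ℕ} (f : ℕ → ℝ) :
    weight p * lowerDiag p q d f = lowerDiag p q d f * weight q +
      (((p : ℂ) - q) / 2 - d) • lowerDiag p q d f := by
  ext a b
  rw [weight, weight, Matrix.diagonal_mul, Matrix.add_apply, Matrix.mul_diagonal,
    Matrix.smul_apply, lowerDiag_apply, smul_eq_mul]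
  split_ifs with h
  · have h1 : ((a : ℕ) : ℂ) = (b : ℕ) + d := by exact_mod_cast h
    rw [h1]
    ring
  · ring

/-- The Clebsch-Gordan matrices form a vector operator from `V n` to `V (n + 2)`. -/
theorem isVec_cg (n : ℕ) : IsVec (spinMatrix (n + 2)) (spinMatrix n)
    (ofLadder (cgWt n) (-cgUp n) (cgDown n)) := by
  have two : (2 : ℂ) = ((2 : ℝ) : ℂ) := by norm_num
  have hn : ∀ b : Fin n, (0 : ℝ) ≤ (n : ℝ) - (b : ℕ) - 1 := by
    intro b
    have h1 : (((b : ℕ) + 1 : ℕ) : ℝ) ≤ n := by exact_mod_cast b.2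
    push_cast at h1
    linarith
  rw [spinMatrix_eq_ofLadder, spinMatrix_eq_ofLadder]
  -- in each of the nine ladder relations all terms live on the same diagonal, and the entries on
  -- it are compared after splitting the square roots into linear factors
  apply isVec_ofLadder
  · rw [cgWt, weight_mul_lowerDiag]
    push_cast
    module
  · rw [cgUp, Matrix.mul_neg, weight_mul_lowerDiag, Matrix.neg_mul]
    push_cast
    module
  · rw [cgDown, weight_mul_lowerDiag]
    push_cast
    module
  · ext a b
    have hb := hn b
    rw [Matrix.sub_apply, Matrix.neg_apply, cgWt, raising_mul_lowerDiag_apply,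
      lowerDiag_mul_raising_apply, cgUp, lowerDiag_apply]
    by_cases h : (a : ℕ) = b
    · rw [if_pos (by omega), if_pos (c := (a : ℕ) = b + 0) (by omega), ladderCoeff_eq, h]
      have e1 : ((n + 2 : ℕ) : ℝ) - 1 - (b : ℕ) = (n : ℝ) + 1 - (b : ℕ) := by push_cast; ring
      have s1 := Real.mul_self_sqrt (by positivity : (0 : ℝ) ≤ ((b : ℕ) : ℝ) + 1)
      rw [e1]
      by_cases h0 : 1 ≤ (b : ℕ)
      · rw [if_pos (by omega), ladderCoeff_eq, Nat.cast_sub h0]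
        have e2 : (((b : ℕ) : ℝ) - (1 : ℕ)) + 1 = (b : ℕ) := by push_cast; ring
        have e3 : (n : ℝ) - 1 - (((b : ℕ) : ℝ) - (1 : ℕ)) = n - (b : ℕ) := by push_cast; ring
        have e4 : (n : ℝ) - (((b : ℕ) : ℝ) - (1 : ℕ)) = n + 1 - (b : ℕ) := by push_cast; ring
        rw [e2, e3, e4, sub_neg_eq_add]
        simp only [← Complex.ofReal_add, Complex.ofReal_inj]
        have s2 := Real.mul_self_sqrt (by positivity : (0 : ℝ) ≤ ((b : ℕ) : ℝ))
        linear_combination (√((n : ℝ) + 1 - (b : ℕ)) * √((n : ℝ) - (b : ℕ))) * (s1 - s2)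
      · have h1 : (b : ℕ) = 0 := by omega
        rw [if_neg (by omega), h1]
        push_cast
        simp
        ring
    · rw [if_neg (by omega), if_neg (by omega), if_neg (by omega)]
      simp
  · ext a b
    have hb := hn b
    rw [Matrix.mul_neg, Matrix.neg_mul, Matrix.neg_apply, Matrix.neg_apply, cgUp,
      raising_mul_lowerDiag_apply, lowerDiag_mul_raising_apply]
    by_cases h : (a : ℕ) + 1 = b
    · have h1 : (b : ℕ) - 1 = a := by omega
      rw [if_pos (by omega), if_pos (by omega), ladderCoeff_eq, ladderCoeff_eq, h1, ← h]
      have e1 : ((n + 2 : ℕ) : ℝ) - 1 - (a : ℕ) = (n : ℝ) + 1 - (a : ℕ) := by push_cast; ring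
      have e2 : (n : ℝ) - (((a : ℕ) + 1 : ℕ) : ℝ) = n - 1 - (a : ℕ) := by push_cast; ring
      have e3 : (n : ℝ) + 1 - (((a : ℕ) + 1 : ℕ) : ℝ) = n - (a : ℕ) := by push_cast; ring
      rw [e1, e2, e3]
      push_cast
      ring
    · rw [if_neg (by omega), if_neg (by omega)]
  · ext a b
    have hb := hn b
    rw [Matrix.add_apply, Matrix.smul_apply, cgWt, cgDown, raising_mul_lowerDiag_apply,
      lowerDiag_mul_raising_apply, lowerDiag_apply, smul_eq_mul]
    by_cases h : (a : ℕ) = b + 1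
    · rw [if_pos (by omega), if_pos (c := (a : ℕ) = b + 1) h, ladderCoeff_eq, h]
      have e1 : ((n + 2 : ℕ) : ℝ) - 1 - (((b : ℕ) + 1 : ℕ) : ℝ) = (n : ℝ) - (b : ℕ) := by
        push_cast; ring
      have e1' : (((b : ℕ) + 1 : ℕ) : ℝ) + 1 = (b : ℕ) + 2 := by push_cast; ring
      have s1 := Real.mul_self_sqrt (by positivity : (0 : ℝ) ≤ ((b : ℕ) : ℝ) + 2)
      rw [e1, e1']
      by_cases h0 : 1 ≤ (b : ℕ)
      · rw [if_pos (by omega), ladderCoeff_eq, Nat.cast_sub h0]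
        have e2 : (((b : ℕ) : ℝ) - (1 : ℕ)) + 1 = (b : ℕ) := by push_cast; ring
        have e3 : (n : ℝ) - 1 - (((b : ℕ) : ℝ) - (1 : ℕ)) = n - (b : ℕ) := by push_cast; ring
        have e4 : (((b : ℕ) : ℝ) - (1 : ℕ)) + 2 = (b : ℕ) + 1 := by push_cast; ring
        rw [e2, e3, e4]
        simp only [two, ← Complex.ofReal_mul, ← Complex.ofReal_add, Complex.ofReal_inj]
        have s2 := Real.mul_self_sqrt (by positivity : (0 : ℝ) ≤ ((b : ℕ) : ℝ))
        linear_combination (√(((b : ℕ) : ℝ) + 1) * √((n : ℝ) - (b : ℕ))) * (s1 - s2)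
      · have h1 : (b : ℕ) = 0 := by omega
        rw [if_neg (by omega), h1]
        simp only [zero_add, two, ← Complex.ofReal_mul, Complex.ofReal_inj]
        simp only [CharP.cast_eq_zero, zero_add, Real.sqrt_one, sub_zero, one_mul]
        have s2 := Real.mul_self_sqrt (by positivity : (0 : ℝ) ≤ 2)
        linear_combination √(n : ℝ) * s2
    · rw [if_neg (by omega), if_neg (by omega), if_neg (by omega)]
      simp
  · ext a b
    have hb := hn b
    rw [Matrix.add_apply, cgWt, cgDown, raising_transpose_mul_lowerDiag_apply,
      lowerDiag_mul_raising_transpose_apply, lowerDiag_apply]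
    by_cases h : (a : ℕ) = b + 2
    · rw [if_pos (by omega), if_pos (by omega), if_pos (by omega), ladderCoeff_eq,
        ladderCoeff_eq]
      have e1 : ((n + 2 : ℕ) : ℝ) - 1 - (((b : ℕ) + 1 : ℕ) : ℝ) = (n : ℝ) - (b : ℕ) := by
        push_cast; ring
      have e2 : (((b : ℕ) + 1 : ℕ) : ℝ) + 1 = (b : ℕ) + 2 := by push_cast; ring
      have e3 : (n : ℝ) - (((b : ℕ) + 1 : ℕ) : ℝ) = n - (b : ℕ) - 1 := by push_cast; ring
      have e4 : (n : ℝ) - 1 - ((b : ℕ) : ℝ) = n - (b : ℕ) - 1 := by ring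
      have s1 := Real.mul_self_sqrt hb
      have s2 := Real.mul_self_sqrt (by linarith : (0 : ℝ) ≤ (n : ℝ) - (b : ℕ))
      rw [e1, e2, e3, e4]
      simp only [← Complex.ofReal_add, Complex.ofReal_inj]
      linear_combination (√(((b : ℕ) : ℝ) + 1) * √(((b : ℕ) : ℝ) + 2)) * (s2 - s1)
    · rw [if_neg (by omega), if_neg (by omega), if_neg (by omega)]
      simp
  · ext a b
    have hb := hn b
    rw [Matrix.sub_apply, Matrix.smul_apply, Matrix.mul_neg, Matrix.neg_mul, Matrix.neg_apply,
      Matrix.neg_apply, cgUp, cgWt, raising_transpose_mul_lowerDiag_apply,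
      lowerDiag_mul_raising_transpose_apply, lowerDiag_apply, smul_eq_mul]
    by_cases h : (a : ℕ) = b + 1
    · rw [if_pos (by omega), if_pos (by omega), if_pos (by omega), ladderCoeff_eq,
        ladderCoeff_eq]
      have e1 : ((n + 2 : ℕ) : ℝ) - 1 - (((b : ℕ) + 0 : ℕ) : ℝ) = (n : ℝ) + 1 - (b : ℕ) := by
        push_cast; ring
      have e2 : (((b : ℕ) + 0 : ℕ) : ℝ) + 1 = (b : ℕ) + 1 := by push_cast; ring
      have e3 : (n : ℝ) - (((b : ℕ) + 1 : ℕ) : ℝ) = n - (b : ℕ) - 1 := by push_cast; ring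
      have e4 : (n : ℝ) - 1 - ((b : ℕ) : ℝ) = n - (b : ℕ) - 1 := by ring
      have e5 : (n : ℝ) + 1 - (((b : ℕ) + 1 : ℕ) : ℝ) = n - (b : ℕ) := by push_cast; ring
      have s1 := Real.mul_self_sqrt hb
      have s2 := Real.mul_self_sqrt (by linarith : (0 : ℝ) ≤ (n : ℝ) + 1 - (b : ℕ))
      rw [e1, e2, e3, e4, e5]
      simp only [two, ← Complex.ofReal_mul, ← Complex.ofReal_sub, ← Complex.ofReal_neg,
        Complex.ofReal_inj]
      linear_combination (-√(((b : ℕ) : ℝ) + 1) * √((n : ℝ) - (b : ℕ))) * (s2 - s1)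
    · rw [if_neg (by omega), if_neg (by omega), if_neg (by omega)]
      simp
  · ext a b
    have hb := hn b
    rw [cgDown, raising_transpose_mul_lowerDiag_apply, lowerDiag_mul_raising_transpose_apply]
    by_cases h : (a : ℕ) = b + 3
    · rw [if_pos (by omega), if_pos (by omega), ladderCoeff_eq, ladderCoeff_eq]
      have e1 : ((n + 2 : ℕ) : ℝ) - 1 - (((b : ℕ) + 2 : ℕ) : ℝ) = (n : ℝ) - 1 - (b : ℕ) := by
        push_cast; ring
      have e2 : (((b : ℕ) + 2 : ℕ) : ℝ) + 1 = (b : ℕ) + 3 := by push_cast; ring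
      have e3 : (((b : ℕ) + 1 : ℕ) : ℝ) + 1 = (b : ℕ) + 2 := by push_cast; ring
      have e4 : (((b : ℕ) + 1 : ℕ) : ℝ) + 2 = (b : ℕ) + 3 := by push_cast; ring
      rw [e1, e2, e3, e4]
      norm_cast
      ring
    · rw [if_neg (by omega), if_neg (by omega)]

theorem lowerDiag_mul_conjTranspose (p q d : ℕ) (f : ℕ → ℝ) :
    lowerDiag p q d f * (lowerDiag p q d f)ᴴ = Matrix.diagonal fun a : Fin p =>
      if d ≤ (a : ℕ) ∧ (a : ℕ) - d < q then ((f (a - d) * f (a - d) : ℝ) : ℂ) else 0 := by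
  ext a b
  rw [Matrix.mul_apply, Matrix.diagonal_apply]
  simp only [Matrix.conjTranspose_apply, lowerDiag_apply]
  by_cases hab : a = b
  · subst hab
    rw [if_pos rfl]
    split_ifs with h
    · rw [Finset.sum_eq_single (⟨a - d, h.2⟩ : Fin q)]
      · rw [if_pos (by simp only; omega)]
        simp
      · intro c _ hc
        rw [if_neg (fun h => hc (Fin.ext (by simp only; omega))), zero_mul]
      · simp
    · refine Finset.sum_eq_zero fun c _ => ?_
      rw [if_neg (by have := c.2; omega), zero_mul]
  · rw [if_neg hab]
    refine Finset.sum_eq_zero fun c _ => ?_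
    split_ifs with h1 h2
    · exact absurd (Fin.ext (h1.trans h2.symm)) hab
    all_goals simp

/-- The contraction of the Clebsch-Gordan matrices with their adjoints. The three diagonal matrices
add up to a scalar, because their entries are given by polynomials that also vanish at the
indices outside the supports of the matrices. -/
theorem cg_normalization (n : ℕ) :
    cgWt n * (cgWt n)ᴴ + (1 / 2 : ℂ) • (cgUp n * (cgUp n)ᴴ + cgDown n * (cgDown n)ᴴ) =
      ((n : ℂ) * (n + 1) / 2) • (1 : Matrix _ _ ℂ) := by
  rw [cgWt, cgUp, cgDown, lowerDiag_mul_conjTranspose, lowerDiag_mul_conjTranspose,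
    lowerDiag_mul_conjTranspose, Matrix.diagonal_add, ← Matrix.diagonal_smul, Matrix.diagonal_add,
    Matrix.smul_one_eq_diagonal]
  congr 1
  funext a
  have sq : ∀ x y : ℝ, 0 ≤ x → 0 ≤ y → √x * √y * (√x * √y) = x * y := by
    intro x y hx hy
    rw [mul_mul_mul_comm, Real.mul_self_sqrt hx, Real.mul_self_sqrt hy]
  have han : ((a : ℕ) : ℝ) ≤ (n : ℝ) + 1 := by exact_mod_cast Nat.lt_succ_iff.1 a.2
  have e0 : (if 0 ≤ (a : ℕ) ∧ (a : ℕ) - 0 < n then ((√((n : ℝ) - ((a - 0 : ℕ) : ℝ)) *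
      √((n : ℝ) + 1 - ((a - 0 : ℕ) : ℝ)) * (√((n : ℝ) - ((a - 0 : ℕ) : ℝ)) *
      √((n : ℝ) + 1 - ((a - 0 : ℕ) : ℝ))) : ℝ) : ℂ) else 0) =
      ((((n : ℝ) - (a : ℕ)) * (n + 1 - (a : ℕ)) : ℝ) : ℂ) := by
    split_ifs with h
    · have h1 : ((a : ℕ) : ℝ) ≤ n := by exact_mod_cast (by omega : (a : ℕ) ≤ n)
      rw [Nat.sub_zero, sq _ _ (by linarith) (by linarith)]
    · have h1 : (a : ℕ) = n ∨ (a : ℕ) = n + 1 := by have := a.2; omega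
      rcases h1 with h1 | h1 <;> rw [h1] <;> push_cast <;> ring
  have e1 : (if 1 ≤ (a : ℕ) ∧ (a : ℕ) - 1 < n then ((√(((a - 1 : ℕ) : ℝ) + 1) *
      √((n : ℝ) - ((a - 1 : ℕ) : ℝ)) * (√(((a - 1 : ℕ) : ℝ) + 1) *
      √((n : ℝ) - ((a - 1 : ℕ) : ℝ))) : ℝ) : ℂ) else 0) =
      ((((a : ℕ) : ℝ) * (n + 1 - (a : ℕ)) : ℝ) : ℂ) := by
    split_ifs with h
    · rw [Nat.cast_sub h.1, sq _ _ (by push_cast; simp) (by push_cast; linarith)]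
      push_cast
      ring
    · have h1 : (a : ℕ) = 0 ∨ (a : ℕ) = n + 1 := by have := a.2; omega
      rcases h1 with h1 | h1 <;> rw [h1] <;> push_cast <;> ring
  have e2 : (if 2 ≤ (a : ℕ) ∧ (a : ℕ) - 2 < n then ((√(((a - 2 : ℕ) : ℝ) + 1) *
      √(((a - 2 : ℕ) : ℝ) + 2) * (√(((a - 2 : ℕ) : ℝ) + 1) *
      √(((a - 2 : ℕ) : ℝ) + 2)) : ℝ) : ℂ) else 0) =
      ((((a : ℕ) : ℝ) * ((a : ℕ) - 1) : ℝ) : ℂ) := by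
    split_ifs with h
    · rw [sq _ _ (by positivity) (by positivity), Nat.cast_sub h.1]
      push_cast
      ring
    · have h1 : (a : ℕ) = 0 ∨ (a : ℕ) = 1 := by have := a.2; omega
      rcases h1 with h1 | h1 <;> rw [h1] <;> push_cast <;> ring
  simp only [Pi.smul_apply, e0, e1, e2, smul_eq_mul]
  push_cast
  ring

theorem exists_isInvariantTriple (n : ℕ) (hn : 2 ≤ n) :
    ∃ B : Fin 3 → Matrix (Fin (n + 2)) (Fin n) ℂ, IsInvariantTriple n B := by
  have hpos : (0 : ℝ) < (n : ℝ) * (n + 1) / 2 := by positivity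
  set s : ℝ := (√((n : ℝ) * (n + 1) / 2))⁻¹ with hs
  have hss : ((s : ℝ) : ℂ) * ((s : ℝ) : ℂ) * ((n : ℂ) * (n + 1) / 2) = 1 := by
    have h : s * s * ((n : ℝ) * (n + 1) / 2) = 1 := by
      rw [hs, ← mul_inv, Real.mul_self_sqrt hpos.le, inv_mul_cancel₀ hpos.ne']
    have h' := congrArg Complex.ofReal h
    push_cast at h'
    exact h'
  set C := ofLadder (cgWt n) (-cgUp n) (cgDown n) with hC
  refine ⟨fun i => (s : ℂ) • C i, isVec_of_forall_V.2 fun i j => ?_, ?_⟩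
  · rw [Matrix.mul_smul, Matrix.smul_mul, ← smul_sub, isVec_cg n i j, Finset.smul_sum]
    exact Finset.sum_congr rfl fun m _ => smul_comm _ _ _
  · have h : ∑ i, C i * (C i)ᴴ = ((n : ℂ) * (n + 1) / 2) • (1 : Matrix _ _ ℂ) := by
      rw [← cg_normalization, Fin.sum_univ_three, hC]
      simp only [ofLadder, Matrix.cons_val_zero, Matrix.cons_val_one, Matrix.cons_val,
        Matrix.conjTranspose_smul, Matrix.conjTranspose_sub, Matrix.conjTranspose_add,
        Matrix.conjTranspose_neg, Matrix.smul_mul, Matrix.mul_smul, Matrix.mul_add,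
        Matrix.add_mul, Matrix.mul_sub, Matrix.sub_mul, Matrix.neg_mul, Matrix.mul_neg, smul_smul]
      simp only [RCLike.star_def, map_div₀, Complex.conj_I, map_one, map_ofNat]
      match_scalars <;> ring_nf <;> simp only [Complex.I_sq] <;> ring1
    simp only [Matrix.conjTranspose_smul, Matrix.smul_mul, Matrix.mul_smul, smul_smul,
      ← Finset.smul_sum, h, RCLike.star_def, Complex.conj_ofReal, hss, one_smul]

/-! ### Unitary normal form of the generating representation -/

theorem so3_eq_sum (A : so3) : A = A.1 2 1 • X 0 + A.1 0 2 • X 1 + A.1 1 0 • X 2 := by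
  have hs : ∀ i j : Fin 3, A.1 i j = - A.1 j i := by
    intro i j
    have h := (LieAlgebra.Orthogonal.mem_so (Fin 3) ℝ A.1).1 A.2
    simpa using congrFun (congrFun h j) i
  have hd : ∀ i : Fin 3, A.1 i i = 0 := fun i => by linarith [hs i i]
  apply Subtype.ext
  change A.1 = A.1 2 1 • (X 0).1 + A.1 0 2 • (X 1).1 + A.1 1 0 • (X 2).1
  ext i j
  have h01 := hs 0 1
  have h12 := hs 1 2
  have h20 := hs 2 0
  fin_cases i <;> fin_cases j <;> simp [X, eps, hd] <;> linarith

theorem Rep.apply_eq_sum {ι : Type*} [Fintype ι] [DecidableEq ι] (ρ : Rep ι) (A : so3) :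
    ρ A = A.1 2 1 • ρ (X 0) + A.1 0 2 • ρ (X 1) + A.1 1 0 • ρ (X 2) := by
  conv_lhs => rw [so3_eq_sum A]
  rw [map_add, map_add, map_smul, map_smul, map_smul]

/-- Block matrices that act by a scalar on each of the two summands. -/
def scalarBlocks (n : ℕ) (u v : ℂ) : Matrix (Fin (n + 2) ⊕ Fin n) (Fin (n + 2) ⊕ Fin n) ℂ :=
  Matrix.fromBlocks (u • 1) 0 0 (v • 1)

section
variable {n : ℕ}

theorem scalarBlocks_mul (u v u' v' : ℂ) :
    scalarBlocks n u v * scalarBlocks n u' v' = scalarBlocks n (u * u') (v * v') := by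
  simp [scalarBlocks, Matrix.fromBlocks_multiply, smul_smul, mul_comm]

theorem scalarBlocks_one : scalarBlocks n 1 1 = 1 := by
  simp [scalarBlocks, Matrix.fromBlocks_one]

theorem conjTranspose_scalarBlocks (u v : ℂ) :
    (scalarBlocks n u v)ᴴ = scalarBlocks n (star u) (star v) := by
  simp [scalarBlocks, Matrix.fromBlocks_conjTranspose]

theorem scalarBlocks_mul_totalSpin (u v : ℂ) (i : Fin 3) :
    scalarBlocks n u v * totalSpin n i = totalSpin n i * scalarBlocks n u v := by
  simp [scalarBlocks, totalSpin, Matrix.fromBlocks_multiply]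

theorem det_scalarBlocks (u v : ℂ) : (scalarBlocks n u v).det = u ^ (n + 2) * v ^ n := by
  simp [scalarBlocks, Matrix.det_fromBlocks_zero₂₁]

theorem scalarBlocks_conj_blocks (B : Fin 3 → Matrix (Fin (n + 2)) (Fin n) ℂ)
    (u v p q q' r : ℂ) (i : Fin 3) :
    scalarBlocks n u v * blocks B p q q' r i * (scalarBlocks n u v)ᴴ =
      blocks B (u * star u * p) (u * star v * q) (v * star u * q') (v * star v * r) i := by
  rw [conjTranspose_scalarBlocks]
  simp only [scalarBlocks, blocks, Matrix.fromBlocks_multiply, Matrix.smul_mul, Matrix.mul_smul,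
    Matrix.one_mul, Matrix.mul_one, Matrix.zero_mul, Matrix.mul_zero, add_zero, zero_add,
    smul_zero, smul_neg, smul_smul]
  congr 1 <;> module

/-- Schur's lemma for `V (n + 2) ⊕ V n`. -/
theorem eq_scalarBlocks_of_commute
    {G : Matrix (Fin (n + 2) ⊕ Fin n) (Fin (n + 2) ⊕ Fin n) ℂ}
    (hG : ∀ i, totalSpin n i * G = G * totalSpin n i) : ∃ u v, G = scalarBlocks n u v := by
  rw [← Matrix.fromBlocks_toBlocks G] at hG ⊢
  simp only [totalSpin, Matrix.fromBlocks_multiply, Matrix.zero_mul, Matrix.mul_zero, add_zero,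
    zero_add, Matrix.fromBlocks_inj] at hG
  obtain ⟨u, hu⟩ := eq_smul_one_of_commute fun i => (hG i).1
  obtain ⟨v, hv⟩ := eq_smul_one_of_commute fun i => (hG i).2.2.2
  have h1 := eq_zero_of_casimir_ne (spinMatrix_casimir (n + 2)) (spinMatrix_casimir n)
    (casimir_ne (by omega)) fun i => (hG i).2.1
  have h2 := eq_zero_of_casimir_ne (spinMatrix_casimir n) (spinMatrix_casimir (n + 2))
    (casimir_ne (by omega)) fun i => (hG i).2.2.1
  exact ⟨u, v, by rw [hu, hv, h1, h2, scalarBlocks]⟩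

theorem mul_conjTranspose_diag {ι : Type*} [Fintype ι] (M : Matrix ι ι ℂ) (a : ι) :
    (M * Mᴴ) a a = ((∑ c, Complex.normSq (M a c) : ℝ) : ℂ) := by
  rw [Matrix.mul_apply]
  push_cast
  exact Finset.sum_congr rfl fun c _ => by
    rw [Matrix.conjTranspose_apply, RCLike.star_def, Complex.mul_conj]

theorem sum_normSq_pos {ι : Type*} [Fintype ι] [DecidableEq ι] {M M' : Matrix ι ι ℂ}
    (h : M * M' = 1) (a : ι) : 0 < ∑ c, Complex.normSq (M a c) := by
  refine lt_of_le_of_ne (Finset.sum_nonneg fun c _ => Complex.normSq_nonneg _) fun h0 => ?_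
  have h1 := (Finset.sum_eq_zero_iff_of_nonneg fun c _ => Complex.normSq_nonneg (M a c)).1 h0.symm
  have h2 := congrFun (congrFun h a) a
  rw [Matrix.mul_apply, Finset.sum_eq_zero, Matrix.one_apply_eq] at h2
  · exact zero_ne_one h2
  · intro c hc
    rw [Complex.normSq_eq_zero.1 (h1 c hc), zero_mul]

/-- An isomorphism between skew-Hermitian representations can be made unitary. By Schur's lemma,
an intertwiner `M` has `M * Mᴴ` scalar on both summands, so it suffices to rescale. -/
theorem exists_unitary_intertwiner (hn : 2 ≤ n) {ρ : Rep (Fin (n + 2) ⊕ Fin n)}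
    (hρ : ∀ i, IsSu (ρ (X i))) (hiso : ρ.Iso ((V (n + 2)).sum (V n))) :
    ∃ U : Matrix (Fin (n + 2) ⊕ Fin n) (Fin (n + 2) ⊕ Fin n) ℂ, U * Uᴴ = 1 ∧
      ∀ i, U * ρ (X i) = totalSpin n i * U := by
  obtain ⟨P, hP⟩ := hiso
  set M := LinearMap.toMatrix' P.toLinearMap with hM
  set M' := LinearMap.toMatrix' P.symm.toLinearMap with hM'
  have hMM' : M * M' = 1 := by
    rw [hM, hM', ← LinearMap.toMatrix'_comp]
    simp
  have hMv : ∀ v, P v = M *ᵥ v := fun v => by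
    rw [hM, LinearMap.toMatrix'_mulVec]
    rfl
  have hint : ∀ i, M * ρ (X i) = totalSpin n i * M := by
    intro i
    refine Matrix.mulVec_injective (funext fun v => ?_)
    have := hP (X i) v
    rw [sum_V_apply_X, hMv, hMv, Matrix.mulVec_mulVec, Matrix.mulVec_mulVec] at this
    exact this
  have hint' : ∀ i, ρ (X i) * Mᴴ = Mᴴ * totalSpin n i := by
    intro i
    have := congrArg Matrix.conjTranspose (hint i)
    rw [Matrix.conjTranspose_mul, Matrix.conjTranspose_mul, (hρ i).1, conjTranspose_totalSpin,
      Matrix.neg_mul, Matrix.mul_neg, neg_inj] at this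
    exact this
  obtain ⟨a, b, hab⟩ := eq_scalarBlocks_of_commute (G := M * Mᴴ) (n := n) (fun i => by
    rw [← Matrix.mul_assoc, ← hint, Matrix.mul_assoc, hint', Matrix.mul_assoc])
  have ha := mul_conjTranspose_diag M (Sum.inl ⟨0, by omega⟩)
  have hb := mul_conjTranspose_diag M (Sum.inr ⟨0, by omega⟩)
  have ha0 := sum_normSq_pos hMM' (Sum.inl ⟨0, by omega⟩)
  have hb0 := sum_normSq_pos hMM' (Sum.inr ⟨0, by omega⟩)
  set x := ∑ c, Complex.normSq (M (Sum.inl ⟨0, by omega⟩) c)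
  set y := ∑ c, Complex.normSq (M (Sum.inr ⟨0, by omega⟩) c)
  rw [hab] at ha hb
  simp only [scalarBlocks, Matrix.fromBlocks_apply₁₁, Matrix.fromBlocks_apply₂₂,
    Matrix.smul_apply, Matrix.one_apply_eq, smul_eq_mul, mul_one] at ha hb
  have key : ∀ z : ℝ, 0 < z → (((√z)⁻¹ : ℝ) : ℂ) * z * (((√z)⁻¹ : ℝ) : ℂ) = 1 := by
    intro z hz
    have : (√z)⁻¹ * z * (√z)⁻¹ = 1 := by
      rw [mul_right_comm, ← mul_inv, Real.mul_self_sqrt hz.le, inv_mul_cancel₀ hz.ne']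
    exact_mod_cast this
  refine ⟨scalarBlocks n ((√x)⁻¹ : ℝ) ((√y)⁻¹ : ℝ) * M, ?_, fun i => ?_⟩
  · rw [Matrix.conjTranspose_mul, Matrix.mul_assoc, ← Matrix.mul_assoc M, hab,
      conjTranspose_scalarBlocks, scalarBlocks_mul, scalarBlocks_mul, ha, hb, RCLike.star_def,
      Complex.conj_ofReal, Complex.conj_ofReal, ← mul_assoc, ← mul_assoc,
      key x ha0, key y hb0, scalarBlocks_one]
  · rw [Matrix.mul_assoc, hint, ← Matrix.mul_assoc, scalarBlocks_mul_totalSpin, Matrix.mul_assoc]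

/-- A skew-Hermitian vector operator on `V (n + 2) ⊕ V n` is a triple of block matrices. -/
theorem exists_eq_blocks {B : Fin 3 → Matrix (Fin (n + 2)) (Fin n) ℂ} (hB : IsInvariantTriple n B)
    (hn : 2 ≤ n) {T : Fin 3 → Matrix (Fin (n + 2) ⊕ Fin n) (Fin (n + 2) ⊕ Fin n) ℂ}
    (hT : IsVec (totalSpin n) (totalSpin n) T) (hskew : ∀ i, (T i)ᴴ = - T i) :
    ∃ (p : ℝ) (q : ℂ) (r : ℝ), ∀ i, T i = blocks B p q (star q) r i := by
  have e : T = fun i => Matrix.fromBlocks (T i).toBlocks₁₁ (T i).toBlocks₁₂ (T i).toBlocks₂₁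
      (T i).toBlocks₂₂ := funext fun i => (Matrix.fromBlocks_toBlocks (T i)).symm
  have h11 : IsVec (spinMatrix (n + 2)) (spinMatrix (n + 2)) fun i => (T i).toBlocks₁₁ := by
    intro j k
    have h := congrArg Matrix.toBlocks₁₁ (hT j k)
    rw [e] at h
    simpa [totalSpin, Matrix.fromBlocks_multiply, fromBlocks_sub, Fin.sum_univ_three,
      Matrix.fromBlocks_smul, Matrix.fromBlocks_add] using h
  have h12 : IsVec (spinMatrix (n + 2)) (spinMatrix n) fun i => (T i).toBlocks₁₂ := by
    intro j k
    have h := congrArg Matrix.toBlocks₁₂ (hT j k)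
    rw [e] at h
    simpa [totalSpin, Matrix.fromBlocks_multiply, fromBlocks_sub, Fin.sum_univ_three,
      Matrix.fromBlocks_smul, Matrix.fromBlocks_add] using h
  have h22 : IsVec (spinMatrix n) (spinMatrix n) fun i => (T i).toBlocks₂₂ := by
    intro j k
    have h := congrArg Matrix.toBlocks₂₂ (hT j k)
    rw [e] at h
    simpa [totalSpin, Matrix.fromBlocks_multiply, fromBlocks_sub, Fin.sum_univ_three,
      Matrix.fromBlocks_smul, Matrix.fromBlocks_add] using h
  obtain ⟨p, hp⟩ := h11.eq_smul_spinMatrix (by omega)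
  obtain ⟨q, hq⟩ := h12.eq_smul hB.isVec (e := 0) rfl (by omega) (by omega) hB.exists_ne_zero
  obtain ⟨r, hr⟩ := h22.eq_smul_spinMatrix hn
  have hadj : ∀ i, ((T i).toBlocks₁₁)ᴴ = -(T i).toBlocks₁₁ ∧
      ((T i).toBlocks₁₂)ᴴ = -(T i).toBlocks₂₁ ∧ ((T i).toBlocks₂₂)ᴴ = -(T i).toBlocks₂₂ := by
    intro i
    have h := hskew i
    rw [← Matrix.fromBlocks_toBlocks (T i), Matrix.fromBlocks_conjTranspose,
      Matrix.fromBlocks_neg, Matrix.fromBlocks_inj] at h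
    exact ⟨h.1, h.2.2.1, h.2.2.2⟩
  -- the coefficients of the diagonal blocks are real, since the generators are skew-Hermitian
  have hreal : ∀ {k : ℕ} (hk : 2 ≤ k) (c : ℂ),
      (∀ i, (c • spinMatrix k i)ᴴ = -(c • spinMatrix k i)) → ((c.re : ℝ) : ℂ) = c := by
    intro k hk c hc
    obtain ⟨i, hi⟩ := spinMatrix_ne_zero hk
    have h := hc i
    rw [Matrix.conjTranspose_smul, conjTranspose_spinMatrix, smul_neg, neg_inj, ← sub_eq_zero,
      ← _root_.sub_smul] at h
    exact Complex.conj_eq_iff_re.1 (sub_eq_zero.1 ((smul_eq_zero.1 h).resolve_right hi))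
  have hp' := hreal (k := n + 2) (by omega) p fun i => by rw [← hp]; exact (hadj i).1
  have hr' := hreal hn r fun i => by rw [← hr]; exact (hadj i).2.2
  refine ⟨p.re, q, r.re, fun i => ?_⟩
  rw [hp', hr', blocks, ← hp, ← hr, ← hq, ← Matrix.conjTranspose_smul, ← hq, (hadj i).2.1,
    neg_neg, Matrix.fromBlocks_toBlocks]

end

/-! ### Real analyticity of solutions of quadratic differential equations -/

section
variable {ι : Type*} [Fintype ι]

/-- The homogeneous quadratic vector field on `ι → ℝ` with coefficients `c`. -/
def quadField (c : ι → ι → ι → ℝ) (x : ι → ℝ) (i : ι) : ℝ := ∑ j, ∑ l, c i j l * (x j * x l)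

/-- The Taylor coefficients of the solution of `x' = quadField c x`, `x 0 = x₀`. -/
def quadCoeff (c : ι → ι → ι → ℝ) (x₀ : ι → ℝ) : ℕ → ι → ℝ
  | 0 => x₀
  | k + 1 => fun i => ((k : ℝ) + 1)⁻¹ * ∑ j, ∑ l, c i j l *
      ∑ p : Fin (k + 1), quadCoeff c x₀ p j * quadCoeff c x₀ (k - p) l
decreasing_by all_goals omega

theorem quadCoeff_zero (c : ι → ι → ι → ℝ) (x₀ : ι → ℝ) : quadCoeff c x₀ 0 = x₀ := by
  rw [quadCoeff]

theorem quadCoeff_succ (c : ι → ι → ι → ℝ) (x₀ : ι → ℝ) (k : ℕ) (i : ι) :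
    ((k : ℝ) + 1) * quadCoeff c x₀ (k + 1) i = ∑ j, ∑ l, c i j l *
      ∑ p ∈ Finset.HasAntidiagonal.antidiagonal k, quadCoeff c x₀ p.1 j * quadCoeff c x₀ p.2 l := by
  rw [quadCoeff, mul_inv_cancel_left₀ (by positivity)]
  refine Finset.sum_congr rfl fun j _ => Finset.sum_congr rfl fun l _ => ?_
  rw [Finset.Nat.sum_antidiagonal_eq_sum_range_succ
    (fun p q => quadCoeff c x₀ p j * quadCoeff c x₀ q l), Finset.sum_range]

/-- The Taylor coefficients grow at most geometrically. -/
theorem abs_quadCoeff_le (c : ι → ι → ι → ℝ) {x₀ : ι → ℝ} {M r : ℝ} (hM : 0 ≤ M)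
    (hx : ∀ i, |x₀ i| ≤ M) (hr : (∑ i, ∑ j, ∑ l, |c i j l|) * M ≤ r) (k : ℕ) :
    ∀ i, |quadCoeff c x₀ k i| ≤ M * r ^ k := by
  have hr0 : 0 ≤ r := le_trans (by positivity) hr
  induction k using Nat.strong_induction_on with
  | _ k ih =>
    intro i
    rcases k with _ | k
    · simpa [quadCoeff_zero] using hx i
    have h1 : ((k : ℝ) + 1) * |quadCoeff c x₀ (k + 1) i| ≤
        ((k : ℝ) + 1) * (M * r ^ (k + 1)) := by
      calc ((k : ℝ) + 1) * |quadCoeff c x₀ (k + 1) i|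
          = |((k : ℝ) + 1) * quadCoeff c x₀ (k + 1) i| := by
            rw [abs_mul, abs_of_nonneg (by positivity : (0 : ℝ) ≤ (k : ℝ) + 1)]
        _ ≤ ∑ j, ∑ l, |c i j l| * (((k : ℝ) + 1) * (M ^ 2 * r ^ k)) := by
            rw [quadCoeff_succ]
            refine (Finset.abs_sum_le_sum_abs _ _).trans (Finset.sum_le_sum fun j _ => ?_)
            refine (Finset.abs_sum_le_sum_abs _ _).trans (Finset.sum_le_sum fun l _ => ?_)
            rw [abs_mul]
            refine mul_le_mul_of_nonneg_left ?_ (abs_nonneg _)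
            refine (Finset.abs_sum_le_sum_abs _ _).trans ?_
            have h2 : ∀ p ∈ Finset.HasAntidiagonal.antidiagonal k,
                |quadCoeff c x₀ p.1 j * quadCoeff c x₀ p.2 l| ≤ M ^ 2 * r ^ k := by
              intro p hp
              have hpk : p.1 + p.2 = k := Finset.HasAntidiagonal.mem_antidiagonal.1 hp
              rw [abs_mul]
              calc _ ≤ (M * r ^ p.1) * (M * r ^ p.2) :=
                    mul_le_mul (ih p.1 (by omega) j) (ih p.2 (by omega) l) (abs_nonneg _)
                      (by positivity)
                _ = M ^ 2 * r ^ k := by rw [← hpk, pow_add]; ring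
            refine (Finset.sum_le_card_nsmul _ _ _ h2).trans ?_
            rw [Finset.Nat.card_antidiagonal, nsmul_eq_mul]
            push_cast
            exact le_rfl
        _ = (∑ j, ∑ l, |c i j l|) * (((k : ℝ) + 1) * (M ^ 2 * r ^ k)) := by
            simp only [Finset.sum_mul]
        _ ≤ (∑ i, ∑ j, ∑ l, |c i j l|) * (((k : ℝ) + 1) * (M ^ 2 * r ^ k)) := by
            refine mul_le_mul_of_nonneg_right ?_ (by positivity)
            exact Finset.single_le_sum (f := fun i => ∑ j, ∑ l, |c i j l|)
              (fun i _ => by positivity) (Finset.mem_univ i)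
        _ = ((∑ i, ∑ j, ∑ l, |c i j l|) * M) * (((k : ℝ) + 1) * (M * r ^ k)) := by ring
        _ ≤ r * (((k : ℝ) + 1) * (M * r ^ k)) :=
            mul_le_mul_of_nonneg_right hr (by positivity)
        _ = ((k : ℝ) + 1) * (M * r ^ (k + 1)) := by ring
    exact le_of_mul_le_mul_left h1 (by positivity)

/-- A power series with geometrically bounded coefficients defines an analytic function. -/
theorem analyticAt_tsum_of_le {a : ℕ → ℝ} {M r : ℝ} (hr : 0 < r)
    (ha : ∀ k, |a k| ≤ M * r ^ k) : AnalyticAt ℝ (fun t => ∑' k, a k * t ^ k) 0 := by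
  have h1 : ((r⁻¹.toNNReal : NNReal) : ENNReal) ≤
      (FormalMultilinearSeries.ofScalars ℝ a).radius := by
    refine FormalMultilinearSeries.le_radius_of_bound _ M fun k => ?_
    rw [FormalMultilinearSeries.ofScalars_norm, Real.coe_toNNReal _ (by positivity),
      Real.norm_eq_abs, inv_pow, ← div_eq_mul_inv, div_le_iff₀ (by positivity)]
    exact ha k
  have h2 : 0 < (FormalMultilinearSeries.ofScalars ℝ a).radius :=
    lt_of_lt_of_le (by simpa using hr) h1
  have h3 := (FormalMultilinearSeries.hasFPowerSeriesOnBall _ h2).analyticAt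
  refine h3.congr (Eventually.of_forall fun t => ?_)
  have h4 := FormalMultilinearSeries.ofScalars_sum_eq (E := ℝ) a t
  simp only [smul_eq_mul] at h4
  exact h4

theorem summable_of_le {a : ℕ → ℝ} {M r t : ℝ} (ha : ∀ k, |a k| ≤ M * r ^ k) (hr : 0 < r)
    (ht : |t| < r⁻¹) : Summable fun k => ‖a k * t ^ k‖ := by
  have h1 : r * |t| < 1 := by rwa [← lt_inv_mul_iff₀ hr, mul_one]
  refine Summable.of_nonneg_of_le (fun _ => norm_nonneg _) (fun k => ?_)
    ((summable_geometric_of_lt_one (by positivity) h1).mul_left M)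
  rw [norm_mul, norm_pow, Real.norm_eq_abs, Real.norm_eq_abs, mul_pow, ← mul_assoc]
  exact mul_le_mul_of_nonneg_right (ha k) (by positivity)

/-- A power series with geometrically bounded coefficients can be differentiated term by term. The
halved radius leaves room for the factor `k` in the derivative. -/
theorem hasDerivAt_tsum_of_le {a : ℕ → ℝ} {M r : ℝ} (hr : 0 < r)
    (ha : ∀ k, |a k| ≤ M * r ^ k) {t : ℝ} (ht : |t| < (2 * r)⁻¹) :
    HasDerivAt (fun t => ∑' k, a k * t ^ k) (∑' k : ℕ, ((k : ℝ) + 1) * a (k + 1) * t ^ k) t := by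
  have hM : 0 ≤ M := by simpa using (abs_nonneg _).trans (ha 0)
  have hu : Summable fun k : ℕ => M * r * ((k : ℝ) * (2⁻¹ : ℝ) ^ (k - 1)) := by
    refine Summable.mul_left _ ?_
    rw [← summable_nat_add_iff 1]
    have h1 := summable_pow_mul_geometric_of_norm_lt_one 1 (r := (2⁻¹ : ℝ)) (by norm_num)
    have h2 := summable_geometric_of_lt_one (r := (2⁻¹ : ℝ)) (by norm_num) (by norm_num)
    refine (h1.add h2).congr fun k => ?_
    rw [Nat.add_sub_cancel]
    push_cast
    ring
  have hb : ∀ (k : ℕ) (s : ℝ), |s| < (2 * r)⁻¹ →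
      ‖a k * ((k : ℝ) * s ^ (k - 1))‖ ≤ M * r * ((k : ℝ) * (2⁻¹ : ℝ) ^ (k - 1)) := by
    intro k s hs
    rcases k with _ | k
    · simp
    have h1 : |s| ^ k ≤ (2 * r)⁻¹ ^ k := pow_le_pow_left₀ (abs_nonneg _) hs.le k
    rw [Nat.add_sub_cancel, norm_mul, norm_mul, norm_pow, Real.norm_eq_abs, Real.norm_eq_abs,
      Real.norm_eq_abs, Nat.abs_cast]
    calc |a (k + 1)| * (((k + 1 : ℕ) : ℝ) * |s| ^ k)
        ≤ (M * r ^ (k + 1)) * (((k + 1 : ℕ) : ℝ) * (2 * r)⁻¹ ^ k) :=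
          mul_le_mul (ha _) (mul_le_mul_of_nonneg_left h1 (by positivity)) (by positivity)
            (by positivity)
      _ = M * r * (((k + 1 : ℕ) : ℝ) * 2⁻¹ ^ k) * (r ^ k * r⁻¹ ^ k) := by
          rw [mul_inv, mul_pow]; ring
      _ = M * r * (((k + 1 : ℕ) : ℝ) * 2⁻¹ ^ k) := by
          rw [← mul_pow, mul_inv_cancel₀ hr.ne', one_pow, mul_one]
  have h := hasDerivAt_tsum_of_isPreconnected (t := Metric.ball (0 : ℝ) (2 * r)⁻¹)
    (g := fun k t => a k * t ^ k) (g' := fun k t => a k * ((k : ℝ) * t ^ (k - 1)))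
    (y₀ := 0) (y := t) hu Metric.isOpen_ball (convex_ball _ _).isPreconnected
    (fun k s _ => (hasDerivAt_pow k s).const_mul (a k))
    (fun k s hs => hb k s (by simpa using hs)) (by simpa using hr) ?_
    (by simpa using ht)
  · refine h.congr_deriv ?_
    have hs : Summable fun k : ℕ => a k * ((k : ℝ) * t ^ (k - 1)) := by
      exact Summable.of_norm_bounded hu fun k => hb k t ht
    rw [hs.tsum_eq_zero_add]
    simp only [Nat.cast_zero, zero_mul, mul_zero, zero_add, Nat.add_sub_cancel, Nat.cast_add,
      Nat.cast_one]
    exact tsum_congr fun k => by ring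
  · refine summable_of_ne_finset_zero (s := {0}) fun k hk => ?_
    simp [Finset.mem_singleton.not.1 hk]

/-- The power series with the recursively defined coefficients solves the equation. -/
theorem hasDerivAt_quadSolution (c : ι → ι → ι → ℝ) {x₀ : ι → ℝ} {M r : ℝ} (hr : 0 < r)
    (ha : ∀ k i, |quadCoeff c x₀ k i| ≤ M * r ^ k) {t : ℝ} (ht : |t| < (2 * r)⁻¹) (i : ι) :
    HasDerivAt (fun t => ∑' k, quadCoeff c x₀ k i * t ^ k)
      (quadField c (fun i => ∑' k, quadCoeff c x₀ k i * t ^ k) i) t := by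
  refine (hasDerivAt_tsum_of_le hr (fun k => ha k i) ht).congr_deriv ?_
  have ht' : |t| < r⁻¹ := ht.trans_le (by
    rw [mul_inv]
    have := inv_pos.2 hr
    linarith)
  have hs : ∀ j, Summable fun k => ‖quadCoeff c x₀ k j * t ^ k‖ := fun j =>
    summable_of_le (fun k => ha k j) hr ht'
  have hprod : ∀ j l, (∑' k, quadCoeff c x₀ k j * t ^ k) * (∑' k, quadCoeff c x₀ k l * t ^ k) =
      ∑' k, ∑ p ∈ Finset.HasAntidiagonal.antidiagonal k,
        (quadCoeff c x₀ p.1 j * t ^ p.1) * (quadCoeff c x₀ p.2 l * t ^ p.2) := fun j l =>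
    tsum_mul_tsum_eq_tsum_sum_antidiagonal_of_summable_norm (hs j) (hs l)
  have hsum : ∀ j l, Summable fun k => ∑ p ∈ Finset.HasAntidiagonal.antidiagonal k,
        (quadCoeff c x₀ p.1 j * t ^ p.1) * (quadCoeff c x₀ p.2 l * t ^ p.2) := fun j l =>
    (summable_norm_sum_mul_antidiagonal_of_summable_norm (hs j) (hs l)).of_norm
  simp only [quadField, hprod, ← tsum_mul_left]
  have h1 : ∀ j, Summable fun k => ∑ l, c i j l * ∑ p ∈ Finset.HasAntidiagonal.antidiagonal k,
        (quadCoeff c x₀ p.1 j * t ^ p.1) * (quadCoeff c x₀ p.2 l * t ^ p.2) := fun j =>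
    summable_sum fun l _ => (hsum j l).mul_left _
  calc _ = ∑' k, ∑ j, ∑ l, c i j l * ∑ p ∈ Finset.HasAntidiagonal.antidiagonal k,
        (quadCoeff c x₀ p.1 j * t ^ p.1) * (quadCoeff c x₀ p.2 l * t ^ p.2) := by
        refine tsum_congr fun k => ?_
        rw [quadCoeff_succ, Finset.sum_mul]
        refine Finset.sum_congr rfl fun j _ => ?_
        rw [Finset.sum_mul]
        refine Finset.sum_congr rfl fun l _ => ?_
        rw [mul_assoc, Finset.sum_mul]
        congr 1
        refine Finset.sum_congr rfl fun p hp => ?_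
        rw [← Finset.HasAntidiagonal.mem_antidiagonal.1 hp, pow_add]
        ring
    _ = _ := by
        rw [Summable.tsum_finsetSum fun j _ => h1 j]
        refine Finset.sum_congr rfl fun j _ => ?_
        rw [Summable.tsum_finsetSum fun l _ => (hsum j l).mul_left _]

theorem contDiff_quadField (c : ι → ι → ι → ℝ) : ContDiff ℝ 1 (quadField c) := by
  refine contDiff_pi.2 fun i => ?_
  unfold quadField
  fun_prop

/-- Solutions of homogeneous quadratic differential equations are real analytic: the power series
solution through a given point agrees with the given one by local uniqueness. -/
theorem analyticAt_of_quadField (c : ι → ι → ι → ℝ) {x : ℝ → ι → ℝ} {t₀ : ℝ}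
    (hx : ∀ᶠ t in 𝓝 t₀, ∀ i, HasDerivAt (fun s => x s i) (quadField c (x t) i) t) (i : ι) :
    AnalyticAt ℝ (fun t => x t i) t₀ := by
  set M := ∑ j, |x t₀ j| with hM
  have hM0 : 0 ≤ M := by positivity
  set r := (∑ i, ∑ j, ∑ l, |c i j l|) * M + 1 with hr
  have hr0 : 0 < r := by positivity
  have ha := fun k => abs_quadCoeff_le c (x₀ := x t₀) hM0
    (fun i => Finset.single_le_sum (f := fun j => |x t₀ j|) (fun j _ => abs_nonneg _)
      (Finset.mem_univ i)) (by linarith : _ ≤ r) k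
  set y : ℝ → ι → ℝ := fun t i => ∑' k, quadCoeff c (x t₀) k i * t ^ k with hy
  have hyan : ∀ i, AnalyticAt ℝ (fun t => y t i) 0 := fun i =>
    analyticAt_tsum_of_le hr0 fun k => ha k i
  have hz : ∀ᶠ t in 𝓝 t₀, HasDerivAt (fun s => y (s - t₀)) (quadField c (y (t - t₀))) t := by
    have : ∀ᶠ t in 𝓝 t₀, |t - t₀| < (2 * r)⁻¹ := by
      filter_upwards [Metric.ball_mem_nhds t₀ (by positivity : 0 < (2 * r)⁻¹)] with t ht
      exact ht
    filter_upwards [this] with t ht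
    refine hasDerivAt_pi.2 fun i => ?_
    exact (hasDerivAt_quadSolution c hr0 ha ht i).comp_sub_const t t₀
  have hx' : ∀ᶠ t in 𝓝 t₀, HasDerivAt x (quadField c (x t)) t := by
    filter_upwards [hx] with t ht using hasDerivAt_pi.2 ht
  have h0 : y (t₀ - t₀) = x t₀ := by
    funext i
    rw [hy, sub_self]
    simp only
    rw [tsum_eq_single 0 (fun k hk => by simp [hk])]
    simp [quadCoeff_zero]
  obtain ⟨K, s, hs, hK⟩ := ((contDiff_quadField c).contDiffAt (x := x t₀)).exists_lipschitzOnWith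
  have heq : x =ᶠ[𝓝 t₀] fun t => y (t - t₀) := by
    refine ODE_solution_unique_of_eventually (v := fun _ => quadField c) (s := fun _ => s) (K := K)
      (Eventually.of_forall fun _ => hK) ?_ ?_ h0.symm
    · exact hx'.and (hx'.self_of_nhds.continuousAt.eventually hs)
    · refine hz.and ?_
      have := hz.self_of_nhds.continuousAt
      rw [ContinuousAt, h0] at this
      exact this.eventually hs
  have hcomp : AnalyticAt ℝ (fun t => y (t - t₀) i) t₀ := by
    have h1 : AnalyticAt ℝ (fun t => y t i) ((fun t => t - t₀) t₀) := by
      simpa using hyan i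
    exact h1.comp (f := fun t : ℝ => t - t₀) (by fun_prop)
  refine hcomp.congr ?_
  filter_upwards [heq] with t ht
  rw [ht]

end

/-! ### The reduced equations and their solutions -/

/-- A solution of a homogeneous linear equation on an interval that vanishes at one point
vanishes. -/
theorem eq_zero_of_linear_ode {I : Set ℝ} (hI : IsOpen I) (hI' : IsPreconnected I) {h k : ℝ → ℝ}
    (hk : ContinuousOn k I) (hh : ∀ t ∈ I, HasDerivAt h (k t * h t) t) {t₀ : ℝ} (ht₀ : t₀ ∈ I)
    (h0 : h t₀ = 0) {t : ℝ} (ht : t ∈ I) : h t = 0 := by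
  have hK : ∀ s ∈ I, HasDerivAt (fun u => ∫ x in t₀..u, k x) (k s) s := fun s hs =>
    intervalIntegral.integral_hasDerivAt_right
      ((hk.mono (hI'.ordConnected.uIcc_subset ht₀ hs)).intervalIntegrable)
      (hk.stronglyMeasurableAtFilter hI s hs) (hk.continuousAt (hI.mem_nhds hs))
  -- the integrating factor `exp (-∫ k)` turns `h` into a constant
  have hF : ∀ s ∈ I, HasDerivAt (fun u => h u * Real.exp (-∫ x in t₀..u, k x)) 0 s := by
    intro s hs
    refine ((hh s hs).mul (hK s hs).neg.exp).congr_deriv ?_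
    ring
  have hc := hI.is_const_of_deriv_eq_zero hI'
    (fun s hs => (hF s hs).differentiableAt.differentiableWithinAt)
    (fun s hs => (hF s hs).deriv) ht ht₀
  simp only [h0, zero_mul] at hc
  exact (mul_eq_zero.1 hc).resolve_right (Real.exp_ne_zero _)

/-- Solutions of the reduced system are real analytic. -/
theorem SolvesReduced.analyticOnNhd {n : ℕ} {fp g fm : ℝ → ℝ} {I : Set ℝ}
    (h : SolvesReduced n fp g fm I) (hI : IsOpen I) :
    AnalyticOnNhd ℝ fp I ∧ AnalyticOnNhd ℝ g I ∧ AnalyticOnNhd ℝ fm I := by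
  -- the coefficients of the reduced system as a homogeneous quadratic vector field
  set c : Fin 3 → Fin 3 → Fin 3 → ℝ :=
    ![![![1, 0, 0], ![0, 2 / ((n : ℝ) + 1), 0], 0],
      ![![0, ((n : ℝ) + 3) / 2, 0], 0, ![0, -(((n : ℝ) - 1) / 2), 0]],
      ![0, ![0, -(2 * ((n : ℝ) + 2) / ((n : ℝ) * ((n : ℝ) + 1))), 0], ![0, 0, 1]]] with hc
  have key : ∀ t₀ ∈ I, ∀ i, AnalyticAt ℝ (fun t => (![fp t, g t, fm t] : Fin 3 → ℝ) i) t₀ := by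
    intro t₀ ht₀
    refine analyticAt_of_quadField c ?_
    filter_upwards [hI.mem_nhds ht₀] with t ht i
    obtain ⟨h1, h2, h3⟩ := h t ht
    fin_cases i
    · refine h1.congr_deriv ?_
      simp [quadField, hc, Fin.sum_univ_three]
      ring
    · refine h2.congr_deriv ?_
      simp [quadField, hc, Fin.sum_univ_three]
      ring
    · refine h3.congr_deriv ?_
      simp [quadField, hc, Fin.sum_univ_three]
      ring
  exact ⟨fun t ht => key t ht 0, fun t ht => key t ht 1, fun t ht => key t ht 2⟩

theorem hasDerivAt_conj_apply {ι : Type*} [Fintype ι] {T : ℝ → Matrix ι ι ℂ} {T' : Matrix ι ι ℂ}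
    {t : ℝ} (hT : ∀ a b, HasDerivAt (fun s => T s a b) (T' a b) t) (U W : Matrix ι ι ℂ)
    (a b : ι) : HasDerivAt (fun s => (U * T s * W) a b) ((U * T' * W) a b) t := by
  simp only [Matrix.mul_apply]
  exact HasDerivAt.fun_sum fun d _ => (HasDerivAt.fun_sum fun e _ =>
    (hT e d).const_mul (U a e)).mul_const (W d b)

theorem conj_mul_conj {ι : Type*} [Fintype ι] [DecidableEq ι] {U W : Matrix ι ι ℂ}
    (h : W * U = 1) (M N : Matrix ι ι ℂ) : U * M * W * (U * N * W) = U * (M * N) * W := by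
  rw [Matrix.mul_assoc (U * M), ← Matrix.mul_assoc W, ← Matrix.mul_assoc W, h, Matrix.one_mul]
  simp only [Matrix.mul_assoc]

theorem cross_conj {ι : Type*} [Fintype ι] [DecidableEq ι] {U W : Matrix ι ι ℂ} (h : W * U = 1)
    (T : Fin 3 → Matrix ι ι ℂ) (i : Fin 3) :
    cross (fun j => U * T j * W) (fun j => U * T j * W) i = U * cross T T i * W := by
  fin_cases i <;>
  simp only [Fin.zero_eta, Fin.mk_one, Fin.reduceFinMk, cross_zero, cross_one, cross_two,
    conj_mul_conj h, Matrix.mul_sub, Matrix.sub_mul]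

theorem IsVec.conj {ι : Type*} [Fintype ι] [DecidableEq ι] {U W : Matrix ι ι ℂ} (h : W * U = 1)
    {Y C : Fin 3 → Matrix ι ι ℂ} (hC : IsVec Y Y C) :
    IsVec (fun i => U * Y i * W) (fun i => U * Y i * W) (fun i => U * C i * W) := by
  intro j k
  rw [conj_mul_conj h, conj_mul_conj h, ← Matrix.sub_mul, ← Matrix.mul_sub, hC j k]
  simp only [Matrix.mul_sum, Matrix.sum_mul, Matrix.mul_smul, Matrix.smul_mul]

theorem GeneratesSymmetry.isVec {ι : Type*} [Fintype ι] [DecidableEq ι] {ρ : Rep ι}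
    {T : ℝ → Fin 3 → Matrix ι ι ℂ} {I : Set ℝ} (h : GeneratesSymmetry ρ T I) {t : ℝ}
    (ht : t ∈ I) : IsVec (fun i => ρ (X i)) (fun i => ρ (X i)) (T t) := by
  intro i j
  have h2 : ∀ m, eps m i j = eps i j m := fun m => by simp only [eps]; ring
  simp only [h2]
  exact h.2 t ht i j

section
variable {n : ℕ} {B : Fin 3 → Matrix (Fin (n + 2)) (Fin n) ℂ}

/-- The coefficients of a differentiable triple of block matrices are differentiable. -/
theorem hasDerivAt_coeff_of_blocks (hB : IsInvariantTriple n B) (hn : 2 ≤ n)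
    {p q q' r : ℝ → ℂ} {p₁ q₁ q₁' r₁ : ℂ} {t : ℝ}
    (h : ∀ i a b, HasDerivAt (fun s => blocks B (p s) (q s) (q' s) (r s) i a b)
      (blocks B p₁ q₁ q₁' r₁ i a b) t) :
    HasDerivAt p p₁ t ∧ HasDerivAt q q₁ t ∧ HasDerivAt r r₁ t := by
  have key : ∀ {f : ℝ → ℂ} {f₁ c : ℂ}, c ≠ 0 → HasDerivAt (fun s => f s * c) (f₁ * c) t →
      HasDerivAt f f₁ t := by
    intro f f₁ c hc hf
    have h1 := hf.mul_const c⁻¹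
    simpa only [mul_inv_cancel_right₀ hc] using h1
  have hentry : ∀ {ι κ : Type} {M : Matrix ι κ ℂ}, M ≠ 0 → ∃ a b, M a b ≠ 0 := by
    intro ι κ M hM
    by_contra! h0
    exact hM (Matrix.ext h0)
  obtain ⟨i, hi⟩ := spinMatrix_ne_zero (by omega : 2 ≤ n + 2)
  obtain ⟨j, hj⟩ := hB.exists_ne_zero
  obtain ⟨k, hk⟩ := spinMatrix_ne_zero hn
  obtain ⟨a, b, hab⟩ := hentry hi
  obtain ⟨a', b', hab'⟩ := hentry hj
  obtain ⟨a'', b'', hab''⟩ := hentry hk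
  exact ⟨key hab (h i (Sum.inl a) (Sum.inl b)), key hab' (h j (Sum.inl a') (Sum.inr b')),
    key hab'' (h k (Sum.inr a'') (Sum.inr b''))⟩

theorem hasDerivAt_of_ofReal {f : ℝ → ℝ} {f' t : ℝ}
    (h : HasDerivAt (fun s => ((f s : ℝ) : ℂ)) ((f' : ℝ) : ℂ) t) : HasDerivAt f f' t := by
  exact Complex.reCLM.hasFDerivAt.comp_hasDerivAt t h

/-- Some phase factor makes a given complex number real. -/
theorem exists_phase (z : ℂ) : ∃ w : ℂ, w * star w = 1 ∧ (w * z).im = 0 := by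
  by_cases hz : z = 0
  · exact ⟨1, by simp, by simp [hz]⟩
  · have h0 : ((‖z‖ : ℝ) : ℂ) ≠ 0 := by exact_mod_cast norm_ne_zero_iff.2 hz
    have hzz : z * star z = ((‖z‖ : ℝ) : ℂ) ^ 2 := by
      rw [RCLike.star_def, Complex.mul_conj, Complex.normSq_eq_norm_sq]
      push_cast
      rfl
    refine ⟨star z / ((‖z‖ : ℝ) : ℂ), ?_, ?_⟩
    · rw [star_div₀, star_star, RCLike.star_def, Complex.conj_ofReal, ← RCLike.star_def,
        div_mul_div_comm, mul_comm, hzz, sq]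
      exact div_self (mul_ne_zero h0 h0)
    · rw [div_mul_eq_mul_div, mul_comm, hzz, sq, mul_div_assoc, div_self h0, mul_one]
      exact Complex.ofReal_im _

/-- Given the relative phase of the two summands, their common phase can be chosen so that the
determinant becomes one. -/
theorem exists_phases {d w : ℂ} (hd : d * star d = 1) (hw : w * star w = 1) :
    ∃ u v : ℂ, u * star u = 1 ∧ v * star v = 1 ∧ u * star v = w ∧
      u ^ (n + 2) * v ^ n * d = 1 := by
  have hd0 : d ≠ 0 := left_ne_zero_of_mul_eq_one hd
  have hw0 : w ≠ 0 := left_ne_zero_of_mul_eq_one hw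
  have norm_one : ∀ z : ℂ, z * star z = 1 ↔ ‖z‖ = 1 := by
    intro z
    rw [RCLike.star_def, Complex.mul_conj, Complex.normSq_eq_norm_sq]
    norm_cast
    exact pow_eq_one_iff_of_nonneg (norm_nonneg z) two_ne_zero
  obtain ⟨v, hv⟩ := IsAlgClosed.exists_pow_nat_eq (w ^ (n + 2) * d)⁻¹ (by omega : 0 < 2 * n + 2)
  have hv1 : ‖v‖ = 1 := by
    have h1 := congrArg norm hv
    rw [norm_pow, norm_inv, norm_mul, norm_pow, (norm_one w).1 hw, (norm_one d).1 hd, one_pow,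
      one_mul, inv_one] at h1
    exact (pow_eq_one_iff_of_nonneg (norm_nonneg _) (by omega)).1 h1
  refine ⟨w * v, v, ?_, (norm_one v).2 hv1, ?_, ?_⟩
  · rw [norm_one, norm_mul, hv1, (norm_one w).1 hw, one_mul]
  · rw [mul_assoc, (norm_one v).2 hv1, mul_one]
  · calc (w * v) ^ (n + 2) * v ^ n * d = v ^ (2 * n + 2) * (w ^ (n + 2) * d) := by ring
      _ = 1 := by rw [hv, inv_mul_cancel₀ (mul_ne_zero (pow_ne_zero _ hw0) hd0)]

/-- In a suitable unitary basis a spherically symmetric triple has block form, and Nahm's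
equations become equations for the coefficients. -/
theorem exists_coeff (hB : IsInvariantTriple n B) (hn : 2 ≤ n) {I : Set ℝ}
    {T : ℝ → Fin 3 → Matrix (Fin (n + 2) ⊕ Fin n) (Fin (n + 2) ⊕ Fin n) ℂ} (hI : IsOpen I)
    (hT : IsNahmSolution T I) {U : Matrix (Fin (n + 2) ⊕ Fin n) (Fin (n + 2) ⊕ Fin n) ℂ}
    (hU' : Uᴴ * U = 1)
    (hvec : ∀ t ∈ I, IsVec (totalSpin n) (totalSpin n) fun i => U * T t i * Uᴴ) :
    ∃ (p : ℝ → ℝ) (q : ℝ → ℂ) (r : ℝ → ℝ),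
      (∀ t ∈ I, ∀ i, U * T t i * Uᴴ = blocks B (p t) (q t) (star (q t)) (r t) i) ∧
      ∀ t ∈ I, HasDerivAt (fun s => ((p s : ℝ) : ℂ))
          ((p t : ℂ) ^ 2 + 2 / ((n : ℂ) + 1) * (q t * star (q t))) t ∧
        HasDerivAt q ((((n : ℂ) + 3) / 2 * p t - ((n : ℂ) - 1) / 2 * r t) * q t) t ∧
        HasDerivAt (fun s => ((r s : ℝ) : ℂ)) ((r t : ℂ) ^ 2 -
          2 * ((n : ℂ) + 2) / ((n : ℂ) * ((n : ℂ) + 1)) * (q t * star (q t))) t := by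
  have hform : ∀ t, ∃ (p : ℝ) (q : ℂ) (r : ℝ), t ∈ I → ∀ i,
      U * T t i * Uᴴ = blocks B p q (star q) r i := by
    intro t
    by_cases ht : t ∈ I
    · obtain ⟨p, q, r, h⟩ := exists_eq_blocks hB hn (hvec t ht) fun i => by
        rw [Matrix.conjTranspose_mul, Matrix.conjTranspose_mul, Matrix.conjTranspose_conjTranspose,
          (hT.1 t ht i).1, Matrix.neg_mul, Matrix.mul_neg, Matrix.mul_assoc]
      exact ⟨p, q, r, fun _ => h⟩
    · exact ⟨0, 0, 0, fun h => absurd h ht⟩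
  choose p q r hpqr using hform
  refine ⟨p, q, r, hpqr, fun t ht => ?_⟩
  refine hasDerivAt_coeff_of_blocks (q' := fun s => star (q s))
    (q₁' := (((n : ℂ) + 3) / 2 * p t - ((n : ℂ) - 1) / 2 * r t) * star (q t)) hB hn
    fun i a b => ?_
  rw [← cross_blocks hB hn]
  have h1 := hasDerivAt_conj_apply (fun a b => hT.2 t ht i a b) U Uᴴ a b
  rw [half_sum_lie_eq_cross, ← cross_conj hU', funext (hpqr t ht)] at h1
  refine h1.congr_of_eventuallyEq ?_
  filter_upwards [hI.mem_nhds ht] with s hs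
  rw [hpqr s hs i]

/-- The normal form of the spherically symmetric solutions and the reduced equations. -/
theorem exists_gauge_ansatz (hB : IsInvariantTriple n B) (hn : 2 ≤ n) {I : Set ℝ}
    {T : ℝ → Fin 3 → Matrix (Fin (n + 2) ⊕ Fin n) (Fin (n + 2) ⊕ Fin n) ℂ}
    {ρ : Rep (Fin (n + 2) ⊕ Fin n)} (hI : IsOpen I) (hI' : IsConnected I)
    (hT : IsNahmSolution T I) (hρ : GeneratesSymmetry ρ T I)
    (hiso : ρ.Iso ((V (n + 2)).sum (V n))) :
    ∃ U ∈ Matrix.specialUnitaryGroup (Fin (n + 2) ⊕ Fin n) ℂ, ∃ fp g fm : ℝ → ℝ,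
      AnalyticOnNhd ℝ fp I ∧ AnalyticOnNhd ℝ g I ∧ AnalyticOnNhd ℝ fm I ∧
      (∀ A, U * ρ A * Uᴴ = (V (n + 2)).sum (V n) A) ∧
      (∀ t ∈ I, ∀ i, U * T t i * Uᴴ = ansatz n B fp g fm t i) ∧
      SolvesReduced n fp g fm I := by
  obtain ⟨U, hU, hUρ⟩ := exists_unitary_intertwiner hn hρ.1 hiso
  have hU' : Uᴴ * U = 1 := mul_eq_one_comm.1 hU
  have hUρ' : ∀ i, U * ρ (X i) * Uᴴ = totalSpin n i := fun i => by
    rw [hUρ, Matrix.mul_assoc, hU, Matrix.mul_one]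
  obtain ⟨p, q, r, hpqr, hode⟩ := exists_coeff hB hn hI hT hU' fun t ht => by
    have h1 := (hρ.isVec ht).conj hU'
    rwa [funext hUρ'] at h1
  obtain ⟨t₀, ht₀⟩ := hI'.nonempty
  obtain ⟨w, hw, hwq⟩ := exists_phase (q t₀)
  have hp : ∀ t ∈ I, HasDerivAt p ((p t) ^ 2 + 2 / ((n : ℝ) + 1) * Complex.normSq (q t)) t := by
    intro t ht
    refine hasDerivAt_of_ofReal ((hode t ht).1.congr_deriv ?_)
    rw [RCLike.star_def, Complex.mul_conj]
    push_cast
    rfl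
  have hr : ∀ t ∈ I, HasDerivAt r ((r t) ^ 2 -
      2 * ((n : ℝ) + 2) / ((n : ℝ) * ((n : ℝ) + 1)) * Complex.normSq (q t)) t := by
    intro t ht
    refine hasDerivAt_of_ofReal ((hode t ht).2.2.congr_deriv ?_)
    rw [RCLike.star_def, Complex.mul_conj]
    push_cast
    rfl
  have hwqd : ∀ t ∈ I, HasDerivAt (fun s => w * q s)
      (((((n : ℝ) + 3) / 2 * p t - ((n : ℝ) - 1) / 2 * r t : ℝ) : ℂ) * (w * q t)) t := by
    intro t ht
    refine ((hode t ht).2.1.const_mul w).congr_deriv ?_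
    push_cast
    ring
  have him : ∀ t ∈ I, HasDerivAt (fun s => (w * q s).im)
      ((((n : ℝ) + 3) / 2 * p t - ((n : ℝ) - 1) / 2 * r t) * (w * q t).im) t := by
    intro t ht
    refine (Complex.imCLM.hasFDerivAt.comp_hasDerivAt t (hwqd t ht)).congr_deriv ?_
    exact Complex.im_ofReal_mul _ _
  have hre : ∀ t ∈ I, HasDerivAt (fun s => (w * q s).re)
      ((((n : ℝ) + 3) / 2 * p t - ((n : ℝ) - 1) / 2 * r t) * (w * q t).re) t := by
    intro t ht
    refine (Complex.reCLM.hasFDerivAt.comp_hasDerivAt t (hwqd t ht)).congr_deriv ?_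
    exact Complex.re_ofReal_mul _ _
  -- the phase of the off-diagonal coefficient is constant
  have him0 : ∀ t ∈ I, (w * q t).im = 0 := by
    intro t ht
    refine eq_zero_of_linear_ode hI hI'.isPreconnected
      (h := fun t => (w * q t).im)
      (k := fun t => ((n : ℝ) + 3) / 2 * p t - ((n : ℝ) - 1) / 2 * r t) ?_ him ht₀ hwq ht
    intro s hs
    have h1 := (hp s hs).continuousAt
    have h2 := (hr s hs).continuousAt
    exact ((h1.const_mul _).sub (h2.const_mul _)).continuousWithinAt
  have hg : ∀ t ∈ I, w * q t = (((w * q t).re : ℝ) : ℂ) := fun t ht =>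
    Complex.ext (by simp) (by rw [him0 t ht, Complex.ofReal_im])
  have hnormSq : ∀ t ∈ I, Complex.normSq (q t) = (w * q t).re ^ 2 := by
    intro t ht
    have h1 : Complex.normSq w = 1 := by
      have h2 := hw
      rw [RCLike.star_def, Complex.mul_conj] at h2
      exact_mod_cast h2
    have h3 : Complex.normSq (w * q t) = (w * q t).re * (w * q t).re := by
      rw [Complex.normSq_apply, him0 t ht]
      ring
    rw [Complex.normSq_mul, h1, one_mul] at h3
    rw [h3, sq]
  have hred : SolvesReduced n p (fun t => (w * q t).re) r I := by
    intro t ht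
    refine ⟨(hp t ht).congr_deriv ?_, hre t ht, (hr t ht).congr_deriv ?_⟩ <;> rw [hnormSq t ht]
  have hdet : U.det * star U.det = 1 := by
    rw [← Matrix.det_conjTranspose, ← Matrix.det_mul, hU, Matrix.det_one]
  obtain ⟨u, v, hu, hv, huv, hone⟩ := exists_phases (n := n) hdet hw
  have hvu : v * star u = star w := by rw [← huv, star_mul', star_star, mul_comm]
  have hS : scalarBlocks n u v * (scalarBlocks n u v)ᴴ = 1 := by
    rw [conjTranspose_scalarBlocks, scalarBlocks_mul, hu, hv, scalarBlocks_one]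
  obtain ⟨han1, han2, han3⟩ := hred.analyticOnNhd hI
  refine ⟨scalarBlocks n u v * U, ?_, p, fun t => (w * q t).re, r, han1, han2, han3, ?_, ?_, hred⟩
  · rw [Matrix.mem_specialUnitaryGroup_iff, Matrix.mem_unitaryGroup_iff,
      Matrix.star_eq_conjTranspose, Matrix.conjTranspose_mul, Matrix.det_mul, det_scalarBlocks]
    refine ⟨?_, hone⟩
    rw [Matrix.mul_assoc, ← Matrix.mul_assoc U, hU, Matrix.one_mul, hS]
  · have h1 : ∀ i, scalarBlocks n u v * U * ρ (X i) * (scalarBlocks n u v * U)ᴴ =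
        (V (n + 2)).sum (V n) (X i) := by
      intro i
      rw [sum_V_apply_X, Matrix.conjTranspose_mul]
      calc _ = scalarBlocks n u v * (U * ρ (X i) * Uᴴ) * (scalarBlocks n u v)ᴴ := by
            simp only [Matrix.mul_assoc]
        _ = _ := by rw [hUρ', scalarBlocks_mul_totalSpin, Matrix.mul_assoc, hS, Matrix.mul_one]
    intro A
    rw [Rep.apply_eq_sum ρ A, Rep.apply_eq_sum ((V (n + 2)).sum (V n)) A, ← h1 0, ← h1 1, ← h1 2]
    simp only [Matrix.mul_add, Matrix.add_mul, Matrix.mul_smul, Matrix.smul_mul]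
  · intro t ht i
    rw [Matrix.conjTranspose_mul, ansatz_eq_blocks]
    calc _ = scalarBlocks n u v * (U * T t i * Uᴴ) * (scalarBlocks n u v)ᴴ := by
            simp only [Matrix.mul_assoc]
      _ = _ := by
        rw [hpqr t ht, scalarBlocks_conj_blocks, hu, hv, huv, hvu, one_mul, one_mul, ← star_mul',
          hg t ht, RCLike.star_def, Complex.conj_ofReal]
        simp only [Complex.ofReal_re]

end

/-! ### Finite rotations -/

/-- Rotation about the first coordinate axis. -/
def rotX (θ : ℝ) : Matrix (Fin 3) (Fin 3) ℝ :=
  !![1, 0, 0; 0, Real.cos θ, -Real.sin θ; 0, Real.sin θ, Real.cos θ]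

/-- Rotation about the second coordinate axis. -/
def rotY (θ : ℝ) : Matrix (Fin 3) (Fin 3) ℝ :=
  !![Real.cos θ, 0, Real.sin θ; 0, 1, 0; -Real.sin θ, 0, Real.cos θ]

/-- Rotation about the third coordinate axis. -/
def rotZ (θ : ℝ) : Matrix (Fin 3) (Fin 3) ℝ :=
  !![Real.cos θ, -Real.sin θ, 0; Real.sin θ, Real.cos θ, 0; 0, 0, 1]

theorem rotY_neg_mul (θ : ℝ) : rotY (-θ) * rotY θ = 1 := by
  have h := Real.cos_sq_add_sin_sq θ
  ext i j
  fin_cases i <;> fin_cases j <;>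
  simp [rotY, Matrix.mul_apply, Fin.sum_univ_three] <;> first | ring1 | linear_combination h

theorem rotZ_neg_mul (θ : ℝ) : rotZ (-θ) * rotZ θ = 1 := by
  have h := Real.cos_sq_add_sin_sq θ
  ext i j
  fin_cases i <;> fin_cases j <;>
  simp [rotZ, Matrix.mul_apply, Fin.sum_univ_three] <;> first | ring1 | linear_combination h

theorem transpose_rotY (θ : ℝ) : (rotY θ)ᵀ = rotY (-θ) := by
  ext i j
  fin_cases i <;> fin_cases j <;> simp [rotY]

theorem transpose_rotZ (θ : ℝ) : (rotZ θ)ᵀ = rotZ (-θ) := by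
  ext i j
  fin_cases i <;> fin_cases j <;> simp [rotZ]

theorem det_rotY (θ : ℝ) : (rotY θ).det = 1 := by
  have h := Real.cos_sq_add_sin_sq θ
  simp [rotY, Matrix.det_fin_three]
  linear_combination h

theorem det_rotZ (θ : ℝ) : (rotZ θ).det = 1 := by
  have h := Real.cos_sq_add_sin_sq θ
  simp [rotZ, Matrix.det_fin_three]
  linear_combination h

/-- Polar coordinates, with an angle also at the origin. -/
theorem exists_polar (x y : ℝ) : ∃ r φ : ℝ, 0 ≤ r ∧ x = r * Real.cos φ ∧ y = r * Real.sin φ :=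
  ⟨‖(⟨x, y⟩ : ℂ)‖, Complex.arg ⟨x, y⟩, norm_nonneg _,
    (Complex.norm_mul_cos_arg ⟨x, y⟩).symm, (Complex.norm_mul_sin_arg ⟨x, y⟩).symm⟩

/-- Euler decomposition: two Givens rotations turn the first column of a rotation matrix into the
first basis vector, which leaves a rotation about the first axis. -/
theorem exists_euler {A : Matrix (Fin 3) (Fin 3) ℝ}
    (hA : A ∈ Matrix.specialOrthogonalGroup (Fin 3) ℝ) :
    ∃ α β γ : ℝ, A = rotZ α * (rotY β * rotX γ) := by
  rw [Matrix.mem_specialOrthogonalGroup_iff, Matrix.mem_orthogonalGroup_iff] at hA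
  obtain ⟨hAA, hdet⟩ := hA
  obtain ⟨r, φ, -, hx, hy⟩ := exists_polar (A 0 0) (A 1 0)
  obtain ⟨ρ, ψ, hρ, hx', hy'⟩ := exists_polar r (A 2 0)
  have hφ := Real.cos_sq_add_sin_sq φ
  have hψ := Real.cos_sq_add_sin_sq ψ
  set C := rotY ψ * (rotZ (-φ) * A) with hC
  have hCA : A = rotZ φ * (rotY (-ψ) * C) := by
    have h1 := rotZ_neg_mul (-φ)
    rw [neg_neg] at h1
    rw [hC, ← Matrix.mul_assoc (rotY (-ψ)), rotY_neg_mul, Matrix.one_mul, ← Matrix.mul_assoc, h1,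
      Matrix.one_mul]
  have hCC : C * Cᵀ = 1 := by
    have h1 := rotY_neg_mul (-ψ)
    have h2 := rotZ_neg_mul φ
    rw [neg_neg] at h1
    rw [hC, Matrix.transpose_mul, Matrix.transpose_mul, transpose_rotY, transpose_rotZ, neg_neg]
    calc _ = rotY ψ * (rotZ (-φ) * (A * Aᵀ) * rotZ φ) * rotY (-ψ) := by
          simp only [Matrix.mul_assoc]
      _ = 1 := by rw [hAA, Matrix.mul_one, h2, Matrix.mul_one, h1]
  have hCC' : Cᵀ * C = 1 := mul_eq_one_comm.1 hCC
  have hCdet : C.det = 1 := by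
    rw [hC, Matrix.det_mul, Matrix.det_mul, det_rotY, det_rotZ, hdet, one_mul, one_mul]
  have c10 : C 1 0 = 0 := by
    simp [hC, rotY, rotZ, Matrix.vecMul, dotProduct, Fin.sum_univ_three]
    rw [hx, hy]
    ring
  have c20 : C 2 0 = 0 := by
    simp [hC, rotY, rotZ, Matrix.vecMul, dotProduct, Fin.sum_univ_three]
    linear_combination -Real.sin ψ * Real.cos φ * hx - Real.sin ψ * Real.sin φ * hy -
      Real.sin ψ * r * hφ - Real.sin ψ * hx' + Real.cos ψ * hy'
  have c00 : C 0 0 = ρ := by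
    simp [hC, rotY, rotZ, Matrix.vecMul, dotProduct, Fin.sum_univ_three]
    linear_combination Real.cos ψ * Real.cos φ * hx + Real.cos ψ * Real.sin φ * hy +
      Real.cos ψ * r * hφ + Real.cos ψ * hx' + Real.sin ψ * hy' + ρ * hψ
  have e00 := congrFun (congrFun hCC' 0) 0
  have r00 := congrFun (congrFun hCC 0) 0
  have r11 := congrFun (congrFun hCC 1) 1
  have r12 := congrFun (congrFun hCC 1) 2
  have r22 := congrFun (congrFun hCC 2) 2
  simp only [Matrix.mul_apply, Fin.sum_univ_three, Matrix.transpose_apply, c10, c20, c00,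
    Matrix.one_apply_eq, mul_zero, add_zero, zero_add] at e00 r00 r11 r12 r22
  rw [Matrix.one_apply_ne (by decide)] at r12
  have hρ1 : ρ = 1 := (mul_self_eq_one_iff.1 e00).resolve_right (by linarith)
  rw [hρ1] at r00
  have c01 : C 0 1 = 0 := by nlinarith [sq_nonneg (C 0 1), sq_nonneg (C 0 2)]
  have c02 : C 0 2 = 0 := by nlinarith [sq_nonneg (C 0 1), sq_nonneg (C 0 2)]
  rw [Matrix.det_fin_three, c10, c20, c01, c02, c00, hρ1] at hCdet
  -- the remaining block is a rotation of the plane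
  have e1 : C 1 1 = C 2 2 := by
    linear_combination C 2 2 * r11 - C 1 2 * r12 - C 1 1 * hCdet
  have e2 : C 1 2 = - C 2 1 := by
    linear_combination C 1 1 * r12 - C 2 1 * r11 - C 1 2 * hCdet
  obtain ⟨s, γ, hs, hc, hsn⟩ := exists_polar (C 1 1) (C 2 1)
  have hγ := Real.cos_sq_add_sin_sq γ
  have hs1 : s = 1 := by
    have : s * s = 1 := by
      have h1 : C 1 1 * C 1 1 + C 2 1 * C 2 1 = 1 := by rw [← r11, e2]; ring
      rw [hc, hsn] at h1
      linear_combination h1 - s * s * hγ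
    exact (mul_self_eq_one_iff.1 this).resolve_right (by linarith)
  refine ⟨φ, -ψ, γ, ?_⟩
  rw [hCA]
  congr 2
  rw [hs1, one_mul] at hc hsn
  ext i j
  fin_cases i <;> fin_cases j <;>
  simp [rotX, c00, c01, c02, c10, c20, hρ1, hc, hsn, e2, ← e1]

section
variable {ι : Type*} [Fintype ι] [DecidableEq ι]

theorem exp_neg_mul_exp (M : Matrix ι ι ℂ) :
    NormedSpace.exp (-M) * NormedSpace.exp M = 1 := by
  rw [← Matrix.exp_add_of_commute _ _ (Commute.neg_left (Commute.refl M)), neg_add_cancel,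
    NormedSpace.exp_zero]

theorem mul_commutator_mul {R : Type*} [Ring R] (E K P Q F : R) :
    (E * K * P + E * Q) * F + E * P * (-K * F) = E * (K * P - P * K + Q) * F := by
  noncomm_ring

section
-- any norm serves to differentiate the exponential; the statements do not depend on it
attribute [local instance] Matrix.linftyOpNormedRing Matrix.linftyOpNormedAlgebra

/-- If `K` rotates the pair `C`, `D` infinitesimally, its exponential rotates them by a finite
angle. -/
theorem exp_conj_rotation {K C D : Matrix ι ι ℂ} (hC : K * C - C * K = D)
    (hD : K * D - D * K = - C) (θ : ℝ) :
    NormedSpace.exp (-(θ • K)) * C * NormedSpace.exp (θ • K) =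
      Real.cos θ • C - Real.sin θ • D := by
  have hinv : ∀ s : ℝ, NormedSpace.exp (-(s • K)) * NormedSpace.exp (s • K) = 1 := by
    exact fun s => exp_neg_mul_exp _
  -- undoing the conjugation gives a function of the angle with zero derivative
  have hd : ∀ s : ℝ, HasDerivAt (fun s : ℝ => NormedSpace.exp (s • K) *
      (Real.cos s • C - Real.sin s • D) * NormedSpace.exp (s • (-K))) 0 s := by
    intro s
    have h1 := hasDerivAt_exp_smul_const K s
    have h2 := hasDerivAt_exp_smul_const' (-K) s
    have h3 := ((Real.hasDerivAt_cos s).smul_const C).fun_sub ((Real.hasDerivAt_sin s).smul_const D)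
    refine ((h1.fun_mul h3).fun_mul h2).congr_deriv ?_
    have h4 : K * (Real.cos s • C - Real.sin s • D) - (Real.cos s • C - Real.sin s • D) * K +
        ((-Real.sin s) • C - Real.cos s • D) = 0 := by
      calc _ = Real.cos s • (K * C - C * K) - Real.sin s • (K * D - D * K) +
            ((-Real.sin s) • C - Real.cos s • D) := by
            simp only [mul_sub, sub_mul, mul_smul_comm, smul_mul_assoc]
            module
        _ = 0 := by rw [hC, hD]; module
    calc _ = NormedSpace.exp (s • K) * (K * (Real.cos s • C - Real.sin s • D) -
          (Real.cos s • C - Real.sin s • D) * K + ((-Real.sin s) • C - Real.cos s • D)) *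
          NormedSpace.exp (s • (-K)) := 
          mul_commutator_mul _ _ _ _ _
      _ = 0 := by rw [h4, mul_zero, zero_mul]
  have hconst := is_const_of_deriv_eq_zero (fun s => (hd s).differentiableAt)
    (fun s => (hd s).deriv) θ 0
  simp only [zero_smul, NormedSpace.exp_zero, Real.cos_zero, Real.sin_zero, one_smul, sub_zero,
    mul_one, one_mul, smul_neg, neg_zero] at hconst
  calc NormedSpace.exp (-(θ • K)) * C * NormedSpace.exp (θ • K)
      = (NormedSpace.exp (-(θ • K)) * NormedSpace.exp (θ • K)) *
        (Real.cos θ • C - Real.sin θ • D) *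
        (NormedSpace.exp (-(θ • K)) * NormedSpace.exp (θ • K)) := by
        conv_lhs => rw [← hconst]
        simp only [mul_assoc]
    _ = _ := by rw [hinv, one_mul, mul_one]

theorem exp_conj_fixed {K C : Matrix ι ι ℂ} (hC : K * C = C * K) (θ : ℝ) :
    NormedSpace.exp (-(θ • K)) * C * NormedSpace.exp (θ • K) = C := by
  have h1 : Commute C (NormedSpace.exp (θ • K)) :=
    Commute.exp_right ((Commute.smul_right (show Commute C K from hC.symm)) θ)
  rw [mul_assoc, h1.eq, ← mul_assoc, exp_neg_mul_exp, one_mul]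

/-- The exponential of a skew-Hermitian matrix is unitary. -/
theorem exp_unitary {K : Matrix ι ι ℂ} (hK : Kᴴ = - K) (θ : ℝ) :
    (NormedSpace.exp (θ • K))ᴴ = NormedSpace.exp (-(θ • K)) ∧
      NormedSpace.exp (θ • K) * (NormedSpace.exp (θ • K))ᴴ = 1 := by
  have h1 : (NormedSpace.exp (θ • K))ᴴ = NormedSpace.exp (-(θ • K)) := by
    rw [← Matrix.exp_conjTranspose, Matrix.conjTranspose_smul, hK, star_trivial, smul_neg]
  refine ⟨h1, ?_⟩
  rw [h1, mul_eq_one_comm, exp_neg_mul_exp]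

end

/-- The rotation `A` acts on the triples `T t` as a fixed unitary conjugation. -/
def IsImplemented (T : ℝ → Fin 3 → Matrix ι ι ℂ) (I : Set ℝ) (A : Matrix (Fin 3) (Fin 3) ℝ) :
    Prop :=
  ∃ U : Matrix ι ι ℂ, U * Uᴴ = 1 ∧ ∀ t ∈ I, ∀ i, ∑ j, A i j • T t j = Uᴴ * T t i * U

theorem IsImplemented.mul {T : ℝ → Fin 3 → Matrix ι ι ℂ} {I : Set ℝ}
    {A A' : Matrix (Fin 3) (Fin 3) ℝ} (h : IsImplemented T I A) (h' : IsImplemented T I A') :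
    IsImplemented T I (A * A') := by
  obtain ⟨U, hU, h⟩ := h
  obtain ⟨U', hU', h'⟩ := h'
  refine ⟨U * U', ?_, fun t ht i => ?_⟩
  · rw [Matrix.conjTranspose_mul, Matrix.mul_assoc, ← Matrix.mul_assoc U', hU', Matrix.one_mul, hU]
  · calc ∑ j, (A * A') i j • T t j = ∑ k, A i k • ∑ j, A' k j • T t j := by
          simp only [Matrix.mul_apply, Finset.sum_smul, Finset.smul_sum, smul_smul]
          exact Finset.sum_comm
      _ = U'ᴴ * (∑ k, A i k • T t k) * U' := by
          simp only [h' t ht, Matrix.mul_sum, Matrix.sum_mul, Matrix.mul_smul, Matrix.smul_mul]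
      _ = _ := by
          rw [h t ht, Matrix.conjTranspose_mul]
          simp only [Matrix.mul_assoc]

/-- Rotations about the coordinate axes are implemented by the exponentials of the generators. -/
theorem isImplemented_rot {ρ : Rep ι} {T : ℝ → Fin 3 → Matrix ι ι ℂ} {I : Set ℝ}
    (h : GeneratesSymmetry ρ T I) (θ : ℝ) :
    IsImplemented T I (rotX θ) ∧ IsImplemented T I (rotY θ) ∧ IsImplemented T I (rotZ θ) := by
  have hvec : ∀ t ∈ I, ∀ j k, ρ (X j) * T t k - T t k * ρ (X j) = ∑ i, eps j k i • T t i :=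
    fun t ht j k => h.2 t ht j k
  have hU := fun i => exp_unitary (h.1 i).1 θ
  refine ⟨⟨_, (hU 0).2, fun t ht i => ?_⟩, ⟨_, (hU 1).2, fun t ht i => ?_⟩,
    ⟨_, (hU 2).2, fun t ht i => ?_⟩⟩
  · have h0 : ρ (X 0) * T t 0 = T t 0 * ρ (X 0) := by
      rw [← sub_eq_zero, hvec t ht]; simp [eps]
    have h1 : ρ (X 0) * T t 1 - T t 1 * ρ (X 0) = T t 2 := by
      rw [hvec t ht]; norm_num [Fin.sum_univ_three, eps]
    have h2 : ρ (X 0) * T t 2 - T t 2 * ρ (X 0) = - T t 1 := by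
      rw [hvec t ht]; norm_num [Fin.sum_univ_three, eps]
    have h3 : ρ (X 0) * (- T t 1) - (- T t 1) * ρ (X 0) = - T t 2 := by
      rw [← h1]; noncomm_ring
    rw [(hU 0).1]
    fin_cases i
    · simp [rotX, Fin.sum_univ_three, exp_conj_fixed h0]
    · simp [rotX, Fin.sum_univ_three, exp_conj_rotation h1 h2, sub_eq_add_neg]
    · simp [rotX, Fin.sum_univ_three, exp_conj_rotation h2 h3, add_comm]
  · have h0 : ρ (X 1) * T t 1 = T t 1 * ρ (X 1) := by
      rw [← sub_eq_zero, hvec t ht]; simp [eps]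
    have h1 : ρ (X 1) * T t 2 - T t 2 * ρ (X 1) = T t 0 := by
      rw [hvec t ht]; norm_num [Fin.sum_univ_three, eps]
    have h2 : ρ (X 1) * T t 0 - T t 0 * ρ (X 1) = - T t 2 := by
      rw [hvec t ht]; norm_num [Fin.sum_univ_three, eps]
    have h3 : ρ (X 1) * (- T t 2) - (- T t 2) * ρ (X 1) = - T t 0 := by
      rw [← h1]; noncomm_ring
    rw [(hU 1).1]
    fin_cases i
    · simp [rotY, Fin.sum_univ_three, exp_conj_rotation h2 h3]
    · simp [rotY, Fin.sum_univ_three, exp_conj_fixed h0]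
    · simp [rotY, Fin.sum_univ_three, exp_conj_rotation h1 h2, sub_eq_add_neg, add_comm]
  · have h0 : ρ (X 2) * T t 2 = T t 2 * ρ (X 2) := by
      rw [← sub_eq_zero, hvec t ht]; simp [eps]
    have h1 : ρ (X 2) * T t 0 - T t 0 * ρ (X 2) = T t 1 := by
      rw [hvec t ht]; norm_num [Fin.sum_univ_three, eps]
    have h2 : ρ (X 2) * T t 1 - T t 1 * ρ (X 2) = - T t 0 := by
      rw [hvec t ht]; norm_num [Fin.sum_univ_three, eps]
    have h3 : ρ (X 2) * (- T t 0) - (- T t 0) * ρ (X 2) = - T t 1 := by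
      rw [← h1]; noncomm_ring
    rw [(hU 2).1]
    fin_cases i
    · simp [rotZ, Fin.sum_univ_three, exp_conj_rotation h1 h2, sub_eq_add_neg]
    · simp [rotZ, Fin.sum_univ_three, exp_conj_rotation h2 h3, add_comm]
    · simp [rotZ, Fin.sum_univ_three, exp_conj_fixed h0]

/-- Infinitesimal symmetry implies symmetry under all rotations. -/
theorem GeneratesSymmetry.isSphericallySymmetric [Nonempty ι] {ρ : Rep ι}
    {T : ℝ → Fin 3 → Matrix ι ι ℂ} {I : Set ℝ} (h : GeneratesSymmetry ρ T I) :
    IsSphericallySymmetric T I := by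
  intro A hA
  obtain ⟨α, β, γ, rfl⟩ := exists_euler hA
  obtain ⟨U, hU, hUT⟩ := (isImplemented_rot h α).2.2.mul
    ((isImplemented_rot h β).2.1.mul (isImplemented_rot h γ).1)
  -- a phase factor normalizes the determinant and does not change the conjugation
  have hdet : U.det * star U.det = 1 := by
    rw [← Matrix.det_conjTranspose, ← Matrix.det_mul, hU, Matrix.det_one]
  obtain ⟨z, hz⟩ := IsAlgClosed.exists_pow_nat_eq (U.det)⁻¹ (Fintype.card_pos (α := ι))
  have hz1 : z * star z = 1 := by
    rw [RCLike.star_def, Complex.mul_conj, Complex.normSq_eq_norm_sq] at hdet ⊢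
    have h1 : ‖U.det‖ = 1 :=
      (pow_eq_one_iff_of_nonneg (norm_nonneg _) two_ne_zero).1 (by exact_mod_cast hdet)
    have h2 := congrArg norm hz
    rw [norm_pow, norm_inv, h1, inv_one] at h2
    rw [(pow_eq_one_iff_of_nonneg (norm_nonneg _) Fintype.card_ne_zero).1 h2]
    norm_num
  refine ⟨z • U, ?_, fun t ht i => ?_⟩
  · rw [Matrix.mem_specialUnitaryGroup_iff, Matrix.mem_unitaryGroup_iff,
      Matrix.star_eq_conjTranspose, Matrix.conjTranspose_smul, Matrix.smul_mul, Matrix.mul_smul,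
      smul_smul, hz1, hU, one_smul, Matrix.det_smul, hz]
    exact ⟨rfl, inv_mul_cancel₀ (left_ne_zero_of_mul_eq_one hdet)⟩
  · rw [hUT t ht, Matrix.conjTranspose_smul, Matrix.smul_mul, Matrix.smul_mul, Matrix.mul_smul,
      smul_smul, mul_comm, hz1, one_smul]

end

/-! ### From the reduced system back to Nahm's equations -/

section
variable {n : ℕ} {B : Fin 3 → Matrix (Fin (n + 2)) (Fin n) ℂ}

theorem hasDerivAt_ansatz_apply {fp g fm : ℝ → ℝ} {fp' g' fm' t : ℝ} (h1 : HasDerivAt fp fp' t)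
    (h2 : HasDerivAt g g' t) (h3 : HasDerivAt fm fm' t) (i : Fin 3) (a b : Fin (n + 2) ⊕ Fin n) :
    HasDerivAt (fun s => ansatz n B fp g fm s i a b)
      (ansatz n B (fun _ => fp') (fun _ => g') (fun _ => fm') t i a b) t := by
  rcases a with a | a <;> rcases b with b | b
  · exact h1.smul_const (V (n + 2) (X i) a b)
  · exact h2.smul_const (B i a b)
  · exact (h2.smul_const ((B i)ᴴ a b)).neg
  · exact h3.smul_const (V n (X i) a b)

theorem isSu_blocks (hB : IsInvariantTriple n B) (p q r : ℝ) (i : Fin 3) :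
    IsSu (blocks B p q q r i) := by
  refine ⟨?_, trace_blocks hB _ _ _ _ i⟩
  have h := conjTranspose_blocks (B := B) (p : ℂ) (q : ℂ) (r : ℂ) i
  simpa only [RCLike.star_def, Complex.conj_ofReal] using h

/-- The block matrices built from a solution of the reduced system solve Nahm's equations. -/
theorem SolvesReduced.isNahmSolution (hB : IsInvariantTriple n B) (hn : 2 ≤ n) {fp g fm : ℝ → ℝ}
    {I : Set ℝ} (h : SolvesReduced n fp g fm I) : IsNahmSolution (ansatz n B fp g fm) I := by
  refine ⟨fun t _ i => ?_, fun t ht i a b => ?_⟩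
  · rw [ansatz_eq_blocks]
    exact isSu_blocks hB _ _ _ i
  · obtain ⟨h1, h2, h3⟩ := h t ht
    refine (hasDerivAt_ansatz_apply h1 h2 h3 i a b).congr_deriv ?_
    have e : ansatz n B fp g fm t = blocks B (fp t) (g t) (g t) (fm t) :=
      funext fun i => ansatz_eq_blocks fp g fm t i
    rw [half_sum_lie_eq_cross, e, cross_blocks hB hn, ansatz_eq_blocks]
    push_cast
    simp only [sq]

theorem generatesSymmetry_ansatz (hB : IsInvariantTriple n B) (fp g fm : ℝ → ℝ) (I : Set ℝ) :
    GeneratesSymmetry ((V (n + 2)).sum (V n)) (ansatz n B fp g fm) I := by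
  refine ⟨fun i => ?_, fun t _ i j => ?_⟩
  · rw [sum_V_apply_X, ← blocks_one_eq_totalSpin (B := B)]
    exact_mod_cast isSu_blocks hB 1 0 1 i
  · have h := isVec_blocks hB (fp t) (g t) (g t) (fm t) i j
    have h2 : ∀ m, eps i j m = eps m i j := fun m => by simp only [eps]; ring
    simp only [ansatz_eq_blocks, sum_V_apply_X, h2]
    exact h

end

/-! ### The explicit solution -/

section
variable {n : ℕ}

theorem gExplicit_sq (n : ℕ) (t : ℝ) :
    gExplicit n t ^ 2 = 2 * (n : ℝ) / ((n : ℝ) + 1) * (1 / (t ^ 2 - 1)) ^ 2 := by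
  rw [gExplicit, mul_pow, Real.sq_sqrt (by positivity)]

theorem solvesReduced_explicit (hn : 2 ≤ n) :
    SolvesReduced n (fPlus n) (gExplicit n) (fMinus n) (Set.Ioo (-1) 1) := by
  intro t ht
  have h1 : t ^ 2 - 1 ≠ 0 := by nlinarith [ht.1, ht.2]
  have h2 : (n : ℝ) + 1 ≠ 0 := by positivity
  have h3 : (n : ℝ) ≠ 0 := by positivity
  have hd : HasDerivAt (fun s : ℝ => s ^ 2 - 1) (2 * t) t := by
    simpa using (hasDerivAt_pow 2 t).sub_const 1
  have hl : ∀ c : ℝ, HasDerivAt (fun s : ℝ => ((n : ℝ) + 1) * s + c) ((n : ℝ) + 1) t := fun c => by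
    simpa using ((hasDerivAt_id t).const_mul ((n : ℝ) + 1)).add_const c
  have hq : ((n : ℝ) + 1) * (t ^ 2 - 1) ≠ 0 := mul_ne_zero h2 h1
  refine ⟨?_, ?_, ?_⟩
  · refine ((hl ((n : ℝ) - 1)).div (hd.const_mul ((n : ℝ) + 1)) hq).neg.congr_deriv ?_
    rw [gExplicit_sq, fPlus]
    field_simp
    ring
  · refine (((hasDerivAt_const t (1 : ℝ)).div hd h1).const_mul _).congr_deriv ?_
    rw [gExplicit, fPlus, fMinus]
    generalize Real.sqrt (2 * (n : ℝ) / ((n : ℝ) + 1)) = s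
    field_simp
    ring
  · refine ((hl ((n : ℝ) + 3)).div (hd.const_mul ((n : ℝ) + 1)) hq).neg.congr_deriv ?_
    rw [gExplicit_sq, fMinus]
    field_simp
    ring

/-- No continuous function agrees with `gExplicit` on `(-1, 1)` and is defined at an end point. -/
theorem not_continuousAt_of_eq_gExplicit (hn : 2 ≤ n) {g : ℝ → ℝ} {e : ℝ} (he : e ^ 2 = 1)
    (hg : ∀ t ∈ Set.Ioo (-1 : ℝ) 1, g t = gExplicit n t) : ¬ ContinuousAt g e := by
  intro hc
  have hne : (𝓝[Set.Ioo (-1 : ℝ) 1] e).NeBot := by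
    rw [← mem_closure_iff_nhdsWithin_neBot, closure_Ioo (by norm_num)]
    exact abs_le.1 (sq_le_one_iff_abs_le_one e |>.1 he.le)
  -- the function `g t * (t ^ 2 - 1)` is a nonzero constant on the interval, with limit zero at `e`
  have h1 : Tendsto (fun t => g t * (t ^ 2 - 1)) (𝓝[Set.Ioo (-1 : ℝ) 1] e) (𝓝 0) := by
    have h2 : ContinuousAt (fun t : ℝ => g t * (t ^ 2 - 1)) e := by fun_prop
    have h3 : Tendsto (fun t => g t * (t ^ 2 - 1)) (𝓝 e) (𝓝 (g e * (e ^ 2 - 1))) := h2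
    rw [he, sub_self, mul_zero] at h3
    exact h3.mono_left nhdsWithin_le_nhds
  have h2 : Tendsto (fun t => g t * (t ^ 2 - 1)) (𝓝[Set.Ioo (-1 : ℝ) 1] e)
      (𝓝 (Real.sqrt (2 * (n : ℝ) / ((n : ℝ) + 1)))) := by
    refine tendsto_const_nhds.congr' ?_
    filter_upwards [self_mem_nhdsWithin] with t ht
    have h3 : t ^ 2 - 1 ≠ 0 := by nlinarith [ht.1, ht.2]
    rw [hg t ht, gExplicit]
    field_simp
  have h3 : 0 < Real.sqrt (2 * (n : ℝ) / ((n : ℝ) + 1)) := Real.sqrt_pos.2 (by positivity)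
  exact h3.ne (tendsto_nhds_unique h1 h2)

theorem isMaximalReduced_explicit (hn : 2 ≤ n) :
    IsMaximalReduced n (fPlus n) (gExplicit n) (fMinus n) (Set.Ioo (-1) 1) := by
  refine ⟨solvesReduced_explicit hn, fun J fp' g' fm' _ hJ hIJ hsol hext => ?_⟩
  have hno : ∀ e : ℝ, e ^ 2 = 1 → e ∉ J := fun e he heJ =>
    not_continuousAt_of_eq_gExplicit hn he (fun t ht => (hext t ht).2.1)
      (hsol e heJ).2.1.continuousAt
  have h0 : (0 : ℝ) ∈ J := hIJ (by norm_num)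
  have hord := hJ.isPreconnected.ordConnected
  refine Set.Subset.antisymm (fun x hx => ⟨?_, ?_⟩) hIJ
  · by_contra! h
    exact hno (-1) (by norm_num) (hord.out hx h0 ⟨h, by norm_num⟩)
  · by_contra! h
    exact hno 1 (by norm_num) (hord.out h0 hx ⟨by norm_num, h⟩)

/-! ### Residues -/

/-- The partial fraction with pole at `e'` is analytic at `e`, so the residue can be read off. -/
theorem hasResidue_of_partialFractions {f : ℝ → ℝ} {a b e e' : ℝ} (he : e ≠ e')
    (hf : ∀ t, t ≠ e → t ≠ e' → f t = a / (t - e) + b / (t - e')) : HasResidue f e a := by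
  refine ⟨fun t => b / (t - e'), ?_, ?_⟩
  · exact analyticAt_const.div (analyticAt_id.sub analyticAt_const) (sub_ne_zero.2 he)
  · filter_upwards [self_mem_nhdsWithin, nhdsWithin_le_nhds (isOpen_ne.mem_nhds he)] with t h1 h2
    rw [hf t h1 h2, smul_eq_mul, div_eq_inv_mul]

theorem fPlus_eq (n : ℕ) {t : ℝ} (h1 : t ≠ 1) (h2 : t ≠ -1) : fPlus n t =
    -((n : ℝ) / ((n : ℝ) + 1)) / (t - 1) + -(1 / ((n : ℝ) + 1)) / (t - -1) := by
  have h3 : t - 1 ≠ 0 := sub_ne_zero.2 h1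
  have h4 : t + 1 ≠ 0 := fun h => h2 (by linarith)
  have h5 : t ^ 2 - 1 ≠ 0 := by
    rw [show t ^ 2 - 1 = (t - 1) * (t + 1) by ring]
    exact mul_ne_zero h3 h4
  have h6 : (n : ℝ) + 1 ≠ 0 := by positivity
  rw [fPlus, sub_neg_eq_add]
  field_simp
  ring

theorem fMinus_eq (n : ℕ) {t : ℝ} (h1 : t ≠ 1) (h2 : t ≠ -1) : fMinus n t =
    -(((n : ℝ) + 2) / ((n : ℝ) + 1)) / (t - 1) + (1 / ((n : ℝ) + 1)) / (t - -1) := by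
  have h3 : t - 1 ≠ 0 := sub_ne_zero.2 h1
  have h4 : t + 1 ≠ 0 := fun h => h2 (by linarith)
  have h5 : t ^ 2 - 1 ≠ 0 := by
    rw [show t ^ 2 - 1 = (t - 1) * (t + 1) by ring]
    exact mul_ne_zero h3 h4
  have h6 : (n : ℝ) + 1 ≠ 0 := by positivity
  rw [fMinus, sub_neg_eq_add]
  field_simp
  ring

theorem sqrt_eq_two_mul_sqrt (n : ℕ) : Real.sqrt (2 * (n : ℝ) / ((n : ℝ) + 1)) =
    2 * Real.sqrt ((n : ℝ) / (2 * ((n : ℝ) + 1))) := by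
  rw [show 2 * (n : ℝ) / ((n : ℝ) + 1) = 2 ^ 2 * ((n : ℝ) / (2 * ((n : ℝ) + 1))) by
    field_simp, Real.sqrt_mul (by norm_num), Real.sqrt_sq (by norm_num)]

theorem gExplicit_eq (n : ℕ) {t : ℝ} (h1 : t ≠ 1) (h2 : t ≠ -1) : gExplicit n t =
    Real.sqrt ((n : ℝ) / (2 * ((n : ℝ) + 1))) / (t - 1) +
      -Real.sqrt ((n : ℝ) / (2 * ((n : ℝ) + 1))) / (t - -1) := by
  have h3 : t - 1 ≠ 0 := sub_ne_zero.2 h1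
  have h4 : t + 1 ≠ 0 := fun h => h2 (by linarith)
  have h5 : t ^ 2 - 1 ≠ 0 := by
    rw [show t ^ 2 - 1 = (t - 1) * (t + 1) by ring]
    exact mul_ne_zero h3 h4
  rw [gExplicit, sqrt_eq_two_mul_sqrt, sub_neg_eq_add]
  generalize Real.sqrt ((n : ℝ) / (2 * ((n : ℝ) + 1))) = s
  field_simp
  ring

theorem hasResidue_fPlus_one (n : ℕ) : HasResidue (fPlus n) 1 (-((n : ℝ) / ((n : ℝ) + 1))) :=
  hasResidue_of_partialFractions (by norm_num) fun _ h1 h2 => fPlus_eq n h1 h2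

theorem hasResidue_fPlus_neg_one (n : ℕ) : HasResidue (fPlus n) (-1) (-(1 / ((n : ℝ) + 1))) :=
  hasResidue_of_partialFractions (e' := 1) (by norm_num) fun _ h1 h2 =>
    (fPlus_eq n h2 h1).trans (add_comm _ _)

theorem hasResidue_fMinus_one (n : ℕ) :
    HasResidue (fMinus n) 1 (-(((n : ℝ) + 2) / ((n : ℝ) + 1))) :=
  hasResidue_of_partialFractions (by norm_num) fun _ h1 h2 => fMinus_eq n h1 h2

theorem hasResidue_fMinus_neg_one (n : ℕ) : HasResidue (fMinus n) (-1) (1 / ((n : ℝ) + 1)) :=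
  hasResidue_of_partialFractions (e' := 1) (by norm_num) fun _ h1 h2 =>
    (fMinus_eq n h2 h1).trans (add_comm _ _)

theorem hasResidue_gExplicit_one (n : ℕ) :
    HasResidue (gExplicit n) 1 (Real.sqrt ((n : ℝ) / (2 * ((n : ℝ) + 1)))) :=
  hasResidue_of_partialFractions (by norm_num) fun _ h1 h2 => gExplicit_eq n h1 h2

theorem hasResidue_gExplicit_neg_one (n : ℕ) :
    HasResidue (gExplicit n) (-1) (-Real.sqrt ((n : ℝ) / (2 * ((n : ℝ) + 1)))) :=
  hasResidue_of_partialFractions (e' := 1) (by norm_num) fun _ h1 h2 =>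
    (gExplicit_eq n h2 h1).trans (add_comm _ _)

theorem HasResidue.smul_const {f : ℝ → ℝ} {t₀ r : ℝ} (h : HasResidue f t₀ r) (c : ℂ) :
    HasResidue (fun t => f t • c) t₀ (r • c) := by
  obtain ⟨k, hk, hf⟩ := h
  refine ⟨fun t => k t • c, hk.smul analyticAt_const, ?_⟩
  filter_upwards [hf] with t ht
  rw [ht, add_smul, smul_eq_mul, mul_smul]

/-- The residues of the Ansatz, in terms of those of its coefficients. -/
theorem hasResidue_ansatz_apply {B : Fin 3 → Matrix (Fin (n + 2)) (Fin n) ℂ} {fp g fm : ℝ → ℝ}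
    {t₀ p q r : ℝ} (h1 : HasResidue fp t₀ p) (h2 : HasResidue g t₀ q) (h3 : HasResidue fm t₀ r)
    (i : Fin 3) (a b : Fin (n + 2) ⊕ Fin n) :
    HasResidue (fun t => ansatz n B fp g fm t i a b) t₀ (blocks B p q q r i a b) := by
  rw [← ansatz_eq_blocks (fun _ => p) (fun _ => q) (fun _ => r) t₀]
  rcases a with a | a <;> rcases b with b | b
  · exact h1.smul_const (V (n + 2) (X i) a b)
  · exact h2.smul_const (B i a b)
  · have h := h2.smul_const (-(B i)ᴴ a b)
    simp only [smul_neg] at h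
    exact h
  · exact h3.smul_const (V n (X i) a b)

end

/-! ### Irreducibility -/

section
variable {n : ℕ} {B : Fin 3 → Matrix (Fin (n + 2)) (Fin n) ℂ}

theorem totalSpin_casimir (n : ℕ) : ∑ i, totalSpin n i * totalSpin n i =
    scalarBlocks n (-(((n + 2 : ℕ) : ℂ) ^ 2 - 1) / 4) (-((n : ℂ) ^ 2 - 1) / 4) := by
  rw [scalarBlocks, ← spinMatrix_casimir, ← spinMatrix_casimir]
  simp [totalSpin, Matrix.fromBlocks_multiply, Fin.sum_univ_three, Matrix.fromBlocks_add]

/-- A subspace that is invariant under the generators of `V (n + 2) ⊕ V n` is compatible with this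
decomposition, because the Casimir element separates the two summands; an off-diagonal block
operator then connects the summands. -/
theorem eq_bot_or_top_of_blocks_invariant (hB : IsInvariantTriple n B) {p q r : ℂ} (hq : q ≠ 0)
    (W : Submodule ℂ (Fin (n + 2) ⊕ Fin n → ℂ))
    (hS : ∀ i, ∀ v ∈ W, totalSpin n i *ᵥ v ∈ W)
    (hC : ∀ i, ∀ v ∈ W, blocks B p q q r i *ᵥ v ∈ W) : W = ⊥ ∨ W = ⊤ := by
  have hcas : ∀ v ∈ W, scalarBlocks n (-(((n + 2 : ℕ) : ℂ) ^ 2 - 1) / 4)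
      (-((n : ℂ) ^ 2 - 1) / 4) *ᵥ v ∈ W := by
    intro v hv
    rw [← totalSpin_casimir, Matrix.sum_mulVec]
    refine W.sum_mem fun i _ => ?_
    rw [← Matrix.mulVec_mulVec]
    exact hS i _ (hS i v hv)
  have hne := casimir_ne (k := n + 2) (l := n) (by omega)
  generalize -(((n + 2 : ℕ) : ℂ) ^ 2 - 1) / 4 = c at hcas hne
  generalize -((n : ℂ) ^ 2 - 1) / 4 = c' at hcas hne
  have hsplit : ∀ (x : Fin (n + 2) → ℂ) (y : Fin n → ℂ), Sum.elim x y ∈ W →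
      Sum.elim x (0 : Fin n → ℂ) ∈ W ∧ Sum.elim (0 : Fin (n + 2) → ℂ) y ∈ W := by
    intro x y hv
    have h1 := hcas _ hv
    have h2 : scalarBlocks n c c' *ᵥ Sum.elim x y = Sum.elim (c • x) (c' • y) := by
      simp [scalarBlocks, Matrix.fromBlocks_mulVec, Matrix.smul_mulVec]
    rw [h2] at h1
    constructor
    · convert W.smul_mem (c - c')⁻¹ (W.sub_mem h1 (W.smul_mem c' hv)) using 1
      ext (a | a)
      · simp only [Sum.elim_inl, Pi.smul_apply, Pi.sub_apply, smul_eq_mul]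
        field_simp [sub_ne_zero.2 hne]
      · simp
    · convert W.smul_mem (c' - c)⁻¹ (W.sub_mem h1 (W.smul_mem c hv)) using 1
      ext (a | a)
      · simp
      · simp only [Sum.elim_inr, Pi.smul_apply, Pi.sub_apply, smul_eq_mul]
        field_simp [sub_ne_zero.2 hne.symm]
  let W₁ : Submodule ℂ (Fin (n + 2) → ℂ) :=
    W.comap ((LinearEquiv.sumArrowLequivProdArrow _ _ ℂ ℂ).symm.toLinearMap ∘ₗ LinearMap.inl ℂ _ _)
  let W₂ : Submodule ℂ (Fin n → ℂ) :=
    W.comap ((LinearEquiv.sumArrowLequivProdArrow _ _ ℂ ℂ).symm.toLinearMap ∘ₗ LinearMap.inr ℂ _ _)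
  have m₁ : ∀ x, x ∈ W₁ ↔ Sum.elim x (0 : Fin n → ℂ) ∈ W := fun x => Iff.rfl
  have m₂ : ∀ y, y ∈ W₂ ↔ Sum.elim (0 : Fin (n + 2) → ℂ) y ∈ W := fun x => Iff.rfl
  have h₁ : W₁ = ⊥ ∨ W₁ = ⊤ := by
    refine eq_bot_or_top_of_spinMatrix_invariant W₁ fun i x hx => ?_
    have h := hS i _ ((m₁ x).1 hx)
    rw [totalSpin, Matrix.fromBlocks_mulVec] at h
    simpa [m₁] using h
  have h₂ : W₂ = ⊥ ∨ W₂ = ⊤ := by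
    refine eq_bot_or_top_of_spinMatrix_invariant W₂ fun i x hx => ?_
    have h := hS i _ ((m₂ x).1 hx)
    rw [totalSpin, Matrix.fromBlocks_mulVec] at h
    simpa [m₂] using h
  have h₂₁ : ∀ i, ∀ y ∈ W₂, B i *ᵥ y ∈ W₁ := by
    intro i y hy
    have h := hC i _ ((m₂ y).1 hy)
    rw [blocks, Matrix.fromBlocks_mulVec] at h
    have h' := (hsplit _ _ h).1
    rw [← m₁] at h'
    simpa [Matrix.smul_mulVec, W₁.smul_mem_iff hq] using h'
  have h₁₂ : ∀ i, ∀ x ∈ W₁, (B i)ᴴ *ᵥ x ∈ W₂ := by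
    intro i x hx
    have h := hC i _ ((m₁ x).1 hx)
    rw [blocks, Matrix.fromBlocks_mulVec] at h
    have h' := (hsplit _ _ h).2
    rw [← m₂] at h'
    simpa [Matrix.smul_mulVec, Matrix.neg_mulVec, W₂.smul_mem_iff hq] using h'
  obtain ⟨i, hi⟩ := hB.exists_ne_zero
  rcases h₁ with h₁ | h₁ <;> rcases h₂ with h₂ | h₂
  · left
    rw [eq_bot_iff]
    intro v hv
    rw [← Sum.elim_comp_inl_inr v] at hv ⊢
    obtain ⟨hx, hy⟩ := hsplit _ _ hv
    rw [← m₁, h₁, Submodule.mem_bot] at hx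
    rw [← m₂, h₂, Submodule.mem_bot] at hy
    rw [hx, hy, Submodule.mem_bot]
    exact Sum.elim_zero_zero
  · refine absurd (Matrix.ext_of_mulVec_single fun b => ?_) hi
    have h := h₂₁ i (Pi.single b 1) (h₂ ▸ Submodule.mem_top)
    rw [h₁, Submodule.mem_bot] at h
    rw [h, Matrix.zero_mulVec]
  · refine absurd (Matrix.conjTranspose_eq_zero.1 (Matrix.ext_of_mulVec_single fun b => ?_)) hi
    have h := h₁₂ i (Pi.single b 1) (h₁ ▸ Submodule.mem_top)
    rw [h₂, Submodule.mem_bot] at h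
    rw [h, Matrix.zero_mulVec]
  · right
    rw [eq_top_iff]
    intro v _
    have hx : v ∘ Sum.inl ∈ W₁ := h₁ ▸ Submodule.mem_top
    have hy : v ∘ Sum.inr ∈ W₂ := h₂ ▸ Submodule.mem_top
    convert W.add_mem ((m₁ _).1 hx) ((m₂ _).1 hy) using 1
    ext (a | a) <;> simp

theorem isIrreducible_explicit (hB : IsInvariantTriple n B) (hn : 2 ≤ n) :
    IsIrreducible (ansatz n B (fPlus n) (gExplicit n) (fMinus n)) (Set.Ioo (-1) 1) := by
  intro W hW
  have hs : Real.sqrt (2 * (n : ℝ) / ((n : ℝ) + 1)) ≠ 0 := (Real.sqrt_pos.2 (by positivity)).ne'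
  have hn1 : (n : ℂ) + 1 ≠ 0 := by exact_mod_cast n.succ_ne_zero
  have h0 : ∀ i, ∀ v ∈ W, blocks B (fPlus n 0) (gExplicit n 0) (gExplicit n 0) (fMinus n 0) i *ᵥ v
      ∈ W := by
    intro i v hv
    rw [← ansatz_eq_blocks]
    exact hW 0 (by norm_num) i v hv
  refine eq_bot_or_top_of_blocks_invariant hB ?_ W (fun i v hv => ?_) h0
  · rw [Ne, Complex.ofReal_eq_zero, gExplicit]
    simpa using hs
  · -- the generators are a combination of the values of the solution at `0` and `1 / 2`
    have h1 : totalSpin n i =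
        (3 / 2 : ℂ) • ansatz n B (fPlus n) (gExplicit n) (fMinus n) (1 / 2) i +
        (-2 : ℂ) • ansatz n B (fPlus n) (gExplicit n) (fMinus n) 0 i := by
      rw [ansatz_eq_blocks, ansatz_eq_blocks, blocks_smul, blocks_smul, blocks_add,
        ← blocks_one_eq_totalSpin (B := B)]
      simp only [fPlus, fMinus, gExplicit]
      push_cast
      congr 1
      · field_simp
        ring
      · ring
      · ring
      · field_simp
        ring
    rw [h1, Matrix.add_mulVec, Matrix.smul_mulVec, Matrix.smul_mulVec]
    exact W.add_mem (W.smul_mem _ (hW _ (by norm_num) i v hv))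
      (W.smul_mem _ (hW _ (by norm_num) i v hv))

end

/-! ### Highest weight vectors -/

section
variable {ι : Type*} [Fintype ι] [DecidableEq ι] {S : Fin 3 → Matrix ι ι ℂ} {k : ℕ} {v : ι → ℂ}

/-- `v` is annihilated by the raising component of `S` and has the highest weight of `V k`. -/
def IsHighest (S : Fin 3 → Matrix ι ι ℂ) (k : ℕ) (v : ι → ℂ) : Prop :=
  wt S *ᵥ v = (((k : ℂ) - 1) / 2) • v ∧ up S *ᵥ v = 0

/-- The normalized powers of the lowering component of `S`. Applied to a highest weight vector of
`V k` they give the basis in which the generators act by the spin matrices of size `k`. -/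
def ladder (S : Fin 3 → Matrix ι ι ℂ) (k : ℕ) : ℕ → Matrix ι ι ℂ
  | 0 => 1
  | a + 1 => (ladderCoeff k a : ℂ)⁻¹ • (down S * ladder S k a)

theorem mul_ladder_of_commute {M : Matrix ι ι ℂ} (hM : M * down S = down S * M) (a : ℕ) :
    M * ladder S k a = ladder S k a * M := by
  induction a with
  | zero => rw [ladder, Matrix.mul_one, Matrix.one_mul]
  | succ a ih =>
    rw [ladder, Matrix.mul_smul, Matrix.smul_mul, ← Matrix.mul_assoc, hM, Matrix.mul_assoc, ih,
      Matrix.mul_assoc]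

theorem wt_mulVec_ladder (hSS : IsVec S S S) (hv : IsHighest S k v) (a : ℕ) :
    wt S *ᵥ (ladder S k a *ᵥ v) = (((k : ℂ) - 1) / 2 - a) • (ladder S k a *ᵥ v) := by
  induction a with
  | zero => simp [ladder, hv.1]
  | succ a ih =>
    rw [ladder, Matrix.smul_mulVec, Matrix.mulVec_smul, smul_comm, ← Matrix.mulVec_mulVec,
      Matrix.mulVec_mulVec, hSS.ladder.2.1, Matrix.sub_mulVec, ← Matrix.mulVec_mulVec, ih,
      Matrix.mulVec_smul]
    push_cast
    module

theorem ladderCoeff_sq {k a : ℕ} (h : a < k) :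
    (ladderCoeff k a : ℂ) * ladderCoeff k a = ((a : ℂ) + 1) * ((k : ℂ) - 1 - a) := by
  have h1 : (a : ℝ) + 1 ≤ k := by exact_mod_cast h
  rw [← Complex.ofReal_mul, ladderCoeff,
    Real.mul_self_sqrt (mul_nonneg (by positivity) (by linarith))]
  push_cast
  ring

/-- Raising after lowering multiplies a ladder vector by the square of the matrix element of the
spin matrices, by induction from the commutator of the raising and lowering components. -/
theorem up_mulVec_down_ladder (hSS : IsVec S S S) (hv : IsHighest S k v) {a : ℕ} (ha : a < k) :
    up S *ᵥ (down S *ᵥ (ladder S k a *ᵥ v)) =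
      (((a : ℂ) + 1) * ((k : ℂ) - 1 - a)) • (ladder S k a *ᵥ v) := by
  have hEF : ∀ w, up S *ᵥ (down S *ᵥ w) = down S *ᵥ (up S *ᵥ w) + (2 : ℂ) • (wt S *ᵥ w) := by
    intro w
    rw [Matrix.mulVec_mulVec, hSS.ladder.2.2.2.2.2, Matrix.add_mulVec, Matrix.smul_mulVec,
      Matrix.mulVec_mulVec]
  rw [hEF, wt_mulVec_ladder hSS hv]
  cases a with
  | zero =>
    simp only [ladder, Matrix.one_mulVec, hv.2, Matrix.mulVec_zero]
    push_cast
    module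
  | succ a =>
    have ih := up_mulVec_down_ladder hSS hv (show a < k by omega)
    have h1 : down S *ᵥ (up S *ᵥ (ladder S k (a + 1) *ᵥ v)) =
        (((a : ℂ) + 1) * ((k : ℂ) - 1 - a)) • (ladder S k (a + 1) *ᵥ v) := by
      rw [ladder, Matrix.smul_mulVec, Matrix.mulVec_smul, ← Matrix.mulVec_mulVec, ih,
        Matrix.mulVec_smul, Matrix.mulVec_smul, smul_comm]
    rw [h1]
    push_cast
    module

theorem up_mulVec_ladder_succ (hSS : IsVec S S S) (hv : IsHighest S k v) {a : ℕ}
    (ha : a + 1 < k) :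
    up S *ᵥ (ladder S k (a + 1) *ᵥ v) = (ladderCoeff k a : ℂ) • (ladder S k a *ᵥ v) := by
  have h0 : (ladderCoeff k a : ℂ) ≠ 0 := Complex.ofReal_ne_zero.2 (ladderCoeff_ne_zero ha)
  rw [ladder, Matrix.smul_mulVec, Matrix.mulVec_smul, ← Matrix.mulVec_mulVec,
    up_mulVec_down_ladder hSS hv (by omega), ← ladderCoeff_sq (by omega), smul_smul,
    inv_mul_cancel_left₀ h0]

theorem down_mulVec_ladder {a : ℕ} (ha : a + 1 < k) :
    down S *ᵥ (ladder S k a *ᵥ v) = (ladderCoeff k a : ℂ) • (ladder S k (a + 1) *ᵥ v) := by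
  have h0 : (ladderCoeff k a : ℂ) ≠ 0 := Complex.ofReal_ne_zero.2 (ladderCoeff_ne_zero ha)
  rw [ladder, Matrix.smul_mulVec, smul_smul, mul_inv_cancel₀ h0, one_smul, Matrix.mulVec_mulVec]

open scoped ComplexOrder in
/-- Lowering the lowest vector gives zero: its norm is computed by raising it again, since the
raising and lowering components are adjoint to each other. -/
theorem down_mulVec_ladder_last (hS : ∀ i, (S i)ᴴ = - S i) (hSS : IsVec S S S)
    (hv : IsHighest S k v) {a : ℕ} (ha : a + 1 = k) : down S *ᵥ (ladder S k a *ᵥ v) = 0 := by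
  have h1 : up S *ᵥ (down S *ᵥ (ladder S k a *ᵥ v)) = 0 := by
    rw [up_mulVec_down_ladder hSS hv (by omega), ← ha]
    push_cast
    simp
  have h2 : (down S)ᴴ = up S := by
    rw [← conjTranspose_up hS, Matrix.conjTranspose_conjTranspose]
  rw [← dotProduct_star_self_eq_zero, Matrix.star_mulVec, h2,
    ← Matrix.dotProduct_mulVec, h1, dotProduct_zero]

theorem ladder_mulVec_ne_zero (hSS : IsVec S S S) (hv : IsHighest S k v) (h0 : v ≠ 0) {a : ℕ}
    (ha : a < k) : ladder S k a *ᵥ v ≠ 0 := by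
  induction a with
  | zero => simpa [ladder] using h0
  | succ a ih =>
    intro h1
    have h2 := up_mulVec_ladder_succ hSS hv ha
    rw [h1, Matrix.mulVec_zero, eq_comm, smul_eq_zero, Complex.ofReal_eq_zero] at h2
    exact h2.elim (ladderCoeff_ne_zero ha) (ih (by omega))

/-- The matrix whose columns are the ladder vectors over `v`. -/
def ladderMatrix (S : Fin 3 → Matrix ι ι ℂ) (k : ℕ) (v : ι → ℂ) : Matrix ι (Fin k) ℂ :=
  Matrix.of fun x a => (ladder S k a *ᵥ v) x

theorem ladderMatrix_mulVec_single (a : Fin k) :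
    ladderMatrix S k v *ᵥ Pi.single a 1 = ladder S k a *ᵥ v := by
  rw [Matrix.mulVec_single_one]
  rfl

/-- The ladder vectors over a highest weight vector span a copy of `V k`. -/
theorem mul_ladderMatrix (hS : ∀ i, (S i)ᴴ = - S i) (hSS : IsVec S S S) (hv : IsHighest S k v)
    (i : Fin 3) : S i * ladderMatrix S k v = ladderMatrix S k v * spinMatrix k i := by
  refine sub_eq_zero.1 (eq_zero_of_ladder
    (C := fun i => S i * ladderMatrix S k v - ladderMatrix S k v * spinMatrix k i) ?_ ?_ ?_ i)
  · have e : up (fun i => S i * ladderMatrix S k v - ladderMatrix S k v * spinMatrix k i) =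
        up S * ladderMatrix S k v - ladderMatrix S k v * up (spinMatrix k) := by
      simp only [up, Matrix.sub_mul, Matrix.mul_sub, Matrix.smul_mul, Matrix.mul_smul]
      module
    rw [e, up_spinMatrix, sub_eq_zero]
    refine Matrix.ext_of_mulVec_single fun a => ?_
    rw [← Matrix.mulVec_mulVec, ← Matrix.mulVec_mulVec, ladderMatrix_mulVec_single]
    obtain ⟨a, ha⟩ := a
    cases a with
    | zero =>
      rw [raising_mulVec_single_zero ha, Matrix.mulVec_zero]
      simp [ladder, hv.2]
    | succ a =>
      have h := raising_mulVec_single_succ (k := k) ⟨a, by omega⟩ ha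
      rw [h, Matrix.mulVec_smul, ladderMatrix_mulVec_single]
      exact up_mulVec_ladder_succ hSS hv ha
  · have e : down (fun i => S i * ladderMatrix S k v - ladderMatrix S k v * spinMatrix k i) =
        down S * ladderMatrix S k v - ladderMatrix S k v * down (spinMatrix k) := by
      simp only [down, Matrix.sub_mul, Matrix.mul_sub, Matrix.smul_mul, Matrix.mul_smul,
        Matrix.neg_mul, Matrix.mul_neg]
      module
    rw [e, down_spinMatrix, sub_eq_zero]
    refine Matrix.ext_of_mulVec_single fun a => ?_
    rw [← Matrix.mulVec_mulVec, ← Matrix.mulVec_mulVec, ladderMatrix_mulVec_single]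
    by_cases ha : (a : ℕ) + 1 < k
    · rw [raising_transpose_mulVec_single a ha, Matrix.mulVec_smul, ladderMatrix_mulVec_single,
        down_mulVec_ladder ha]
    · rw [raising_transpose_mulVec_single_last a ha, Matrix.mulVec_zero,
        down_mulVec_ladder_last hS hSS hv (by have := a.2; omega)]
  · have e : wt (fun i => S i * ladderMatrix S k v - ladderMatrix S k v * spinMatrix k i) =
        wt S * ladderMatrix S k v - ladderMatrix S k v * wt (spinMatrix k) := by
      simp only [wt, Matrix.smul_mul, Matrix.mul_smul, smul_sub]
    rw [e, wt_spinMatrix, sub_eq_zero]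
    refine Matrix.ext_of_mulVec_single fun a => ?_
    rw [← Matrix.mulVec_mulVec, ← Matrix.mulVec_mulVec, ladderMatrix_mulVec_single,
      wt_mulVec_ladder hSS hv, weight, Matrix.diagonal_mulVec_single, ← smul_eq_mul,
      Pi.single_smul, Matrix.mulVec_smul, ladderMatrix_mulVec_single]

end

/-! ### Two commuting actions -/

/-- A square intertwining matrix with linearly independent columns gives an isomorphism. -/
theorem Rep.iso_of_linearIndependent {ι κ : Type*} [Fintype ι] [DecidableEq ι] [Fintype κ]
    [DecidableEq κ] {σ : Rep ι} {τ : Rep κ} (Φ : Matrix ι κ ℂ)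
    (hΦ : LinearIndependent ℂ fun a x => Φ x a) (hcard : Fintype.card κ = Fintype.card ι)
    (h : ∀ i, σ (X i) * Φ = Φ * τ (X i)) : σ.Iso τ := by
  have hA : ∀ A, σ A * Φ = Φ * τ A := by
    intro A
    rw [Rep.apply_eq_sum σ, Rep.apply_eq_sum τ]
    simp only [Matrix.add_mul, Matrix.mul_add, Matrix.smul_mul, Matrix.mul_smul, h]
  have : Module.finrank ℂ (ι → ℂ) = Fintype.card κ := by
    rw [Module.finrank_fintype_fun_eq_card, hcard]
  by_cases hκ : Nonempty κ
  · let b := basisOfLinearIndependentOfCardEqFinrank hΦ this.symm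
    have hb : ∀ u : κ → ℂ, b.equivFun.symm u = Φ *ᵥ u := by
      intro u
      rw [Module.Basis.equivFun_symm_apply]
      ext x
      simp [b, Matrix.mulVec, dotProduct, mul_comm]
    refine ⟨b.equivFun, fun A v => ?_⟩
    rw [← LinearEquiv.eq_symm_apply, hb, Matrix.mulVec_mulVec, ← hA, ← Matrix.mulVec_mulVec, ← hb,
      LinearEquiv.symm_apply_apply]
  · have h1 : IsEmpty κ := not_nonempty_iff.1 hκ
    have h2 : IsEmpty ι := by
      rw [← Fintype.card_eq_zero_iff, ← hcard, Fintype.card_eq_zero_iff]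
      exact h1
    exact ⟨LinearEquiv.ofFinrankEq _ _ (by simp), fun A v => Subsingleton.elim _ _⟩

section
variable {ι : Type*} [Fintype ι] [DecidableEq ι] {L S : Fin 3 → Matrix ι ι ℂ} {k m : ℕ}
  {v : ι → ℂ}

/-- If two commuting actions have a common highest weight vector, of the weights of `V k` and
`V m`, and the dimension is `k * m`, then the space is `V k ⊗ V m`; hence the first action
is a sum of `m` copies of `V k`. -/
theorem iso_copies_of_commute (hL : ∀ i, (L i)ᴴ = - L i) (hLL : IsVec L L L)
    (hSS : IsVec S S S) (hLS : ∀ i j, L i * S j = S j * L i) (h0 : v ≠ 0)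
    (hvL : IsHighest L k v) (hvS : IsHighest S m v) (hcard : k * m = Fintype.card ι)
    {σ : Rep ι} (hσ : ∀ i, σ (X i) = L i) : σ.Iso ((V k).copies m) := by
  have hLd : ∀ i, L i * down S = down S * L i := by
    intro i
    simp only [down, Matrix.mul_sub, Matrix.sub_mul, Matrix.mul_neg, Matrix.neg_mul,
      Matrix.mul_smul, Matrix.smul_mul, hLS]
  have hSd : ∀ i, S i * down L = down L * S i := by
    intro i
    simp only [down, Matrix.mul_sub, Matrix.sub_mul, Matrix.mul_neg, Matrix.neg_mul,
      Matrix.mul_smul, Matrix.smul_mul, hLS]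
  have hwtL : wt L * down S = down S * wt L := by
    simp only [wt, Matrix.smul_mul, Matrix.mul_smul, hLd]
  have hwtS : wt S * down L = down L * wt S := by
    simp only [wt, Matrix.smul_mul, Matrix.mul_smul, hSd]
  have hupS : up S * down L = down L * up S := by
    simp only [up, Matrix.mul_sub, Matrix.sub_mul, Matrix.mul_smul, Matrix.smul_mul, hSd]
  have hS' : ∀ a, IsHighest S m (ladder L k a *ᵥ v) := by
    intro a
    constructor
    · rw [Matrix.mulVec_mulVec, mul_ladder_of_commute hwtS, ← Matrix.mulVec_mulVec, hvS.1,
        Matrix.mulVec_smul]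
    · rw [Matrix.mulVec_mulVec, mul_ladder_of_commute hupS, ← Matrix.mulVec_mulVec, hvS.2,
        Matrix.mulVec_zero]
  -- the ladder vectors of both actions over the common highest weight vector
  let w : Fin k × Fin m → ι → ℂ := fun x => ladder S m x.2 *ᵥ (ladder L k x.1 *ᵥ v)
  refine Rep.iso_of_linearIndependent (Matrix.of fun y x => w x y) ?_ (by simpa using hcard) ?_
  · -- the vectors are eigenvectors of `wt L + k * wt S`, with distinct eigenvalues
    refine Module.End.eigenvectors_linearIndependent' (Matrix.toLin' (wt L + (k : ℂ) • wt S))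
      (fun x => (((k : ℂ) - 1) / 2 - (x.1 : ℕ)) + k * (((m : ℂ) - 1) / 2 - (x.2 : ℕ)))
      (fun x y hxy => ?_) _ fun x => ?_
    · have h1 : (((x.1 : ℕ) + k * (x.2 : ℕ) : ℕ) : ℂ) = (((y.1 : ℕ) + k * (y.2 : ℕ) : ℕ) : ℂ) := by
        push_cast
        simp only at hxy
        linear_combination -hxy
      have h2 : (x.1 : ℕ) + k * (x.2 : ℕ) = (y.1 : ℕ) + k * (y.2 : ℕ) := by exact_mod_cast h1
      have h3 := congrArg (· % k) h2
      simp only [Nat.add_mul_mod_self_left, Nat.mod_eq_of_lt x.1.2, Nat.mod_eq_of_lt y.1.2] at h3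
      rw [h3] at h2
      have h4 := Nat.eq_of_mul_eq_mul_left (lt_of_le_of_lt (Nat.zero_le _) x.1.2)
        (Nat.add_left_cancel h2)
      exact Prod.ext (Fin.ext h3) (Fin.ext h4)
    · refine ⟨?_, ladder_mulVec_ne_zero hSS (hS' _)
        (ladder_mulVec_ne_zero hLL hvL h0 x.1.2) x.2.2⟩
      rw [Module.End.mem_eigenspace_iff, Matrix.toLin'_apply, Matrix.add_mulVec,
        Matrix.smul_mulVec]
      change wt L *ᵥ (ladder S m x.2 *ᵥ (ladder L k x.1 *ᵥ v)) +
        (k : ℂ) • wt S *ᵥ (ladder S m x.2 *ᵥ (ladder L k x.1 *ᵥ v)) =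
        _ • (ladder S m x.2 *ᵥ (ladder L k x.1 *ᵥ v))
      rw [wt_mulVec_ladder hSS (hS' _), Matrix.mulVec_mulVec, mul_ladder_of_commute hwtL,
        ← Matrix.mulVec_mulVec, wt_mulVec_ladder hLL hvL, Matrix.mulVec_smul]
      module
  · intro i
    have key : ∀ s : Fin m, L i * (ladder S m s * ladderMatrix L k v) =
        ladder S m s * ladderMatrix L k v * spinMatrix k i := by
      intro s
      rw [← Matrix.mul_assoc, mul_ladder_of_commute (hLd i), Matrix.mul_assoc,
        mul_ladderMatrix hL hLL hvL, Matrix.mul_assoc]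
    have hcol : ∀ y c s, w (c, s) y = (ladder S m s * ladderMatrix L k v) y c := fun _ _ _ => rfl
    have hτ : (V k).copies m (X i) = Matrix.blockDiagonal fun _ => spinMatrix k i := by
      rw [← V_X]
      rfl
    rw [hσ, hτ]
    ext y ⟨c, s⟩
    have h1 := congrFun (congrFun (key s) y) c
    rw [Matrix.mul_apply] at h1 ⊢
    simp only [Matrix.of_apply, hcol]
    rw [h1, Matrix.mul_apply, Matrix.mul_apply, Fintype.sum_prod_type]
    refine Finset.sum_congr rfl fun c' _ => ?_
    simp [Matrix.blockDiagonal_apply]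

end

/-! ### The induced representations of the explicit solution -/

/-- A triple that is its own cross product obeys the commutator relations of `so(3)`. -/
theorem isVec_self_of_cross {ι : Type*} [Fintype ι] {L : Fin 3 → Matrix ι ι ℂ}
    (h : ∀ i, cross L L i = L i) : IsVec L L L := by
  have h0 := h 0
  have h1 := h 1
  have h2 := h 2
  rw [cross_zero, sub_eq_iff_eq_add'] at h0
  rw [cross_one, sub_eq_iff_eq_add'] at h1
  rw [cross_two, sub_eq_iff_eq_add'] at h2
  rw [isVec_iff]
  exact ⟨⟨rfl, rfl, rfl⟩, ⟨h2, h0, h1⟩, ⟨eq_sub_of_add_eq h2.symm, eq_sub_of_add_eq h0.symm,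
    eq_sub_of_add_eq h1.symm⟩⟩

theorem Rep.ofTriple_X {ι : Type*} [Fintype ι] [DecidableEq ι] (Y : Fin 3 → Matrix ι ι ℂ)
    (h01 : ⁅Y 0, Y 1⁆ = Y 2) (h12 : ⁅Y 1, Y 2⁆ = Y 0) (h20 : ⁅Y 2, Y 0⁆ = Y 1) (i : Fin 3) :
    Rep.ofTriple Y h01 h12 h20 (X i) = Y i := by
  fin_cases i <;> simp [Rep.ofTriple, X, eps] <;> norm_num

theorem exists_rep_of_cross {ι : Type*} [Fintype ι] [DecidableEq ι] {L : Fin 3 → Matrix ι ι ℂ}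
    (h : ∀ i, cross L L i = L i) : ∃ σ : Rep ι, ∀ i, σ (X i) = L i := by
  have h0 := h 0
  have h1 := h 1
  have h2 := h 2
  rw [cross_zero] at h0
  rw [cross_one] at h1
  rw [cross_two] at h2
  exact ⟨Rep.ofTriple L h2 h0 h1, Rep.ofTriple_X L h2 h0 h1⟩

section
variable {n : ℕ} {B : Fin 3 → Matrix (Fin (n + 2)) (Fin n) ℂ}

/-- The highest weight vector of the summand `V (n + 2)`. -/
def topVector (n : ℕ) : Fin (n + 2) ⊕ Fin n → ℂ := Sum.elim (Pi.single 0 1) 0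

theorem topVector_ne_zero (n : ℕ) : topVector n ≠ 0 := by
  intro h
  have h1 := congrFun h (Sum.inl 0)
  simp [topVector] at h1

/-- No weight of `V n` is high enough for the off-diagonal blocks to act nontrivially on the
highest weight vector of `V (n + 2)`. -/
theorem isHighest_topVector (hB : IsInvariantTriple n B) {p q q' r : ℂ} {k : ℕ}
    (hp : p * ((n : ℂ) + 1) = (k : ℂ) - 1) : IsHighest (blocks B p q q' r) k (topVector n) := by
  have hC := hB.isVec_conjTranspose
  have hu : up (fun i => (B i)ᴴ) *ᵥ Pi.single 0 1 = 0 := by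
    ext a
    rw [Matrix.mulVec_single_one]
    exact hC.up_apply_eq_zero (e := 2) rfl a 0 (by simp)
  have hw : (B 0)ᴴ *ᵥ Pi.single 0 1 = 0 := by
    ext a
    rw [Matrix.mulVec_single_one, Matrix.col_apply]
    have h1 := hC 0 0
    simp [eps, spinMatrix] at h1
    have h2 := congrFun (congrFun h1 a) 0
    simp only [Matrix.sub_apply, Matrix.diagonal_mul, Matrix.mul_diagonal, Matrix.zero_apply] at h2
    have h3 : ((a : ℕ) : ℂ) + 1 ≠ 0 := by exact_mod_cast Nat.succ_ne_zero (a : ℕ)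
    refine (mul_eq_zero.1 (?_ : ((B 0)ᴴ) a 0 * (((a : ℕ) : ℂ) + 1) = 0)).resolve_right h3
    rw [Fin.val_zero, Nat.cast_zero] at h2
    linear_combination Complex.I * h2 + ((B 0)ᴴ) a 0 * (((a : ℕ) : ℂ) + 1) * Complex.I_mul_I
  have hblk : ∀ i, blocks B p q q' r i *ᵥ topVector n =
      Sum.elim (p • (spinMatrix (n + 2) i *ᵥ Pi.single 0 1))
        (-(q' • ((B i)ᴴ *ᵥ Pi.single 0 1))) := by
    intro i
    rw [blocks, topVector, Matrix.fromBlocks_mulVec, Sum.elim_comp_inl, Sum.elim_comp_inr,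
      Matrix.mulVec_zero, Matrix.mulVec_zero, add_zero, add_zero, Matrix.smul_mulVec,
      Matrix.neg_mulVec, Matrix.smul_mulVec]
  constructor
  · have h1 : spinMatrix (n + 2) 0 *ᵥ (Pi.single 0 1 : Fin (n + 2) → ℂ) =
        (Complex.I / 2 * ((n : ℂ) + 1)) • (Pi.single 0 1 : Fin (n + 2) → ℂ) := by
      rw [spinMatrix, Matrix.cons_val_zero, Matrix.diagonal_mulVec_single, ← smul_eq_mul,
        Pi.single_smul]
      congr 1
      rw [Fin.val_zero]
      push_cast
      ring
    rw [wt, Matrix.smul_mulVec, hblk, hw, h1, ← hp]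
    ext (a | a)
    · simp only [topVector, Pi.smul_apply, Sum.elim_inl, smul_eq_mul]
      linear_combination -(p * ((n : ℂ) + 1) / 2 * (Pi.single 0 1 : Fin (n + 2) → ℂ) a) *
        Complex.I_mul_I
    · simp [topVector]
  · have h1 : spinMatrix (n + 2) 1 *ᵥ Pi.single 0 1 -
        Complex.I • (spinMatrix (n + 2) 2 *ᵥ Pi.single 0 1) = 0 := by
      rw [← raising_mulVec_single_zero (k := n + 2) (by omega), ← up_spinMatrix, up,
        Matrix.sub_mulVec, Matrix.smul_mulVec]
      rfl
    rw [up, Matrix.sub_mulVec, Matrix.smul_mulVec] at hu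
    rw [up, Matrix.sub_mulVec, Matrix.smul_mulVec, hblk, hblk]
    ext (a | a)
    · have h2 := congrFun h1 a
      simp only [Pi.sub_apply, Pi.smul_apply, Pi.zero_apply, Sum.elim_inl, smul_eq_mul] at h2 ⊢
      linear_combination p * h2
    · have h2 := congrFun hu a
      simp only [Pi.sub_apply, Pi.smul_apply, Pi.neg_apply, Pi.zero_apply, Sum.elim_inr,
        smul_eq_mul] at h2 ⊢
      linear_combination -q' * h2

/-- If one of two triples of block matrices obeys the relations of `so(3)` and their sum is the
triple of generators, then the two triples commute. -/
theorem commute_of_add_eq_totalSpin (hB : IsInvariantTriple n B) {p q r p' q' r' : ℂ}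
    (hp : p + p' = 1) (hq : q + q' = 0) (hr : r + r' = 1)
    (h : IsVec (blocks B p q q r) (blocks B p q q r) (blocks B p q q r)) (i j : Fin 3) :
    blocks B p q q r i * blocks B p' q' q' r' j = blocks B p' q' q' r' j * blocks B p q q r i := by
  have h1 : ∀ j, blocks B p' q' q' r' j = totalSpin n j - blocks B p q q r j := by
    intro j
    rw [eq_sub_iff_add_eq, blocks_add, ← blocks_one_eq_totalSpin (B := B)]
    congr 1 <;> first | linear_combination hp | linear_combination hq | linear_combination hr
  have h2 := isVec_blocks hB p q q r j i
  rw [← h j i] at h2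
  rw [h1, Matrix.mul_sub, Matrix.sub_mul, ← sub_eq_zero]
  rw [← sub_eq_zero] at h2
  rw [← neg_eq_zero, ← h2]
  abel

/-- The criterion for the representation that the block matrices `blocks B p q q r` generate to be
a sum of `m` copies of `V k`: the complement `blocks B p' q' q' r'` in the total spin generates a
commuting action. -/
theorem exists_rep_iso_copies (hB : IsInvariantTriple n B) {p q r p' q' r' : ℝ} {k m : ℕ}
    (hp : p + p' = 1) (hq : q + q' = 0) (hr : r + r' = 1)
    (hL : ∀ i, cross (blocks B p q q r) (blocks B p q q r) i = blocks B p q q r i)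
    (hS : ∀ i, cross (blocks B p' q' q' r') (blocks B p' q' q' r') i = blocks B p' q' q' r' i)
    (hk : p * ((n : ℝ) + 1) = (k : ℝ) - 1) (hm : p' * ((n : ℝ) + 1) = (m : ℝ) - 1)
    (hcard : k * m = 2 * (n + 1)) :
    ∃ σ : Rep (Fin (n + 2) ⊕ Fin n), (∀ i, σ (X i) = blocks B p q q r i) ∧
      σ.Iso ((V k).copies m) := by
  obtain ⟨σ, hσ⟩ := exists_rep_of_cross hL
  refine ⟨σ, hσ, iso_copies_of_commute (fun i => (isSu_blocks hB p q r i).1)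
    (isVec_self_of_cross hL) (isVec_self_of_cross hS)
    (commute_of_add_eq_totalSpin hB (by exact_mod_cast hp) (by exact_mod_cast hq)
      (by exact_mod_cast hr) (isVec_self_of_cross hL)) (topVector_ne_zero n)
    (isHighest_topVector hB (by exact_mod_cast congrArg (Complex.ofReal) hk))
    (isHighest_topVector hB (by exact_mod_cast congrArg (Complex.ofReal) hm)) ?_ hσ⟩
  simp only [Fintype.card_sum, Fintype.card_fin]
  omega

/-- The equations for real coefficients under which the block matrices obey the relations of
`so(3)`. -/
theorem cross_blocks_real (hB : IsInvariantTriple n B) (hn : 2 ≤ n) {p q r : ℝ}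
    (h1 : p ^ 2 + 2 / ((n : ℝ) + 1) * q ^ 2 = p)
    (h2 : ((n : ℝ) + 3) / 2 * p - ((n : ℝ) - 1) / 2 * r = 1)
    (h3 : r ^ 2 - 2 * ((n : ℝ) + 2) / ((n : ℝ) * ((n : ℝ) + 1)) * q ^ 2 = r) (i : Fin 3) :
    cross (blocks B p q q r) (blocks B p q q r) i = blocks B p q q r i := by
  rw [cross_blocks hB hn]
  have h1' := congrArg Complex.ofReal h1
  have h2' := congrArg Complex.ofReal h2
  have h3' := congrArg Complex.ofReal h3
  push_cast at h1' h2' h3'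
  rw [← sq, h1', h2', h3', one_mul]

/-- The negative residues at `1` obey the relations of `so(3)`; here `q` is either square root. -/
theorem cross_residue_one (hB : IsInvariantTriple n B) (hn : 2 ≤ n) {q : ℝ}
    (hq : q ^ 2 = (n : ℝ) / (2 * ((n : ℝ) + 1))) (i : Fin 3) :
    cross (blocks B ((n : ℝ) / ((n : ℝ) + 1) : ℝ) q q (((n : ℝ) + 2) / ((n : ℝ) + 1) : ℝ))
      (blocks B ((n : ℝ) / ((n : ℝ) + 1) : ℝ) q q (((n : ℝ) + 2) / ((n : ℝ) + 1) : ℝ)) i =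
    blocks B ((n : ℝ) / ((n : ℝ) + 1) : ℝ) q q (((n : ℝ) + 2) / ((n : ℝ) + 1) : ℝ) i := by
  have h1 : (n : ℝ) + 1 ≠ 0 := by positivity
  have h2 : (n : ℝ) ≠ 0 := by positivity
  refine cross_blocks_real hB hn ?_ ?_ ?_ i
  · rw [hq]
    field_simp
  · field_simp
    ring
  · rw [hq]
    field_simp
    ring

/-- The negative residues at `-1` obey the relations of `so(3)`. -/
theorem cross_residue_neg_one (hB : IsInvariantTriple n B) (hn : 2 ≤ n) {q : ℝ}
    (hq : q ^ 2 = (n : ℝ) / (2 * ((n : ℝ) + 1))) (i : Fin 3) :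
    cross (blocks B (1 / ((n : ℝ) + 1) : ℝ) q q (-(1 / ((n : ℝ) + 1)) : ℝ))
      (blocks B (1 / ((n : ℝ) + 1) : ℝ) q q (-(1 / ((n : ℝ) + 1)) : ℝ)) i =
    blocks B (1 / ((n : ℝ) + 1) : ℝ) q q (-(1 / ((n : ℝ) + 1)) : ℝ) i := by
  have h1 : (n : ℝ) + 1 ≠ 0 := by positivity
  have h2 : (n : ℝ) ≠ 0 := by positivity
  refine cross_blocks_real hB hn ?_ ?_ ?_ i
  · rw [hq]
    field_simp
    ring
  · field_simp
    ring
  · rw [hq]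
    field_simp
    ring

theorem residuesInduce_one (hB : IsInvariantTriple n B) (hn : 2 ≤ n) :
    ResiduesInduce (ansatz n B (fPlus n) (gExplicit n) (fMinus n)) 1 ((V (n + 1)).copies 2) := by
  have h1 : (n : ℝ) + 1 ≠ 0 := by positivity
  have hs : Real.sqrt ((n : ℝ) / (2 * ((n : ℝ) + 1))) ^ 2 = (n : ℝ) / (2 * ((n : ℝ) + 1)) :=
    Real.sq_sqrt (by positivity)
  obtain ⟨σ, hσ, hiso⟩ := exists_rep_iso_copies (k := n + 1) (m := 2) hB
    (p := (n : ℝ) / ((n : ℝ) + 1)) (p' := 1 / ((n : ℝ) + 1)) (by field_simp)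
    (neg_add_cancel _) (by field_simp; ring) (cross_residue_one hB hn (by rw [neg_sq, hs]))
    (cross_residue_neg_one hB hn hs) (by push_cast; field_simp; ring)
    (by push_cast; field_simp; norm_num) (by ring)
  refine ⟨_, σ, hasResidue_ansatz_apply (hasResidue_fPlus_one n) (hasResidue_gExplicit_one n)
    (hasResidue_fMinus_one n), fun i => ?_, hiso⟩
  rw [hσ, blocks_neg]
  push_cast
  simp only [neg_neg]

theorem residuesInduce_neg_one (hB : IsInvariantTriple n B) (hn : 2 ≤ n) :
    ResiduesInduce (ansatz n B (fPlus n) (gExplicit n) (fMinus n)) (-1)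
      ((V 2).copies (n + 1)) := by
  have h1 : (n : ℝ) + 1 ≠ 0 := by positivity
  have hs : Real.sqrt ((n : ℝ) / (2 * ((n : ℝ) + 1))) ^ 2 = (n : ℝ) / (2 * ((n : ℝ) + 1)) :=
    Real.sq_sqrt (by positivity)
  obtain ⟨σ, hσ, hiso⟩ := exists_rep_iso_copies (k := 2) (m := n + 1) hB
    (p := 1 / ((n : ℝ) + 1)) (p' := (n : ℝ) / ((n : ℝ) + 1)) (by field_simp; ring)
    (add_neg_cancel _) (by field_simp; ring) (cross_residue_neg_one hB hn hs)
    (cross_residue_one hB hn (by rw [neg_sq, hs])) (by push_cast; field_simp; norm_num)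
    (by push_cast; field_simp; ring) rfl
  refine ⟨_, σ, hasResidue_ansatz_apply (hasResidue_fPlus_neg_one n)
    (hasResidue_gExplicit_neg_one n) (hasResidue_fMinus_neg_one n), fun i => ?_, hiso⟩
  rw [hσ, blocks_neg]
  push_cast
  simp only [neg_neg]

end

end Nahm

end

theorem mainTheorem2 (n : ℕ) (hn : 2 ≤ n) :
    -- the normalized invariant triple exists
    (∃ B : Fin 3 → Matrix (Fin (n + 2)) (Fin n) ℂ, Nahm.IsInvariantTriple n B) ∧
    ∀ B : Fin 3 → Matrix (Fin (n + 2)) (Fin n) ℂ, Nahm.IsInvariantTriple n B →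
      -- the form of the spherically symmetric solutions and the reduced equations
      (∀ (I : Set ℝ)
        (T : ℝ → Fin 3 → Matrix (Fin (n + 2) ⊕ Fin n) (Fin (n + 2) ⊕ Fin n) ℂ)
        (ρ : Nahm.Rep (Fin (n + 2) ⊕ Fin n)),
        IsOpen I → IsConnected I → Nahm.IsNahmSolution T I →
        Nahm.GeneratesSymmetry ρ T I →
        ρ.Iso ((Nahm.V (n + 2)).sum (Nahm.V n)) →
        ∃ U ∈ Matrix.specialUnitaryGroup (Fin (n + 2) ⊕ Fin n) ℂ, ∃ fp g fm : ℝ → ℝ,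
          AnalyticOnNhd ℝ fp I ∧ AnalyticOnNhd ℝ g I ∧ AnalyticOnNhd ℝ fm I ∧
          (∀ A, U * ρ A * Uᴴ = (Nahm.V (n + 2)).sum (Nahm.V n) A) ∧
          (∀ t ∈ I, ∀ i, U * T t i * Uᴴ = Nahm.ansatz n B fp g fm t i) ∧
          Nahm.SolvesReduced n fp g fm I) ∧
      -- the explicit solution is maximal, and its Nahm datum is spherically symmetric
      -- and irreducible
      Nahm.IsMaximalReduced n (Nahm.fPlus n) (Nahm.gExplicit n) (Nahm.fMinus n)
        (Set.Ioo (-1) 1) ∧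
      Nahm.IsNahmSolution
        (Nahm.ansatz n B (Nahm.fPlus n) (Nahm.gExplicit n) (Nahm.fMinus n)) (Set.Ioo (-1) 1) ∧
      Nahm.GeneratesSymmetry ((Nahm.V (n + 2)).sum (Nahm.V n))
        (Nahm.ansatz n B (Nahm.fPlus n) (Nahm.gExplicit n) (Nahm.fMinus n)) (Set.Ioo (-1) 1) ∧
      Nahm.IsSphericallySymmetric
        (Nahm.ansatz n B (Nahm.fPlus n) (Nahm.gExplicit n) (Nahm.fMinus n)) (Set.Ioo (-1) 1) ∧
      Nahm.IsIrreducible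
        (Nahm.ansatz n B (Nahm.fPlus n) (Nahm.gExplicit n) (Nahm.fMinus n)) (Set.Ioo (-1) 1) ∧
      -- the residues of the three functions
      Nahm.HasResidue (Nahm.fPlus n) 1 (-((n : ℝ) / ((n : ℝ) + 1))) ∧
      Nahm.HasResidue (Nahm.fPlus n) (-1) (-(1 / ((n : ℝ) + 1))) ∧
      Nahm.HasResidue (Nahm.fMinus n) 1 (-(((n : ℝ) + 2) / ((n : ℝ) + 1))) ∧
      Nahm.HasResidue (Nahm.fMinus n) (-1) (1 / ((n : ℝ) + 1)) ∧
      Nahm.HasResidue (Nahm.gExplicit n) 1 (Real.sqrt ((n : ℝ) / (2 * ((n : ℝ) + 1)))) ∧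
      Nahm.HasResidue (Nahm.gExplicit n) (-1) (-Real.sqrt ((n : ℝ) / (2 * ((n : ℝ) + 1)))) ∧
      -- the representations induced by the residues of the Nahm datum
      Nahm.ResiduesInduce
        (Nahm.ansatz n B (Nahm.fPlus n) (Nahm.gExplicit n) (Nahm.fMinus n)) 1
        ((Nahm.V (n + 1)).copies 2) ∧
      Nahm.ResiduesInduce
        (Nahm.ansatz n B (Nahm.fPlus n) (Nahm.gExplicit n) (Nahm.fMinus n)) (-1)
        ((Nahm.V 2).copies (n + 1)) := by
  refine ⟨Nahm.exists_isInvariantTriple n hn, fun B hB => ⟨fun I T ρ hI hI' hT hρ hiso =>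
    Nahm.exists_gauge_ansatz hB hn hI hI' hT hρ hiso, Nahm.isMaximalReduced_explicit hn,
    (Nahm.solvesReduced_explicit hn).isNahmSolution hB hn,
    Nahm.generatesSymmetry_ansatz hB _ _ _ _,
    (Nahm.generatesSymmetry_ansatz hB _ _ _ _).isSphericallySymmetric,
    Nahm.isIrreducible_explicit hB hn, Nahm.hasResidue_fPlus_one n,
    Nahm.hasResidue_fPlus_neg_one n, Nahm.hasResidue_fMinus_one n,
    Nahm.hasResidue_fMinus_neg_one n, Nahm.hasResidue_gExplicit_one n,
    Nahm.hasResidue_gExplicit_neg_one n, Nahm.residuesInduce_one hB hn,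
    Nahm.residuesInduce_neg_one hB hn⟩⟩
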